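/- **Setting.** Let $g\ge 3$ and let $D=\operatorname{diag}(d_1,\dots,d_g)$ with positive integers $d_1\mid d_2\mid\dots\mid d_g$; put $d=d_1\cdots d_g$ and $\mathbb Z_D=\mathbb Z/d_1\oplus\dots\oplus\mathbb Z/d_g$ (represented by the $m\in\mathbb Z^g$ with $0\le m_i<d_i$). Let $\mathfrak H_g$ be the Siegel upper half space. For $Z\in\mathfrak H_g$ let $\Lambda_Z=Z\mathbb Z^g+D\mathbb Z^g$, $X_Z=\mathbb C^g/\Lambda_Z$, $H(v,w)={}^tv(\operatorname{Im}Z)^{-1}\bar w$, $B(v,w)={}^tv(\operatorname{Im}Z)^{-1}w$, $E=\operatorname{Im}H$, write $v=Zv^1+v^2$ with $v^1,v^2\in\mathbb R^g$, and put $\chi_0(v)=e^{\pi iE(Zv^1,v^2)}$. The line bundle $L(H,\chi_0|_{\Lambda_Z})$ on $X_Z$ is the one of characteristic $0$ (Appell–Humbert data); a line bundle is *totally symmetric* if it is the square of a line bundle $N$ with $(-1)^*N\cong N$. For $c,w\in\mathbb C^g$ define $$\theta^c_0(v)=e^{-\pi H(v,c)-\frac{\pi}{2}H(c,c)+\frac{\pi}{2}B(v+c,v+c)}\sum_{l\in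 Z\mathbb Z^g}e^{\pi(H-B)(v+c,l)-\frac{\pi}{2}(H-B)(l,l)},$$ $$\theta^c_w(v)=\Big(\chi_0(w)\,e^{2\pi iE(c,w)}\,e^{\pi H(v,w)+\frac{\pi}{2}H(w,w)}\Big)^{-1}\theta^c_0(v+w).$$ Let $M=\begin{pmatrix}\alpha&\beta\\ \gamma&\delta\end{pmatrix}\in \mathrm{Sp}_{2g}(\mathbb Q)$ be of the form $\begin{pmatrix}1&0\\0&D\end{pmatrix}^{-1}R\begin{pmatrix}1&0\\0&D\end{pmatrix}$ with $R\in M_{2g}(\mathbb Z)$ and $R\begin{pmatrix}0&D\\-D&0\end{pmatrix}{}^tR=\begin{pmatrix}0&D\\-D&0\end{pmatrix}$. Put $Z'=M(Z)=(\alpha Z+\beta)(\gamma Z+\delta)^{-1}$ and let $\psi:X_{Z'}\to X_Z$ be the isomorphism given by $v\mapsto{}^t(\gamma Z+\delta)v$. Let $M[0]=(M[0]^1,M[0]^2)$ with $M[0]^1=\frac12(D\gamma\,{}^t\delta)_0$, $M[0]^2=\frac12(\alpha\,{}^t\beta)_0$, where $(\ )_0$ is the diagonal vector. Let $\kappa=(\kappa^1,\kappa^2)$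 be $M[0]$ or $0$ (when $L(H,\chi_0)$ is totally symmetric, both give the characteristic of $\psi^*L(H,\chi_0)$), and put $c'=Z'\kappa^1+\kappa^2$. Consider the bases of canonical theta functions $B^Z=(\theta^{0}_{ZD^{-1}m})_{m\in\mathbb Z_D}$ (for $Z$) and $B^{Z'}=(\theta^{c'}_{Z'D^{-1}n})_{n\in\mathbb Z_D}$ (for $Z'$). **Proposition.** There is a continuous branch $Z\mapsto\det(\gamma Z+\delta)^{1/2}$ on $\mathfrak H_g$. For each such branch and each of the two choices of $\kappa$ there is a complex $d\times d$ matrix $C_M$, independent of $Z$, with the following properties. 1. For every $Z\in\mathfrak H_g$ such that $L(H,\chi_0)$ on $X_Z$ is totally symmetric, there is exactly one matrix $C$ with $\psi^*B^Z=C\,B^{Z'}$, namely $C=\det(\gamma Z+\delta)^{-1/2}\,C_M$. 2. If it is not the case that both $3\mid d_g$ and $\gcd(3,d_{g-1})=1$, then $\det C_M=1$. 3. If $3\mid d_g$ and $\gcd(3,d_{g-1})=1$, then $(\det C_M)^3=1$. -/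

import Mathlib

open Matrix Complex

namespace ThetaTransformation

noncomputable section

/-- The Siegel upper half space: symmetric complex matrices with positive definite imaginary
part. -/
def siegel (g : ℕ) : Set (Matrix (Fin g) (Fin g) ℂ) :=
  {Z | Z.IsSymm ∧ (Z.map Complex.im).PosDef}

/-- The polarization type as a diagonal matrix `D = diag (d_1, …, d_g)`. -/
def typeMatrix (R : Type*) [Semiring R] {g : ℕ} (d : Fin g → ℕ) : Matrix (Fin g) (Fin g) R :=
  Matrix.diagonal fun i => (d i : R)

/-- The real isomorphism `j_Z : ℝ^g × ℝ^g → ℂ^g`, `(x, y) ↦ Z x + y`. -/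
def jMap {g : ℕ} (Z : Matrix (Fin g) (Fin g) ℂ) (x : (Fin g → ℝ) × (Fin g → ℝ)) : Fin g → ℂ :=
  (Z *ᵥ fun i => (x.1 i : ℂ)) + fun i => (x.2 i : ℂ)

/-- The inverse of `j_Z`: the real coordinates `(v¹, v²)` of `v = Z v¹ + v²`. -/
def coords {g : ℕ} (Z : Matrix (Fin g) (Fin g) ℂ) (v : Fin g → ℂ) :
    (Fin g → ℝ) × (Fin g → ℝ) :=
  let v₁ : Fin g → ℝ := (Z.map Complex.im)⁻¹ *ᵥ fun i => (v i).im
  (v₁, (fun i => (v i).re) - Z.map Complex.re *ᵥ v₁)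

/-- The first component of `v` in the decomposition `ℂ^g = Z ℝ^g ⊕ ℝ^g`. -/
def part₁ {g : ℕ} (Z : Matrix (Fin g) (Fin g) ℂ) (v : Fin g → ℂ) : Fin g → ℂ :=
  jMap Z ((coords Z v).1, 0)

/-- The second component of `v` in the decomposition `ℂ^g = Z ℝ^g ⊕ ℝ^g`. -/
def part₂ {g : ℕ} (Z : Matrix (Fin g) (Fin g) ℂ) (v : Fin g → ℂ) : Fin g → ℂ :=
  jMap Z (0, (coords Z v).2)

/-- The lattice `Λ_Z = Z ℤ^g + D ℤ^g` in `ℂ^g`. -/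
def lattice {g : ℕ} (d : Fin g → ℕ) (Z : Matrix (Fin g) (Fin g) ℂ) :
    AddSubgroup (Fin g → ℂ) where
  carrier := {v | ∃ m n : Fin g → ℤ,
    v = (Z *ᵥ fun i => (m i : ℂ)) + fun i => (d i : ℂ) * (n i : ℂ)}
  zero_mem' := ⟨0, 0, by ext i; simp [Matrix.mulVec, dotProduct]⟩
  add_mem' := by
    rintro _ _ ⟨m, n, rfl⟩ ⟨m', n', rfl⟩
    refine ⟨m + m', n + n', ?_⟩
    ext i
    simp [Matrix.mulVec, dotProduct, mul_add, Finset.sum_add_distrib]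
    ring
  neg_mem' := by
    rintro _ ⟨m, n, rfl⟩
    refine ⟨-m, -n, ?_⟩
    ext i
    simp [Matrix.mulVec, dotProduct]
    ring

/-- The hermitian form `H_Z (v, w) = ᵗv (Im Z)⁻¹ w̄` (linear in the first variable). -/
def formH {g : ℕ} (Z : Matrix (Fin g) (Fin g) ℂ) (v w : Fin g → ℂ) : ℂ :=
  v ⬝ᵥ (((Z.map Complex.im)⁻¹.map ((↑) : ℝ → ℂ)) *ᵥ star w)

/-- The bilinear form `B_Z (v, w) = ᵗv (Im Z)⁻¹ w`, the `ℂ`-bilinear extension to `ℂ^g` of the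
restriction of `H_Z` to `ℝ^g`. -/
def formB {g : ℕ} (Z : Matrix (Fin g) (Fin g) ℂ) (v w : Fin g → ℂ) : ℂ :=
  v ⬝ᵥ (((Z.map Complex.im)⁻¹.map ((↑) : ℝ → ℂ)) *ᵥ w)

/-- The alternating form `E = Im H_Z`. -/
def formE {g : ℕ} (Z : Matrix (Fin g) (Fin g) ℂ) (v w : Fin g → ℂ) : ℝ :=
  (formH Z v w).im

/-- `χ₀ (v) = exp (π i E (v₁, v₂))`, on all of `ℂ^g`; its restriction to the lattice is the
semicharacter of characteristic `0`. -/
def chi₀ {g : ℕ} (Z : Matrix (Fin g) (Fin g) ℂ) (v : Fin g → ℂ) : ℂ :=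
  Complex.exp (Real.pi * I * formE Z (part₁ Z v) (part₂ Z v))

/-- `χ (v) = χ₀ (v) exp (2 π i E (c, v))`, whose restriction to the lattice is the semicharacter
of characteristic `c`. -/
def chi {g : ℕ} (Z : Matrix (Fin g) (Fin g) ℂ) (c v : Fin g → ℂ) : ℂ :=
  chi₀ Z v * Complex.exp (2 * Real.pi * I * formE Z c v)

/-- The data `(H, χ)` of a line bundle `L(H, χ)` on the torus `ℂ^g / Λ`: a hermitian form `H` whose
imaginary part is integral on `Λ`, and a semicharacter `χ : Λ → U(1)` for `H`.
Only the values of `χ` on `Λ` matter. -/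
structure IsLineBundleDatum {g : ℕ} (Λ : AddSubgroup (Fin g → ℂ))
    (H : (Fin g → ℂ) → (Fin g → ℂ) → ℂ) (χ : (Fin g → ℂ) → ℂ) : Prop where
  add_left : ∀ u v w, H (u + v) w = H u w + H v w
  smul_left : ∀ (a : ℂ) (v w), H (a • v) w = a * H v w
  conj_symm : ∀ v w, H w v = star (H v w)
  integral : ∀ l ∈ Λ, ∀ m ∈ Λ, ∃ k : ℤ, (H l m).im = k
  norm_eq_one : ∀ l ∈ Λ, ‖χ l‖ = 1
  semichar : ∀ l ∈ Λ, ∀ m ∈ Λ,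
    χ (l + m) = χ l * χ m * Complex.exp (Real.pi * I * ((H l m).im : ℝ))

/-- `L(H, χ)` is symmetric: it is isomorphic to its pull back `L(H, χ ∘ (-1))` under `-1`. -/
def IsSymmetricDatum {g : ℕ} (Λ : AddSubgroup (Fin g → ℂ))
    (H : (Fin g → ℂ) → (Fin g → ℂ) → ℂ) (χ : (Fin g → ℂ) → ℂ) : Prop :=
  IsLineBundleDatum Λ H χ ∧ ∀ l ∈ Λ, χ (-l) = χ l

/-- `L(H, χ)` is totally symmetric: it is the square `L(2 H', χ'²)` of a symmetric line bundle
`L(H', χ')`. -/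
def IsTotallySymmetric {g : ℕ} (Λ : AddSubgroup (Fin g → ℂ))
    (H : (Fin g → ℂ) → (Fin g → ℂ) → ℂ) (χ : (Fin g → ℂ) → ℂ) : Prop :=
  ∃ (H' : (Fin g → ℂ) → (Fin g → ℂ) → ℂ) (χ' : (Fin g → ℂ) → ℂ),
    IsSymmetricDatum Λ H' χ' ∧ (∀ v w, H v w = 2 * H' v w) ∧ ∀ l ∈ Λ, χ l = χ' l ^ 2

/-- The canonical factor of automorphy
`a (w, v) = χ (w) exp (π H (v, w) + π / 2 H (w, w))` for the characteristic `c`,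
extended from lattice vectors `w` to all `w`. -/
def autFactor {g : ℕ} (Z : Matrix (Fin g) (Fin g) ℂ) (c w v : Fin g → ℂ) : ℂ :=
  chi Z c w * Complex.exp (Real.pi * formH Z v w + Real.pi / 2 * formH Z w w)

/-- The canonical theta function `θ^c_0` on `ℂ^g`; the sum runs over `Λ₁ = Z ℤ^g`. -/
def theta₀ {g : ℕ} (Z : Matrix (Fin g) (Fin g) ℂ) (c v : Fin g → ℂ) : ℂ :=
  Complex.exp (-Real.pi * formH Z v c - Real.pi / 2 * formH Z c c
      + Real.pi / 2 * formB Z (v + c) (v + c)) *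
    ∑' m : Fin g → ℤ,
      let l : Fin g → ℂ := Z *ᵥ fun i => (m i : ℂ)
      Complex.exp (Real.pi * (formH Z (v + c) l - formB Z (v + c) l)
        - Real.pi / 2 * (formH Z l l - formB Z l l))

/-- The canonical theta function `θ^c_w (v) = a (w, v)⁻¹ θ^c_0 (v + w)`. -/
def theta {g : ℕ} (Z : Matrix (Fin g) (Fin g) ℂ) (c w v : Fin g → ℂ) : ℂ :=
  (autFactor Z c w v)⁻¹ * theta₀ Z c (v + w)

/-- The index set `ℤ_D = ℤ_{d_1} ⊕ ⋯ ⊕ ℤ_{d_g}`, through the representatives `0 ≤ m_i < d_i`. -/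
abbrev ZD {g : ℕ} (d : Fin g → ℕ) : Type := (i : Fin g) → Fin (d i)

/-- The basis `B^Z = (θ^c_{Z D⁻¹ m})`, `m ∈ ℤ_D`, of canonical theta functions, where the
characteristic `c = Z c¹ + c²` is given through its real coordinates. -/
def thetaBasis {g : ℕ} (d : Fin g → ℕ) (Z : Matrix (Fin g) (Fin g) ℂ)
    (c : (Fin g → ℝ) × (Fin g → ℝ)) (m : ZD d) (v : Fin g → ℂ) : ℂ :=
  theta Z (jMap Z c) (Z *ᵥ fun i => ((m i : ℕ) : ℂ) / (d i : ℂ)) v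

/-- `Γ_D`: the integral matrices `R` with `R (0 D; -D 0) ᵗR = (0 D; -D 0)`. -/
def GammaD {g : ℕ} (d : Fin g → ℕ) : Set (Matrix (Fin g ⊕ Fin g) (Fin g ⊕ Fin g) ℤ) :=
  {R | R * Matrix.fromBlocks 0 (typeMatrix ℤ d) (-typeMatrix ℤ d) 0 * Rᵀ =
    Matrix.fromBlocks 0 (typeMatrix ℤ d) (-typeMatrix ℤ d) 0}

/-- `G_D`: the matrices `M ∈ Sp_{2g}(ℚ)` of the form `(1 0; 0 D)⁻¹ R (1 0; 0 D)`, `R ∈ Γ_D`. -/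
def GD {g : ℕ} (d : Fin g → ℕ) : Set (Matrix (Fin g ⊕ Fin g) (Fin g ⊕ Fin g) ℚ) :=
  {M | M ∈ Matrix.symplecticGroup (Fin g) ℚ ∧ ∃ R ∈ GammaD d,
    M = (Matrix.fromBlocks 1 0 0 (typeMatrix ℚ d))⁻¹ * R.map ((↑) : ℤ → ℚ) *
      Matrix.fromBlocks 1 0 0 (typeMatrix ℚ d)}

/-- The matrix `γ Z + δ` for `M = (α β; γ δ)`. -/
def denom {g : ℕ} (M : Matrix (Fin g ⊕ Fin g) (Fin g ⊕ Fin g) ℚ)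
    (Z : Matrix (Fin g) (Fin g) ℂ) : Matrix (Fin g) (Fin g) ℂ :=
  M.toBlocks₂₁.map ((↑) : ℚ → ℂ) * Z + M.toBlocks₂₂.map ((↑) : ℚ → ℂ)

/-- The action `M(Z) = (α Z + β) (γ Z + δ)⁻¹`. -/
def siegelAct {g : ℕ} (M : Matrix (Fin g ⊕ Fin g) (Fin g ⊕ Fin g) ℚ)
    (Z : Matrix (Fin g) (Fin g) ℂ) : Matrix (Fin g) (Fin g) ℂ :=
  (M.toBlocks₁₁.map ((↑) : ℚ → ℂ) * Z + M.toBlocks₁₂.map ((↑) : ℚ → ℂ)) * (denom M Z)⁻¹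

/-- The transformed characteristic `M[c]`, in real coordinates:
`M[c]¹ = δ c¹ - γ c² + ½ (D γ ᵗδ)₀`, `M[c]² = -β c¹ + α c² + ½ (α ᵗβ)₀`,
where `( )₀` is the diagonal vector. -/
def charAct {g : ℕ} (d : Fin g → ℕ) (M : Matrix (Fin g ⊕ Fin g) (Fin g ⊕ Fin g) ℚ)
    (c : (Fin g → ℝ) × (Fin g → ℝ)) : (Fin g → ℝ) × (Fin g → ℝ) :=
  let α : Matrix (Fin g) (Fin g) ℝ := M.toBlocks₁₁.map ((↑) : ℚ → ℝ)
  let β : Matrix (Fin g) (Fin g) ℝ := M.toBlocks₁₂.map ((↑) : ℚ → ℝ)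
  let γ : Matrix (Fin g) (Fin g) ℝ := M.toBlocks₂₁.map ((↑) : ℚ → ℝ)
  let δ : Matrix (Fin g) (Fin g) ℝ := M.toBlocks₂₂.map ((↑) : ℚ → ℝ)
  (δ *ᵥ c.1 - γ *ᵥ c.2 + (1 / 2 : ℝ) • Matrix.diag (typeMatrix ℝ d * γ * δᵀ),
   -(β *ᵥ c.1) + α *ᵥ c.2 + (1 / 2 : ℝ) • Matrix.diag (α * βᵀ))

/-- `C` satisfies `ψ^* B^Z = C B^{Z'}`, where `Z' = M(Z)`, the basis `B^Z` has characteristic `c`,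
`B^{Z'}` has characteristic `c'`, and `ψ : X_{Z'} → X_Z` is the isomorphism with analytic
representation `v ↦ ᵗ(γ Z + δ) v`. -/
def IsBaseChange {g : ℕ} (d : Fin g → ℕ) (M : Matrix (Fin g ⊕ Fin g) (Fin g ⊕ Fin g) ℚ)
    (Z : Matrix (Fin g) (Fin g) ℂ) (c c' : (Fin g → ℝ) × (Fin g → ℝ))
    (C : Matrix (ZD d) (ZD d) ℂ) : Prop :=
  ∀ (m : ZD d) (v : Fin g → ℂ),
    thetaBasis d Z c m ((denom M Z)ᵀ *ᵥ v) =
      ∑ n : ZD d, C m n * thetaBasis d (siegelAct M Z) c' n v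

/-- `s` is a continuous branch of `Z ↦ det (γ Z + δ)^{1/2}` on the Siegel upper half space. -/
def IsSqrtDet {g : ℕ} (M : Matrix (Fin g ⊕ Fin g) (Fin g ⊕ Fin g) ℚ)
    (s : Matrix (Fin g) (Fin g) ℂ → ℂ) : Prop :=
  ContinuousOn s (siegel g) ∧ ∀ Z ∈ siegel g, s Z ^ 2 = (denom M Z).det

end

end ThetaTransformation

/-! Total symmetry forces every `d i` to be even (`even_of_isTotallySymmetric`), so for other types
the base change claim is vacuous. For integral second characteristic each canonical theta function
is a constant times a Gaussian times a classical theta series (`thetaBasis_eq`). The series of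
characteristic `D⁻¹ m` have disjoint Fourier spectra, hence are linearly independent
(`levelTheta_linearIndependent`); this gives uniqueness of the base change matrix.

A Euclidean algorithm on row vectors shows that `Γ_D` is generated by translations, rotations of one
hyperbolic plane and mixed unipotents (`GammaD_subset_elementaryMonoid`). On theta series a
translation acts diagonally, a mixed unipotent by a permutation, and a rotation by a finite Fourier
transform coming from Poisson summation. In each case the matrix is `(s Z)⁻¹ • U` with `U` constant,
a property stable under products because `det (γ Z + δ)` is a cocycle.

Since `∏ d i` is even, `det U` does not see the sign of the branch `s`. It is multiplicative and
equals `1` for the identity (`HasTrans.mul`, `HasTrans.eq_one`), so relations in `Γ_D` become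
relations between determinants. Only translations are evaluated: there the exponent is a sum of
squares, and as `g ≥ 3` gives `4 ∣ ∏_{j ≠ i} d j`, the result is a cube root of unity, trivial
outside the exceptional case. A rotation is a product of three conjugates of a translation
(`jMat_eq`), and a mixed unipotent is conjugate to a commutator times a translation (`pMat_eq`).
Their determinants follow without any Gauss sum or permutation sign.

Finally, for even type, passing from characteristic `M[0]` to `0` costs a monomial matrix of
determinant `1` (`det_charMatrix`). -/

namespace ThetaTransformation

/-! ### The symplectic action on the Siegel upper half space -/

section Action

variable {g : ℕ}

/-- The numerator `α Z + β` of the action of `M` on `Z`. -/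
noncomputable def numer (M : Matrix (Fin g ⊕ Fin g) (Fin g ⊕ Fin g) ℚ)
    (Z : Matrix (Fin g) (Fin g) ℂ) : Matrix (Fin g) (Fin g) ℂ :=
  M.toBlocks₁₁.map ((↑) : ℚ → ℂ) * Z + M.toBlocks₁₂.map ((↑) : ℚ → ℂ)

theorem siegelAct_eq (M : Matrix (Fin g ⊕ Fin g) (Fin g ⊕ Fin g) ℚ)
    (Z : Matrix (Fin g) (Fin g) ℂ) : siegelAct M Z = numer M Z * (denom M Z)⁻¹ := rfl

theorem map_ratCast_mul (A B : Matrix (Fin g) (Fin g) ℚ) :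
    (A * B).map ((↑) : ℚ → ℂ) = A.map ((↑) : ℚ → ℂ) * B.map ((↑) : ℚ → ℂ) :=
  Matrix.map_mul (f := Rat.castHom ℂ)

theorem map_ratCast_add (A B : Matrix (Fin g) (Fin g) ℚ) :
    (A + B).map ((↑) : ℚ → ℂ) = A.map ((↑) : ℚ → ℂ) + B.map ((↑) : ℚ → ℂ) := by
  ext; simp

theorem map_ratCast_sub (A B : Matrix (Fin g) (Fin g) ℚ) :
    (A - B).map ((↑) : ℚ → ℂ) = A.map ((↑) : ℚ → ℂ) - B.map ((↑) : ℚ → ℂ) := by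
  ext; simp

theorem map_ratCast_one : (1 : Matrix (Fin g) (Fin g) ℚ).map ((↑) : ℚ → ℂ) = 1 :=
  Matrix.map_one _ Rat.cast_zero Rat.cast_one

theorem symplectic_blocks {M : Matrix (Fin g ⊕ Fin g) (Fin g ⊕ Fin g) ℚ}
    (hM : M ∈ Matrix.symplecticGroup (Fin g) ℚ) :
    M.toBlocks₁₁ᵀ * M.toBlocks₂₁ = M.toBlocks₂₁ᵀ * M.toBlocks₁₁ ∧
    M.toBlocks₁₂ᵀ * M.toBlocks₂₂ = M.toBlocks₂₂ᵀ * M.toBlocks₁₂ ∧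
    M.toBlocks₁₁ᵀ * M.toBlocks₂₂ - M.toBlocks₂₁ᵀ * M.toBlocks₁₂ = 1 := by
  rw [SymplecticGroup.mem_iff', ← M.fromBlocks_toBlocks, Matrix.J, fromBlocks_transpose,
    fromBlocks_multiply, fromBlocks_multiply, fromBlocks_inj] at hM
  obtain ⟨h1, h2, -, h4⟩ := hM
  simp only [Matrix.mul_zero, Matrix.mul_one, Matrix.mul_neg, zero_add, add_zero,
    Matrix.neg_mul] at h1 h2 h4
  refine ⟨?_, ?_, ?_⟩
  · exact (sub_eq_zero.mp (by rw [← h1]; abel)).symm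
  · exact (sub_eq_zero.mp (by rw [← h4]; abel)).symm
  · rw [← neg_inj, ← h2]; abel

/-- The polarized form of the symplectic relations. Taking `W = Z` gives the symmetry of `M(Z)`;
taking `W` to be the conjugate of `Z` gives the invertibility of `γ Z + δ` and the transformation of
the imaginary part. -/
theorem numer_transpose_mul_denom {M : Matrix (Fin g ⊕ Fin g) (Fin g ⊕ Fin g) ℚ}
    (hM : M ∈ Matrix.symplecticGroup (Fin g) ℚ) {Z W : Matrix (Fin g) (Fin g) ℂ}
    (hZ : Z.IsSymm) :
    (numer M Z)ᵀ * denom M W - (denom M Z)ᵀ * numer M W = Z - W := by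
  obtain ⟨h1, h2, h3⟩ := symplectic_blocks hM
  have h4 : M.toBlocks₁₂ᵀ * M.toBlocks₂₁ - M.toBlocks₂₂ᵀ * M.toBlocks₁₁ = -1 := by
    rw [← neg_inj, neg_neg, ← Matrix.transpose_inj, transpose_one, ← h3]
    simp [transpose_mul]
  have e1 := congrArg (fun A => A.map ((↑) : ℚ → ℂ)) h1
  have e2 := congrArg (fun A => A.map ((↑) : ℚ → ℂ)) h2
  have e3 := congrArg (fun A => A.map ((↑) : ℚ → ℂ)) h3
  have e4 := congrArg (fun A => A.map ((↑) : ℚ → ℂ)) h4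
  simp only [map_ratCast_mul, map_ratCast_sub, map_ratCast_one, transpose_map] at e1 e2 e3 e4
  rw [show (-1 : Matrix (Fin g) (Fin g) ℚ).map ((↑) : ℚ → ℂ) = -1 by
    rw [← map_ratCast_one]; ext; simp [-Matrix.map_one]] at e4
  unfold numer denom
  set a := M.toBlocks₁₁.map ((↑) : ℚ → ℂ)
  set b := M.toBlocks₁₂.map ((↑) : ℚ → ℂ)
  set c := M.toBlocks₂₁.map ((↑) : ℚ → ℂ)
  set e := M.toBlocks₂₂.map ((↑) : ℚ → ℂ)
  simp only [transpose_add, transpose_mul, hZ.eq]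
  calc (Z * aᵀ + bᵀ) * (c * W + e) - (Z * cᵀ + eᵀ) * (a * W + b)
      = Z * (aᵀ * c - cᵀ * a) * W + Z * (aᵀ * e - cᵀ * b) + (bᵀ * c - eᵀ * a) * W +
        (bᵀ * e - eᵀ * b) := by noncomm_ring
    _ = Z - W := by rw [e1, e2, e3, e4]; simp [sub_eq_add_neg]

theorem re_hermitian_pos {Y : Matrix (Fin g) (Fin g) ℝ} (hY : Y.PosDef) {v : Fin g → ℂ}
    (hv : v ≠ 0) : 0 < (v ⬝ᵥ (Y.map ((↑) : ℝ → ℂ) *ᵥ star v)).re := by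
  have key : (v ⬝ᵥ (Y.map ((↑) : ℝ → ℂ) *ᵥ star v)).re =
      (fun i => (v i).re) ⬝ᵥ (Y *ᵥ fun i => (v i).re) +
      (fun i => (v i).im) ⬝ᵥ (Y *ᵥ fun i => (v i).im) := by
    simp only [dotProduct, mulVec, Complex.re_sum, Finset.mul_sum, ← Finset.sum_add_distrib]
    refine Finset.sum_congr rfl fun i _ => Finset.sum_congr rfl fun j _ => ?_
    simp
  rw [key]
  have h (u : Fin g → ℝ) : 0 ≤ u ⬝ᵥ (Y *ᵥ u) := by
    simpa using hY.posSemidef.dotProduct_mulVec_nonneg u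
  have h' (u : Fin g → ℝ) (hu : u ≠ 0) : 0 < u ⬝ᵥ (Y *ᵥ u) := by
    simpa using hY.dotProduct_mulVec_pos hu
  by_cases h1 : (fun i => (v i).re) = 0
  · refine add_pos_of_nonneg_of_pos (h _) (h' _ fun h2 => hv ?_)
    ext i
    exact Complex.ext (congrFun h1 i) (congrFun h2 i)
  · exact add_pos_of_pos_of_nonneg (h' _ h1) (h _)

theorem siegel_sub_conj (Z : Matrix (Fin g) (Fin g) ℂ) :
    Z - Z.map star = (2 * I) • (Z.map Complex.im).map ((↑) : ℝ → ℂ) := by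
  ext i j
  apply Complex.ext <;> simp
  ring

theorem denom_map_star (M : Matrix (Fin g ⊕ Fin g) (Fin g ⊕ Fin g) ℚ)
    (Z : Matrix (Fin g) (Fin g) ℂ) : denom M (Z.map star) = (denom M Z).map star := by
  ext i j
  simp [denom, Matrix.mul_apply]

theorem numer_map_star (M : Matrix (Fin g ⊕ Fin g) (Fin g ⊕ Fin g) ℚ)
    (Z : Matrix (Fin g) (Fin g) ℂ) : numer M (Z.map star) = (numer M Z).map star := by
  ext i j
  simp [numer, Matrix.mul_apply]

theorem map_star_mulVec (A : Matrix (Fin g) (Fin g) ℂ) (v : Fin g → ℂ) :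
    A.map star *ᵥ star v = star (A *ᵥ v) := by
  ext i
  simp [mulVec, dotProduct]

variable {M : Matrix (Fin g ⊕ Fin g) (Fin g ⊕ Fin g) ℚ}
  {Z : Matrix (Fin g) (Fin g) ℂ}

/-- A kernel vector `v` would make the left side of `numer_transpose_mul_denom`, paired with `v` and
its conjugate, vanish; but the right side is `2 i` times a positive definite hermitian form. -/
theorem det_denom_ne_zero (hM : M ∈ Matrix.symplecticGroup (Fin g) ℚ) (hZ : Z ∈ siegel g) :
    (denom M Z).det ≠ 0 := by
  intro h0
  obtain ⟨v, hv, hv0⟩ := Matrix.exists_mulVec_eq_zero_iff.mpr h0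
  have key := numer_transpose_mul_denom hM (W := Z.map star) hZ.1
  rw [siegel_sub_conj, denom_map_star, numer_map_star] at key
  have h1 : v ⬝ᵥ (((numer M Z)ᵀ * (denom M Z).map star -
      (denom M Z)ᵀ * (numer M Z).map star) *ᵥ star v) = 0 := by
    rw [sub_mulVec, ← mulVec_mulVec, ← mulVec_mulVec, map_star_mulVec, hv0, dotProduct_sub,
      dotProduct_mulVec v (denom M Z)ᵀ, vecMul_transpose, hv0]
    simp
  rw [key, smul_mulVec, dotProduct_smul, smul_eq_mul] at h1
  have h2 := re_hermitian_pos hZ.2 hv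
  rcases mul_eq_zero.mp h1 with h | h
  · simp at h
  · rw [h] at h2; simp at h2

theorem isUnit_det_denom (hM : M ∈ Matrix.symplecticGroup (Fin g) ℚ) (hZ : Z ∈ siegel g) :
    IsUnit (denom M Z).det :=
  isUnit_iff_ne_zero.mpr (det_denom_ne_zero hM hZ)

theorem siegelAct_mul_denom (hM : M ∈ Matrix.symplecticGroup (Fin g) ℚ) (hZ : Z ∈ siegel g) :
    siegelAct M Z * denom M Z = numer M Z := by
  rw [siegelAct_eq, Matrix.mul_assoc, Matrix.nonsing_inv_mul _ (isUnit_det_denom hM hZ),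
    Matrix.mul_one]

theorem isSymm_siegelAct (hM : M ∈ Matrix.symplecticGroup (Fin g) ℚ) (hZ : Z ∈ siegel g) :
    (siegelAct M Z).IsSymm := by
  have key := numer_transpose_mul_denom hM (W := Z) hZ.1
  rw [sub_self, sub_eq_zero] at key
  have hu := isUnit_det_denom hM hZ
  have hu' : IsUnit (denom M Z)ᵀ.det := by rwa [det_transpose]
  rw [← siegelAct_mul_denom hM hZ, transpose_mul, Matrix.mul_assoc] at key
  have h2 := congrArg (fun A => ((denom M Z)ᵀ)⁻¹ * A) key
  simp only [← Matrix.mul_assoc, Matrix.nonsing_inv_mul _ hu', Matrix.one_mul] at h2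
  have h3 := congrArg (fun A => A * (denom M Z)⁻¹) h2
  simp only [Matrix.mul_assoc, Matrix.mul_nonsing_inv _ hu, Matrix.mul_one] at h3
  exact h3

theorem denom_transpose_mul_im_mul (hM : M ∈ Matrix.symplecticGroup (Fin g) ℚ)
    (hZ : Z ∈ siegel g) :
    (denom M Z)ᵀ * ((siegelAct M Z).map Complex.im).map ((↑) : ℝ → ℂ) * (denom M Z).map star =
      (Z.map Complex.im).map ((↑) : ℝ → ℂ) := by
  have key := numer_transpose_mul_denom hM (W := Z.map star) hZ.1
  rw [siegel_sub_conj, denom_map_star, numer_map_star, ← siegelAct_mul_denom hM hZ,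
    transpose_mul, (isSymm_siegelAct hM hZ).eq] at key
  have h1 : (siegelAct M Z * denom M Z).map star =
      (siegelAct M Z).map star * (denom M Z).map star := by
    exact Matrix.map_mul (f := starRingEnd ℂ)
  rw [h1, ← Matrix.mul_assoc, ← sub_mul, ← mul_sub, siegel_sub_conj, Matrix.mul_smul,
    Matrix.smul_mul] at key
  exact smul_right_injective _ (by simp : (2 * I : ℂ) ≠ 0) key

theorem siegelAct_mem (hM : M ∈ Matrix.symplecticGroup (Fin g) ℚ) (hZ : Z ∈ siegel g) :
    siegelAct M Z ∈ siegel g := by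
  have hs := isSymm_siegelAct hM hZ
  refine ⟨hs, Matrix.PosDef.of_dotProduct_mulVec_pos ?_ fun x hx => ?_⟩
  · ext i j
    simp [Matrix.conjTranspose_apply, hs.apply]
  -- Positivity at a real vector `x` is transported to positivity of `Im Z` at the complex vector
  -- `v` with `(γ Z + δ) v = x`.
  · set v : Fin g → ℂ := (denom M Z)⁻¹ *ᵥ fun i => (x i : ℂ) with hv
    have hdv : denom M Z *ᵥ v = fun i => (x i : ℂ) := by
      rw [hv, mulVec_mulVec, Matrix.mul_nonsing_inv _ (isUnit_det_denom hM hZ), one_mulVec]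
    have hv0 : v ≠ 0 := by
      intro h
      rw [h, mulVec_zero] at hdv
      refine hx (funext fun i => ?_)
      simpa using (congrFun hdv i).symm
    have h := re_hermitian_pos hZ.2 hv0
    rw [← denom_transpose_mul_im_mul hM hZ, ← mulVec_mulVec, map_star_mulVec, ← mulVec_mulVec,
      dotProduct_mulVec, vecMul_transpose, hdv] at h
    refine h.trans_eq ?_
    simp [dotProduct, mulVec, Complex.re_sum]

theorem denom_mul (M' : Matrix (Fin g ⊕ Fin g) (Fin g ⊕ Fin g) ℚ)
    (hM : M ∈ Matrix.symplecticGroup (Fin g) ℚ) (hZ : Z ∈ siegel g) :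
    denom (M' * M) Z = denom M' (siegelAct M Z) * denom M Z := by
  have h : M' * M = fromBlocks _ _ _ _ :=
    (congrArg₂ (· * ·) M'.fromBlocks_toBlocks.symm M.fromBlocks_toBlocks.symm).trans
      (fromBlocks_multiply _ _ _ _ _ _ _ _)
  rw [denom, h, toBlocks_fromBlocks₂₁, toBlocks_fromBlocks₂₂, denom, Matrix.add_mul,
    Matrix.mul_assoc _ (siegelAct M Z), siegelAct_mul_denom hM hZ]
  simp only [map_ratCast_add, map_ratCast_mul, numer, denom]
  noncomm_ring

theorem numer_mul (M' : Matrix (Fin g ⊕ Fin g) (Fin g ⊕ Fin g) ℚ)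
    (hM : M ∈ Matrix.symplecticGroup (Fin g) ℚ) (hZ : Z ∈ siegel g) :
    numer (M' * M) Z = numer M' (siegelAct M Z) * denom M Z := by
  have h : M' * M = fromBlocks _ _ _ _ :=
    (congrArg₂ (· * ·) M'.fromBlocks_toBlocks.symm M.fromBlocks_toBlocks.symm).trans
      (fromBlocks_multiply _ _ _ _ _ _ _ _)
  rw [numer, h, toBlocks_fromBlocks₁₁, toBlocks_fromBlocks₁₂, numer, Matrix.add_mul,
    Matrix.mul_assoc _ (siegelAct M Z), siegelAct_mul_denom hM hZ]
  simp only [map_ratCast_add, map_ratCast_mul, numer, denom]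
  noncomm_ring

theorem siegelAct_mul {M' : Matrix (Fin g ⊕ Fin g) (Fin g ⊕ Fin g) ℚ}
    (hM : M ∈ Matrix.symplecticGroup (Fin g) ℚ) (hZ : Z ∈ siegel g) :
    siegelAct (M' * M) Z = siegelAct M' (siegelAct M Z) := by
  rw [siegelAct_eq, numer_mul M' hM hZ, denom_mul M' hM hZ, Matrix.mul_inv_rev,
    Matrix.mul_assoc, ← Matrix.mul_assoc (denom M Z),
    Matrix.mul_nonsing_inv _ (isUnit_det_denom hM hZ), Matrix.one_mul, ← siegelAct_eq]

theorem denom_one (Z : Matrix (Fin g) (Fin g) ℂ) :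
    denom (1 : Matrix (Fin g ⊕ Fin g) (Fin g ⊕ Fin g) ℚ) Z = 1 := by
  rw [denom, ← fromBlocks_one, toBlocks_fromBlocks₂₁, toBlocks_fromBlocks₂₂, map_ratCast_one,
    Matrix.map_zero _ Rat.cast_zero]
  simp

theorem siegelAct_one (Z : Matrix (Fin g) (Fin g) ℂ) :
    siegelAct (1 : Matrix (Fin g ⊕ Fin g) (Fin g ⊕ Fin g) ℚ) Z = Z := by
  rw [siegelAct, denom_one, ← fromBlocks_one, toBlocks_fromBlocks₁₁, toBlocks_fromBlocks₁₂,
    map_ratCast_one, Matrix.map_zero _ Rat.cast_zero]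
  simp

theorem continuous_denom (M : Matrix (Fin g ⊕ Fin g) (Fin g ⊕ Fin g) ℚ) :
    Continuous (denom M) := by
  unfold denom
  fun_prop

theorem continuousOn_siegelAct (hM : M ∈ Matrix.symplecticGroup (Fin g) ℚ) :
    ContinuousOn (siegelAct M) (siegel g) := by
  have h : siegelAct M = fun Z =>
      numer M Z * ((denom M Z).det⁻¹ • (denom M Z).adjugate) := by
    funext Z
    rw [siegelAct_eq, Matrix.inv_def, Ring.inverse_eq_inv']
  have hn : Continuous (numer M) := by
    unfold numer
    fun_prop
  rw [h]
  refine hn.continuousOn.mul (ContinuousOn.fun_smul (ContinuousOn.inv₀ ?_ ?_) ?_)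
  · exact (continuous_denom M).matrix_det.continuousOn
  · exact fun Z hZ => det_denom_ne_zero hM hZ
  · exact (continuous_denom M).matrix_adjugate.continuousOn

theorem inv_map_ofReal {Y : Matrix (Fin g) (Fin g) ℝ} (hY : IsUnit Y.det) :
    Y⁻¹.map ((↑) : ℝ → ℂ) = (Y.map ((↑) : ℝ → ℂ))⁻¹ := by
  refine (Matrix.inv_eq_left_inv ?_).symm
  have : (Y⁻¹ * Y).map ((↑) : ℝ → ℂ) = Y⁻¹.map ((↑) : ℝ → ℂ) * Y.map ((↑) : ℝ → ℂ) :=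
    Matrix.map_mul (f := Complex.ofRealHom)
  rw [← this, Matrix.nonsing_inv_mul _ hY, Matrix.map_one _ Complex.ofReal_zero
    Complex.ofReal_one]

theorem isUnit_im_det (hZ : Z ∈ siegel g) : IsUnit (Z.map Complex.im).det :=
  (Matrix.isUnit_iff_isUnit_det _).mp hZ.2.isUnit

theorem im_inv_siegelAct (hM : M ∈ Matrix.symplecticGroup (Fin g) ℚ) (hZ : Z ∈ siegel g) :
    (((siegelAct M Z).map Complex.im)⁻¹).map ((↑) : ℝ → ℂ) =
      (denom M Z).map star * ((Z.map Complex.im)⁻¹).map ((↑) : ℝ → ℂ) * (denom M Z)ᵀ := by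
  have hZ' := siegelAct_mem hM hZ
  have key := denom_transpose_mul_im_mul hM hZ
  have hY := isUnit_im_det hZ
  have hY' := isUnit_im_det hZ'
  rw [inv_map_ofReal hY, inv_map_ofReal hY']
  have hd := isUnit_det_denom hM hZ
  have hd1 : IsUnit (denom M Z)ᵀ.det := by rwa [det_transpose]
  have hd2 : IsUnit ((denom M Z).map star).det := by
    have : ((denom M Z).map star).det = star (denom M Z).det := by
      exact ((starRingEnd ℂ).map_det _).symm
    rw [this]
    exact hd.star
  rw [← key, Matrix.mul_inv_rev, Matrix.mul_inv_rev]
  rw [← Matrix.mul_assoc, Matrix.mul_nonsing_inv _ hd2, Matrix.one_mul, Matrix.mul_assoc,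
    Matrix.nonsing_inv_mul _ hd1, Matrix.mul_one]

/-- The change of the quadratic exponent of canonical theta functions under `M`. -/
theorem formB_denom (hM : M ∈ Matrix.symplecticGroup (Fin g) ℚ) (hZ : Z ∈ siegel g)
    (v : Fin g → ℂ) :
    formB Z ((denom M Z)ᵀ *ᵥ v) ((denom M Z)ᵀ *ᵥ v) =
      formB (siegelAct M Z) v v +
        2 * I * (v ⬝ᵥ ((denom M Z * (M.toBlocks₂₁.map ((↑) : ℚ → ℂ))ᵀ) *ᵥ v)) := by
  have hsym : ((Z.map Complex.im)⁻¹.map ((↑) : ℝ → ℂ)).IsSymm := by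
    have h : (Z.map Complex.im).IsSymm := by
      ext i j; simp [hZ.1.apply]
    rw [Matrix.IsSymm, ← transpose_map, transpose_nonsing_inv, h.eq]
  have h1 : formB (siegelAct M Z) v v = v ⬝ᵥ ((denom M Z *
      (Z.map Complex.im)⁻¹.map ((↑) : ℝ → ℂ) * ((denom M Z).map star)ᵀ) *ᵥ v) := by
    rw [formB, im_inv_siegelAct hM hZ]
    conv_lhs => rw [dotProduct_mulVec, ← mulVec_transpose, dotProduct_comm]
    simp only [transpose_mul, transpose_transpose, hsym.eq, Matrix.mul_assoc]
  have h2 : formB Z ((denom M Z)ᵀ *ᵥ v) ((denom M Z)ᵀ *ᵥ v) = v ⬝ᵥ ((denom M Z *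
      (Z.map Complex.im)⁻¹.map ((↑) : ℝ → ℂ) * (denom M Z)ᵀ) *ᵥ v) := by
    rw [formB, mulVec_transpose, ← dotProduct_mulVec, ← mulVec_transpose]
    simp only [mulVec_mulVec, Matrix.mul_assoc]
  -- `H` is invariant under `ψ`, but `B` carries no conjugation on its second argument; the defect
  -- comes from the difference between `γ Z + δ` and its conjugate, which is `2 i γ Im Z`.
  have h3 : (denom M Z)ᵀ = ((denom M Z).map star)ᵀ + (2 * I) •
      ((Z.map Complex.im).map ((↑) : ℝ → ℂ) * (M.toBlocks₂₁.map ((↑) : ℚ → ℂ))ᵀ) := by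
    have h : denom M Z - denom M (Z.map star) =
        M.toBlocks₂₁.map ((↑) : ℚ → ℂ) * (Z - Z.map star) := by
      simp only [denom]; noncomm_ring
    rw [siegel_sub_conj, denom_map_star] at h
    rw [← sub_eq_iff_eq_add', ← transpose_sub, h, Matrix.mul_smul, transpose_smul, transpose_mul]
    congr 2
    ext i j; simp [hZ.1.apply]
  rw [h2, h1]
  conv_lhs => rw [h3]
  rw [mul_add, Matrix.mul_smul, add_mulVec, dotProduct_add, smul_mulVec, dotProduct_smul,
    smul_eq_mul, ← Matrix.mul_assoc _ _ (M.toBlocks₂₁.map _)ᵀ, Matrix.mul_assoc (denom M Z) _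
      ((Z.map Complex.im).map _), inv_map_ofReal (isUnit_im_det hZ), Matrix.nonsing_inv_mul,
    Matrix.mul_one]
  have : ((Z.map Complex.im).map ((↑) : ℝ → ℂ)).det = ((Z.map Complex.im).det : ℂ) :=
    (Complex.ofRealHom.map_det _).symm
  rw [this]
  exact (isUnit_im_det hZ).map Complex.ofRealHom

end Action

/-! ### Branches of the square root of the automorphy factor -/

section Branch

variable {g : ℕ} {M : Matrix (Fin g ⊕ Fin g) (Fin g ⊕ Fin g) ℚ}

theorem convex_siegel (g : ℕ) : Convex ℝ (siegel g) := by
  intro Z hZ W hW a b ha hb hab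
  refine ⟨?_, ?_⟩
  · rw [Matrix.IsSymm, transpose_add, transpose_smul, transpose_smul, hZ.1.eq, hW.1.eq]
  · have : (a • Z + b • W).map Complex.im = a • Z.map Complex.im + b • W.map Complex.im := by
      ext; simp
    rw [this]
    rcases ha.eq_or_lt with rfl | ha
    · rw [zero_add] at hab
      subst hab
      simpa using hW.2
    · exact (hZ.2.smul ha).add_posSemidef (hW.2.posSemidef.smul hb)

theorem I_smul_one_mem_siegel (g : ℕ) : (I • 1 : Matrix (Fin g) (Fin g) ℂ) ∈ siegel g := by
  refine ⟨by simp [Matrix.IsSymm], ?_⟩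
  have : (I • 1 : Matrix (Fin g) (Fin g) ℂ).map Complex.im = 1 := by
    ext i j
    by_cases h : i = j <;> simp [Matrix.one_apply, h]
  rw [this]
  exact Matrix.PosDef.one

theorem IsSqrtDet.ne_zero (hM : M ∈ Matrix.symplecticGroup (Fin g) ℚ)
    {s : Matrix (Fin g) (Fin g) ℂ → ℂ} (hs : IsSqrtDet M s) {Z : Matrix (Fin g) (Fin g) ℂ}
    (hZ : Z ∈ siegel g) : s Z ≠ 0 := by
  intro h
  have := hs.2 Z hZ
  rw [h] at this
  exact det_denom_ne_zero hM hZ (by rw [← this]; simp)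

/-- The half space is convex, hence connected, and the branches do not vanish, so their quotient is
a constant sign. -/
theorem IsSqrtDet.eq_or_eq_neg (hM : M ∈ Matrix.symplecticGroup (Fin g) ℚ)
    {s s' : Matrix (Fin g) (Fin g) ℂ → ℂ} (hs : IsSqrtDet M s) (hs' : IsSqrtDet M s') :
    (∀ Z ∈ siegel g, s Z = s' Z) ∨ ∀ Z ∈ siegel g, s Z = -s' Z := by
  have := (convex_siegel g).isPreconnected.eq_or_eq_neg_of_sq_eq hs.1 hs'.1
    (fun Z hZ => by simp [hs.2 Z hZ, hs'.2 Z hZ]) (fun hZ => hs'.ne_zero hM hZ)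
  exact this

theorem IsSqrtDet.mul {M' : Matrix (Fin g ⊕ Fin g) (Fin g ⊕ Fin g) ℚ}
    (hM : M ∈ Matrix.symplecticGroup (Fin g) ℚ)
    {s s' : Matrix (Fin g) (Fin g) ℂ → ℂ} (hs' : IsSqrtDet M' s') (hs : IsSqrtDet M s) :
    IsSqrtDet (M' * M) fun Z => s' (siegelAct M Z) * s Z := by
  refine ⟨(hs'.1.comp (continuousOn_siegelAct hM) fun Z hZ => siegelAct_mem hM hZ).mul hs.1,
    fun Z hZ => ?_⟩
  rw [mul_pow, hs'.2 _ (siegelAct_mem hM hZ), hs.2 Z hZ, denom_mul M' hM hZ, det_mul]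

end Branch

/-! ### The classical theta series -/

section Series

variable {g : ℕ}

/-- The general term `exp (π i (ᵗl Z l + 2 ᵗl v))` of the classical theta series. -/
noncomputable def thetaTerm (Z : Matrix (Fin g) (Fin g) ℂ) (v l : Fin g → ℂ) : ℂ :=
  cexp (Real.pi * I * (l ⬝ᵥ (Z *ᵥ l) + 2 * (l ⬝ᵥ v)))

/-- The classical theta series with characteristic `ν`, the sum over `ℤ^g + ν`. -/
noncomputable def thetaSeries (Z : Matrix (Fin g) (Fin g) ℂ) (ν v : Fin g → ℂ) : ℂ :=
  ∑' k : Fin g → ℤ, thetaTerm Z v fun i => (k i : ℂ) + ν i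

theorem summable_prod_apply {n : ℕ} {f : Fin n → ℤ → ℝ} (h0 : ∀ i k, 0 ≤ f i k)
    (hf : ∀ i, Summable (f i)) : Summable fun k : Fin n → ℤ => ∏ i, f i (k i) := by
  induction n with
  | zero => exact Summable.of_finite
  | succ n ih =>
    rw [← (Fin.consEquiv fun _ => ℤ).summable_iff]
    have h := (hf 0).mul_of_nonneg (ih (f := fun i => f i.succ) (fun i k => h0 _ k)
      fun i => hf _) (fun k => h0 0 k) (fun k => Finset.prod_nonneg fun i _ => h0 _ _)
    refine h.congr fun p => ?_
    simp [Fin.prod_univ_succ, Fin.consEquiv]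

/-- The quadratic form attains a positive minimum on the compact unit sphere; homogeneity does the
rest. The sphere is empty exactly when `g = 0`. -/
theorem exists_posDef_lower_bound {Y : Matrix (Fin g) (Fin g) ℝ} (hY : Y.PosDef) :
    ∃ ε : ℝ, 0 < ε ∧ ∀ x : Fin g → ℝ, ε * ∑ i, x i ^ 2 ≤ x ⬝ᵥ (Y *ᵥ x) := by
  rcases (Metric.sphere (0 : Fin g → ℝ) 1).eq_empty_or_nonempty with h | h
  · refine ⟨1, one_pos, fun x => ?_⟩
    have hx : x = 0 := by
      by_contra hx
      have : ‖x‖⁻¹ • x ∈ Metric.sphere (0 : Fin g → ℝ) 1 := by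
        rw [mem_sphere_zero_iff_norm, norm_smul, norm_inv, norm_norm,
          inv_mul_cancel₀ (norm_ne_zero_iff.mpr hx)]
      rw [h] at this
      exact this
    simp [hx]
  · have hc : Continuous fun x : Fin g → ℝ => x ⬝ᵥ (Y *ᵥ x) := by fun_prop
    obtain ⟨x₀, hx₀, hmin⟩ :=
      (isCompact_sphere (0 : Fin g → ℝ) 1).exists_isMinOn h hc.continuousOn
    have hx₀0 : x₀ ≠ 0 := by
      rintro rfl
      simp at hx₀
    have hpos : 0 < x₀ ⬝ᵥ (Y *ᵥ x₀) := by simpa using hY.dotProduct_mulVec_pos hx₀0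
    -- The sphere is that of the sup norm, so the sum of squares is at most `g ‖x‖ ^ 2`; using `g +
    -- 1` makes the denominator visibly positive.
    refine ⟨(x₀ ⬝ᵥ (Y *ᵥ x₀)) / (g + 1), by positivity, fun x => ?_⟩
    have h1 : (x₀ ⬝ᵥ (Y *ᵥ x₀)) * ‖x‖ ^ 2 ≤ x ⬝ᵥ (Y *ᵥ x) := by
      by_cases hx : x = 0
      · simp [hx]
      have hn : 0 < ‖x‖ := norm_pos_iff.mpr hx
      have hm : ‖x‖⁻¹ • x ∈ Metric.sphere (0 : Fin g → ℝ) 1 := by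
        rw [mem_sphere_zero_iff_norm, norm_smul, norm_inv, norm_norm, inv_mul_cancel₀ hn.ne']
      have h2 : x₀ ⬝ᵥ (Y *ᵥ x₀) ≤ (‖x‖⁻¹ • x) ⬝ᵥ (Y *ᵥ (‖x‖⁻¹ • x)) := hmin hm
      rw [mulVec_smul, smul_dotProduct, dotProduct_smul, smul_eq_mul, smul_eq_mul] at h2
      calc _ ≤ (‖x‖⁻¹ * (‖x‖⁻¹ * x ⬝ᵥ (Y *ᵥ x))) * ‖x‖ ^ 2 := by gcongr
        _ = _ := by field_simp
    have h3 : ∑ i, x i ^ 2 ≤ (g + 1) * ‖x‖ ^ 2 := by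
      calc ∑ i, x i ^ 2 ≤ ∑ _i : Fin g, ‖x‖ ^ 2 := by
            refine Finset.sum_le_sum fun i _ => ?_
            rw [← sq_abs]
            exact pow_le_pow_left₀ (abs_nonneg _) (norm_le_pi_norm x i) 2
        _ ≤ _ := by
          simp only [Finset.sum_const, Finset.card_univ, Fintype.card_fin, nsmul_eq_mul]
          nlinarith [sq_nonneg ‖x‖]
    calc _ ≤ (x₀ ⬝ᵥ (Y *ᵥ x₀)) / (g + 1) * ((g + 1) * ‖x‖ ^ 2) := by gcongr
      _ = (x₀ ⬝ᵥ (Y *ᵥ x₀)) * ‖x‖ ^ 2 := by field_simp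
      _ ≤ _ := h1

theorem dotProduct_mulVec_comm {Z : Matrix (Fin g) (Fin g) ℂ} (hZ : Z.IsSymm)
    (x y : Fin g → ℂ) : x ⬝ᵥ (Z *ᵥ y) = y ⬝ᵥ (Z *ᵥ x) := by
  rw [dotProduct_mulVec, ← mulVec_transpose, hZ.eq, dotProduct_comm]

theorem thetaTerm_add {Z : Matrix (Fin g) (Fin g) ℂ} (hZ : Z.IsSymm) (v l ν : Fin g → ℂ) :
    thetaTerm Z v (fun i => l i + ν i) = thetaTerm Z v ν * thetaTerm Z (v + Z *ᵥ ν) l := by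
  rw [thetaTerm, thetaTerm, thetaTerm, ← Complex.exp_add,
    show (fun i => l i + ν i) = l + ν from rfl]
  congr 1
  simp only [mulVec_add, add_dotProduct, dotProduct_add]
  rw [dotProduct_mulVec_comm hZ ν l]
  ring

variable {Z : Matrix (Fin g) (Fin g) ℂ}

/-- The lower bound `ε ∑ k_i ^ 2` for the imaginary part dominates each term by a product of
one-variable Jacobi theta terms at `τ = ε i`. -/
theorem summable_norm_thetaTerm_int (hZ : Z ∈ siegel g) (v : Fin g → ℂ) :
    Summable fun k : Fin g → ℤ => ‖thetaTerm Z v fun i => (k i : ℂ)‖ := by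
  obtain ⟨ε, hε, hlow⟩ := exists_posDef_lower_bound hZ.2
  have hsum := summable_prod_apply (f := fun i n => ‖jacobiTheta₂_term n (v i) (ε * I)‖)
    (fun i k => norm_nonneg _) fun i =>
      ((summable_jacobiTheta₂_term_iff (v i) (ε * I)).mpr (by simpa using hε)).norm
  refine Summable.of_nonneg_of_le (fun _ => norm_nonneg _) (fun k => ?_) hsum
  have h1 : (Real.pi * I * ((fun i => (k i : ℂ)) ⬝ᵥ (Z *ᵥ fun i => (k i : ℂ)) +
      2 * ((fun i => (k i : ℂ)) ⬝ᵥ v))).re = -Real.pi * ((fun i => (k i : ℝ)) ⬝ᵥ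
        (Z.map Complex.im *ᵥ fun i => (k i : ℝ))) - 2 * Real.pi * ∑ i, k i * (v i).im := by
    simp only [dotProduct, mulVec, mul_re, mul_im, add_im, add_re, Complex.im_sum, Complex.re_sum]
    simp
    ring
  rw [thetaTerm, Complex.norm_exp, h1]
  simp only [norm_jacobiTheta₂_term]
  rw [← Real.exp_sum, Real.exp_le_exp]
  have h2 := hlow fun i => (k i : ℝ)
  have h3 : ∑ i, (-Real.pi * (k i : ℝ) ^ 2 * ((ε : ℂ) * I).im - 2 * Real.pi * k i * (v i).im) =
      -Real.pi * (ε * ∑ i, (k i : ℝ) ^ 2) - 2 * Real.pi * ∑ i, k i * (v i).im := by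
    rw [Finset.sum_sub_distrib, Finset.mul_sum, Finset.mul_sum, Finset.mul_sum]
    congr 1 <;> refine Finset.sum_congr rfl fun i _ => ?_
    · simp; ring
    · ring
  rw [h3]
  have := Real.pi_pos
  nlinarith

theorem summable_norm_thetaTerm (hZ : Z ∈ siegel g) (ν v : Fin g → ℂ) :
    Summable fun k : Fin g → ℤ => ‖thetaTerm Z v fun i => (k i : ℂ) + ν i‖ := by
  simp only [thetaTerm_add hZ.1, norm_mul]
  exact (summable_norm_thetaTerm_int hZ _).mul_left _

theorem summable_thetaTerm (hZ : Z ∈ siegel g) (ν v : Fin g → ℂ) :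
    Summable fun k : Fin g → ℤ => thetaTerm Z v fun i => (k i : ℂ) + ν i :=
  (summable_norm_thetaTerm hZ ν v).of_norm

theorem thetaSeries_add_int (Z : Matrix (Fin g) (Fin g) ℂ) (ν v : Fin g → ℂ) (n : Fin g → ℤ) :
    thetaSeries Z (fun i => ν i + n i) v = thetaSeries Z ν v := by
  unfold thetaSeries
  rw [← (Equiv.addRight n).tsum_eq fun k : Fin g → ℤ => thetaTerm Z v fun i => (k i : ℂ) + ν i]
  refine tsum_congr fun k => congrArg _ (funext fun i => ?_)
  simp
  ring

/-- The theta series of level `d` attached to an integral vector `x`, of characteristic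
`D⁻¹ x`. -/
noncomputable def levelTheta (d : Fin g → ℕ) (Z : Matrix (Fin g) (Fin g) ℂ) (x : Fin g → ℤ)
    (v : Fin g → ℂ) : ℂ :=
  thetaSeries Z (fun i => (x i : ℂ) / d i) v

/-- The residue of an integral vector in `ℤ_D`. -/
def residue (d : Fin g → ℕ) (hd : ∀ i, 0 < d i) (x : Fin g → ℤ) : ZD d := fun i =>
  ⟨(x i % d i).toNat, by
    have h := Int.emod_lt_of_pos (x i) (by exact_mod_cast hd i : (0 : ℤ) < d i)
    have h' := Int.emod_nonneg (x i) (by exact_mod_cast (hd i).ne' : (d i : ℤ) ≠ 0)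
    omega⟩

/-- The representative of an element of `ℤ_D`. -/
def repr (d : Fin g → ℕ) (m : ZD d) : Fin g → ℤ := fun i => ((m i : ℕ) : ℤ)

theorem repr_residue (d : Fin g → ℕ) (hd : ∀ i, 0 < d i) (x : Fin g → ℤ) (i : Fin g) :
    repr d (residue d hd x) i = x i % d i := by
  have h' := Int.emod_nonneg (x i) (by exact_mod_cast (hd i).ne' : (d i : ℤ) ≠ 0)
  simp [repr, residue, h']

theorem residue_repr (d : Fin g → ℕ) (hd : ∀ i, 0 < d i) (m : ZD d) :
    residue d hd (repr d m) = m := by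
  funext i
  apply Fin.ext
  have : ((m i : ℕ) : ℤ) % d i = (m i : ℕ) :=
    Int.emod_eq_of_lt (by positivity) (by exact_mod_cast (m i).2)
  simp [repr, residue, this]

theorem residue_eq_iff (d : Fin g → ℕ) (hd : ∀ i, 0 < d i) (x y : Fin g → ℤ) :
    residue d hd x = residue d hd y ↔ ∀ i, x i % d i = y i % d i := by
  refine ⟨fun h i => ?_, fun h => ?_⟩
  · rw [← repr_residue d hd x, ← repr_residue d hd y, h]
  · funext i
    apply Fin.ext
    simp [residue, h i]

theorem levelTheta_repr_residue (d : Fin g → ℕ) (hd : ∀ i, 0 < d i)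
    (Z : Matrix (Fin g) (Fin g) ℂ) (x : Fin g → ℤ) (v : Fin g → ℂ) :
    levelTheta d Z (repr d (residue d hd x)) v = levelTheta d Z x v := by
  unfold levelTheta
  rw [← thetaSeries_add_int Z (fun i => ((repr d (residue d hd x) i : ℤ) : ℂ) / d i) v
    fun i => x i / d i]
  congr 1
  funext i
  have h : (d i : ℂ) ≠ 0 := by exact_mod_cast (hd i).ne'
  rw [repr_residue, Int.emod_def]
  push_cast
  field_simp
  ring

-- The `n`-th Fourier coefficient, as the `L²` inner product with a character. Continuity for the
-- sup norm is what lets it pass through infinite sums.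
open UnitAddTorus in
theorem exists_mFourier_functional (n : Fin g → ℤ) :
    ∃ φ : C(UnitAddTorus (Fin g), ℂ) →L[ℂ] ℂ,
      ∀ m, φ (mFourier m) = if n = m then 1 else 0 := by
  let _ : MeasureTheory.MeasureSpace UnitAddCircle := ⟨AddCircle.haarAddCircle⟩
  have : MeasureTheory.IsProbabilityMeasure
      (MeasureTheory.volume : MeasureTheory.Measure UnitAddCircle) :=
    inferInstanceAs (MeasureTheory.IsProbabilityMeasure AddCircle.haarAddCircle)
  refine ⟨(innerSL ℂ (mFourierLp (d := Fin g) 2 n)).comp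
    (ContinuousMap.toLp (E := ℂ) 2 MeasureTheory.volume ℂ), fun m => ?_⟩
  exact (orthonormal_iff_ite.mp (orthonormal_mFourier (d := Fin g))) n m

-- On the real points `v = D y` the series indexed by `n` is a Fourier series in `y` with
-- frequencies `k D + n` and nonzero coefficients. Different `n` give different residues modulo `D`,
-- so no frequency is shared and the coefficient at frequency `n₀` isolates `a n₀`.
open UnitAddTorus in
theorem levelTheta_linearIndependent {d : Fin g → ℕ} (hd : ∀ i, 0 < d i) (hZ : Z ∈ siegel g)
    {a : ZD d → ℂ} (ha : ∀ v, ∑ n, a n * levelTheta d Z (repr d n) v = 0) : a = 0 := by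
  set b : (Fin g → ℤ) → (ZD d) → ℂ := fun k n =>
    thetaTerm Z 0 fun i => (k i : ℂ) + (repr d n i : ℂ) / d i with hb
  set e : (Fin g → ℤ) → (ZD d) → (Fin g → ℤ) := fun k n i => k i * d i + repr d n i with he
  have hs (n : ZD d) : Summable fun k => b k n • (mFourier (e k n) : C(UnitAddTorus (Fin g), ℂ)) := by
    refine Summable.of_norm ?_
    simp only [norm_smul, mFourier_norm, mul_one]
    exact summable_norm_thetaTerm hZ _ _
  have hval (n : ZD d) (y : Fin g → ℝ) :
      (∑' k, b k n • (mFourier (e k n) : C(UnitAddTorus (Fin g), ℂ)))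
        (fun i => ((y i : ℝ) : UnitAddCircle)) =
      levelTheta d Z (repr d n) fun i => (d i : ℂ) * y i := by
    rw [← ContinuousMap.tsum_apply (hs n), levelTheta, thetaSeries]
    refine tsum_congr fun k => ?_
    simp only [ContinuousMap.coe_smul, Pi.smul_apply, smul_eq_mul, mFourier,
      ContinuousMap.coe_mk, fourier_coe_apply, hb, thetaTerm, ← Complex.exp_sum,
      ← Complex.exp_add, dotProduct_zero, mul_zero, add_zero]
    rw [mul_add]
    congr 2
    simp only [dotProduct, Finset.mul_sum]
    refine Finset.sum_congr rfl fun i _ => ?_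
    have h : (d i : ℂ) ≠ 0 := by exact_mod_cast (hd i).ne'
    simp only [he]
    push_cast
    field_simp
  have hzero : ∑ n, a n • ∑' k, b k n • (mFourier (e k n) : C(UnitAddTorus (Fin g), ℂ)) = 0 := by
    ext y
    choose y' hy' using fun i => QuotientAddGroup.mk_surjective (y i)
    have hy : y = fun i => ((y' i : ℝ) : UnitAddCircle) := funext fun i => (hy' i).symm
    rw [ContinuousMap.coe_sum, Finset.sum_apply, hy]
    simp only [ContinuousMap.coe_smul, Pi.smul_apply, smul_eq_mul]
    simp only [hval]
    exact ha _
  funext n₀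
  obtain ⟨φ, hφ⟩ := exists_mFourier_functional (e 0 n₀)
  have hφn (n : ZD d) : φ (∑' k, b k n • (mFourier (e k n) : C(UnitAddTorus (Fin g), ℂ))) =
      if n = n₀ then b 0 n₀ else 0 := by
    rw [φ.map_tsum (hs n)]
    simp only [map_smul, hφ]
    have hcond (k) : e 0 n₀ = e k n ↔ k = 0 ∧ n = n₀ := by
      refine ⟨fun h => ?_, by rintro ⟨rfl, rfl⟩; rfl⟩
      have hn : n = n₀ := by
        rw [← residue_repr d hd n, ← residue_repr d hd n₀, residue_eq_iff]
        intro i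
        have := congrFun h i
        simp only [he, Pi.zero_apply, zero_mul, zero_add] at this
        rw [this]
        simp
      refine ⟨funext fun i => ?_, hn⟩
      have := congrFun h i
      subst hn
      simpa [he, (hd i).ne'] using this
    split_ifs with h
    · rw [tsum_eq_single 0 fun k hk => ?_]
      · rw [if_pos ((hcond 0).mpr ⟨rfl, h⟩), h]; simp
      · rw [if_neg fun h' => hk ((hcond k).mp h').1]; simp
    · simp [hcond, h]
  have := congrArg φ hzero
  simp only [map_sum, map_smul, hφn, map_zero, smul_eq_mul, mul_ite, mul_zero,
    Finset.sum_ite_eq', Finset.mem_univ, if_true] at this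
  exact (mul_eq_zero.mp this).resolve_right (Complex.exp_ne_zero _)

end Series

/-! ### Canonical theta functions as classical theta series -/

section Canonical

variable {g : ℕ} {Z : Matrix (Fin g) (Fin g) ℂ}

theorem formB_add_left (Z : Matrix (Fin g) (Fin g) ℂ) (u v w : Fin g → ℂ) :
    formB Z (u + v) w = formB Z u w + formB Z v w := by
  simp [formB]

theorem formB_add_right (Z : Matrix (Fin g) (Fin g) ℂ) (u v w : Fin g → ℂ) :
    formB Z u (v + w) = formB Z u v + formB Z u w := by
  simp [formB, mulVec_add]

theorem isSymm_im_inv (hZ : Z ∈ siegel g) :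
    ((Z.map Complex.im)⁻¹.map ((↑) : ℝ → ℂ)).IsSymm := by
  have h : (Z.map Complex.im).IsSymm := by
    ext i j; simp [hZ.1.apply]
  rw [Matrix.IsSymm, ← transpose_map, transpose_nonsing_inv, h.eq]

theorem formB_comm (hZ : Z ∈ siegel g) (u v : Fin g → ℂ) : formB Z u v = formB Z v u :=
  dotProduct_mulVec_comm (isSymm_im_inv hZ) u v

theorem star_formH (hZ : Z ∈ siegel g) (u v : Fin g → ℂ) :
    star (formH Z u v) = formH Z v u := by
  have h := dotProduct_mulVec_comm (isSymm_im_inv hZ) (star u) v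
  rw [formH, formH, ← h]
  simp [dotProduct, mulVec]

/-- Conjugating `Z x¹ + x²` subtracts `2 i (Im Z) x¹`, and `Im Z` cancels against its inverse in
`H`. -/
theorem formH_jMap (hZ : Z ∈ siegel g) (v : Fin g → ℂ) (x : (Fin g → ℝ) × (Fin g → ℝ)) :
    formH Z v (jMap Z x) = formB Z v (jMap Z x) - 2 * I * (v ⬝ᵥ fun i => (x.1 i : ℂ)) := by
  have h1 : star (jMap Z x) = jMap Z x - (2 * I) •
      ((Z.map Complex.im).map ((↑) : ℝ → ℂ) *ᵥ fun i => (x.1 i : ℂ)) := by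
    rw [← smul_mulVec, ← siegel_sub_conj, sub_mulVec]
    ext i
    simp [jMap, mulVec, dotProduct]
    ring
  rw [formH, formB, h1, mulVec_sub, dotProduct_sub, mulVec_smul, mulVec_mulVec,
    inv_map_ofReal (isUnit_im_det hZ), Matrix.nonsing_inv_mul, one_mulVec, dotProduct_smul,
    smul_eq_mul]
  have : ((Z.map Complex.im).map ((↑) : ℝ → ℂ)).det = ((Z.map Complex.im).det : ℂ) :=
    (Complex.ofRealHom.map_det _).symm
  rw [this]
  exact (isUnit_im_det hZ).map Complex.ofRealHom

/-- In real coordinates `E` is the standard symplectic form: `2 i E(u, v) = H(u, v) - H(v, u)`, and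
the symmetric `B` parts cancel. -/
theorem formE_jMap (hZ : Z ∈ siegel g) (x y : (Fin g → ℝ) × (Fin g → ℝ)) :
    formE Z (jMap Z x) (jMap Z y) = x.1 ⬝ᵥ y.2 - x.2 ⬝ᵥ y.1 := by
  have h1 : (2 * I) * (formE Z (jMap Z x) (jMap Z y) : ℂ) =
      formH Z (jMap Z x) (jMap Z y) - formH Z (jMap Z y) (jMap Z x) := by
    rw [← star_formH hZ (jMap Z x)]
    apply Complex.ext <;> simp [formE]
    ring
  rw [formH_jMap hZ, formH_jMap hZ, formB_comm hZ (jMap Z y)] at h1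
  have h2 : (2 * I) * (formE Z (jMap Z x) (jMap Z y) : ℂ) =
      (2 * I) * ((x.1 ⬝ᵥ y.2 - x.2 ⬝ᵥ y.1 : ℝ) : ℂ) := by
    rw [h1]
    have h3 := dotProduct_mulVec_comm hZ.1 (fun i => (x.1 i : ℂ)) (fun i => (y.1 i : ℂ))
    simp only [jMap, add_dotProduct]
    rw [dotProduct_comm (Z *ᵥ _), dotProduct_comm (Z *ᵥ _), h3]
    have h4 : (fun i => (y.2 i : ℂ)) ⬝ᵥ (fun i => (x.1 i : ℂ)) = ((x.1 ⬝ᵥ y.2 : ℝ) : ℂ) := by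
      simp [dotProduct, mul_comm]
    have h5 : (fun i => (x.2 i : ℂ)) ⬝ᵥ (fun i => (y.1 i : ℂ)) = ((x.2 ⬝ᵥ y.1 : ℝ) : ℂ) := by
      simp [dotProduct]
    rw [h4, h5]
    push_cast
    ring
  have h6 := mul_left_cancel₀ (by simp : (2 * I : ℂ) ≠ 0) h2
  exact_mod_cast h6

theorem coords_jMap (hZ : Z ∈ siegel g) (x : (Fin g → ℝ) × (Fin g → ℝ)) :
    coords Z (jMap Z x) = x := by
  have h1 : (fun i => (jMap Z x i).im) = Z.map Complex.im *ᵥ x.1 := by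
    ext i
    simp [jMap, mulVec, dotProduct]
  have h2 : (fun i => (jMap Z x i).re) = Z.map Complex.re *ᵥ x.1 + x.2 := by
    ext i
    simp [jMap, mulVec, dotProduct]
  simp only [coords]
  rw [h1, h2, mulVec_mulVec, Matrix.nonsing_inv_mul _ (isUnit_im_det hZ), one_mulVec]
  simp

theorem chi₀_jMap (hZ : Z ∈ siegel g) (x : (Fin g → ℝ) × (Fin g → ℝ)) :
    chi₀ Z (jMap Z x) = cexp (Real.pi * I * (x.1 ⬝ᵥ x.2 : ℝ)) := by
  rw [chi₀, part₁, part₂, coords_jMap hZ, formE_jMap hZ]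
  simp

/-- If `H = 2 H'`, then `Im H'` is integral on the lattice, while `E` takes the value `d i` on the
pair `Z e_i`, `d_i e_i`. -/
theorem even_of_isTotallySymmetric {d : Fin g → ℕ} (hZ : Z ∈ siegel g)
    (h : IsTotallySymmetric (lattice d Z) (formH Z) (chi Z 0)) (i : Fin g) : 2 ∣ d i := by
  obtain ⟨H', χ', ⟨hH', -⟩, hH, -⟩ := h
  have e1 : jMap Z (Pi.single i 1, 0) ∈ lattice d Z := by
    refine ⟨Pi.single i 1, 0, ?_⟩
    simp only [jMap]
    congr 1
    · congr 1; ext j; by_cases hj : j = i <;> simp [hj]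
    · ext j; simp
  have e2 : jMap Z (0, Pi.single i (d i : ℝ)) ∈ lattice d Z := by
    refine ⟨0, Pi.single i 1, ?_⟩
    simp only [jMap]
    congr 1
    · congr 1; ext j; simp
    · ext j; by_cases hj : j = i <;> simp [hj]
  obtain ⟨k, hk⟩ := hH'.integral _ e1 _ e2
  have h1 := formE_jMap hZ (Pi.single i 1, 0) (0, Pi.single i (d i : ℝ))
  rw [formE, hH] at h1
  simp only [mul_im, re_ofNat, im_ofNat, zero_mul, add_zero, hk] at h1
  simp at h1
  have h2 : (2 * k : ℤ) = d i := by
    have : (((2 * k : ℤ)) : ℝ) = ((d i : ℤ) : ℝ) := by simpa using h1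
    exact_mod_cast this
  omega

/-- The bridge to classical theta series, proved term by term after `k ↦ -k`: since `(H - B)(v, Z k)
= -2 i ᵗv k`, the canonical sum runs through the opposite lattice vectors. -/
theorem thetaBasis_eq {d : Fin g → ℕ} (hZ : Z ∈ siegel g)
    {c : (Fin g → ℝ) × (Fin g → ℝ)} (hc : ∀ i, ∃ n : ℤ, c.2 i = n) (m : ZD d) (v : Fin g → ℂ) :
    thetaBasis d Z c m v =
      cexp (Real.pi * I * (2 * ∑ i, (c.2 i : ℂ) * ((repr d m i : ℂ) / d i) +
        ∑ i, (c.1 i : ℂ) * c.2 i)) * (cexp (Real.pi / 2 * formB Z v v) *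
      thetaSeries Z (fun i => (repr d m i : ℂ) / d i + c.1 i) v) := by
  choose n hn using hc
  set μ : Fin g → ℝ := fun i => (repr d m i : ℝ) / d i with hμ
  set x1 : Fin g → ℂ := fun i => (c.1 i : ℂ) with hx1
  set x2 : Fin g → ℂ := fun i => (c.2 i : ℂ) with hx2
  set y : Fin g → ℂ := fun i => (μ i : ℂ) with hy
  have hw : (Z *ᵥ fun i => ((m i : ℕ) : ℂ) / (d i : ℂ)) = jMap Z (μ, 0) := by
    have : (fun i => ((m i : ℕ) : ℂ) / (d i : ℂ)) = fun i => (μ i : ℂ) := by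
      ext i; simp [hμ, repr]
    rw [this, jMap]
    ext i; simp
  have hw' : jMap Z (μ, 0) = Z *ᵥ y := by
    rw [jMap]; ext i; simp [hy]
  have hcc : jMap Z c = Z *ᵥ x1 + x2 := rfl
  rw [thetaBasis, hw, theta, theta₀, autFactor, chi, chi₀_jMap hZ, formE_jMap hZ, thetaSeries,
    ← (Equiv.neg (Fin g → ℤ)).tsum_eq fun k : Fin g → ℤ => thetaTerm Z v fun i =>
      (k i : ℂ) + ((repr d m i : ℂ) / d i + c.1 i)]
  simp only [← tsum_mul_left, ← mul_assoc]
  refine tsum_congr fun k => ?_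
  set l : Fin g → ℂ := fun i => (k i : ℂ) with hl
  have hlj : Z *ᵥ l = jMap Z (fun i => (k i : ℝ), 0) := by
    rw [jMap]; ext i; simp [hl]
  have hHl (u) : formH Z u (Z *ᵥ l) = formB Z u (Z *ᵥ l) - 2 * I * (u ⬝ᵥ l) := by
    rw [hlj, formH_jMap hZ]; simp [hl]
  have hHy (u) : formH Z u (Z *ᵥ y) = formB Z u (Z *ᵥ y) - 2 * I * (u ⬝ᵥ y) := by
    rw [← hw', formH_jMap hZ]
  have hterm : (fun i => (((Equiv.neg (Fin g → ℤ)) k i : ℤ) : ℂ) +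
      ((repr d m i : ℂ) / d i + c.1 i)) = y + x1 - l := by
    ext i; simp [hy, hx1, hl, hμ]; ring
  rw [hterm, thetaTerm, hlj]
  simp only [← Complex.exp_add, ← Complex.exp_neg]
  rw [Complex.exp_eq_exp_iff_exists_int]
  -- The two exponents differ by `2 π i` times the pairing of `c²` with the summation vector, an
  -- integer because `c²` is integral.
  refine ⟨∑ i, -(n i * k i), ?_⟩
  simp only [← hlj, hw', hHl, hHy, formH_jMap hZ]
  have hnk : ((∑ i, -(n i * k i) : ℤ) : ℂ) = -(x2 ⬝ᵥ l) := by
    simp [dotProduct, hx2, hl, hn]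
  have hr1 : ((μ ⬝ᵥ (0 : Fin g → ℝ) : ℝ) : ℂ) = 0 := by simp
  have hr2 : ((c.1 ⬝ᵥ (0 : Fin g → ℝ) - c.2 ⬝ᵥ μ : ℝ) : ℂ) = -(x2 ⬝ᵥ y) := by
    simp [dotProduct, hx2, hy]
  have hs1 : ∑ i, (c.2 i : ℂ) * ((repr d m i : ℂ) / d i) = x2 ⬝ᵥ y := by
    simp [dotProduct, hx2, hy, hμ]
  have hs2 : ∑ i, (c.1 i : ℂ) * c.2 i = x2 ⬝ᵥ x1 := by
    simp [dotProduct, hx2, hx1, mul_comm]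
  rw [hnk, hr1, hr2, hs1, hs2, ← hx1]
  simp only [hcc, formB_add_left, formB_add_right, add_dotProduct, dotProduct_add, mulVec_add,
    mulVec_sub, sub_dotProduct, dotProduct_sub]
  rw [dotProduct_comm (Z *ᵥ y) y, dotProduct_comm (Z *ᵥ y) x1, dotProduct_comm (Z *ᵥ y) l,
    dotProduct_comm (Z *ᵥ x1) l, dotProduct_comm (Z *ᵥ x1) x1, dotProduct_comm (Z *ᵥ l) l,
    dotProduct_comm y v, dotProduct_comm x1 v, dotProduct_comm l v,
    dotProduct_mulVec_comm hZ.1 x1 y, dotProduct_mulVec_comm hZ.1 l y,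
    dotProduct_mulVec_comm hZ.1 l x1, formB_comm hZ (Z *ᵥ y) v, formB_comm hZ (Z *ᵥ x1) v,
    formB_comm hZ (Z *ᵥ y) (Z *ᵥ x1), formB_comm hZ x2 v, formB_comm hZ x2 (Z *ᵥ y),
    formB_comm hZ x2 (Z *ᵥ x1)]
  ring

end Canonical

/-! ### Transformation matrices with constant determinant -/

section Trans

variable {g : ℕ} {d : Fin g → ℕ} {M : Matrix (Fin g ⊕ Fin g) (Fin g ⊕ Fin g) ℚ}
  {Z : Matrix (Fin g) (Fin g) ℂ}

theorem thetaBasis_zero (hZ : Z ∈ siegel g) (m : ZD d) (v : Fin g → ℂ) :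
    thetaBasis d Z 0 m v = cexp (Real.pi / 2 * formB Z v v) * levelTheta d Z (repr d m) v := by
  rw [thetaBasis_eq hZ (fun i => ⟨0, by simp⟩)]
  simp [levelTheta]

/-- The Gaussians `exp (π/2 B)` at `Z` and `Z'` cancel except for the defect computed in
`formB_denom`. What remains is holomorphic in `Z` and only involves classical series. -/
theorem isBaseChange_iff (hM : M ∈ Matrix.symplecticGroup (Fin g) ℚ) (hZ : Z ∈ siegel g)
    (C : Matrix (ZD d) (ZD d) ℂ) :
    IsBaseChange d M Z 0 0 C ↔ ∀ (m : ZD d) (v : Fin g → ℂ),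
      cexp (Real.pi * I * (v ⬝ᵥ ((denom M Z * (M.toBlocks₂₁.map ((↑) : ℚ → ℂ))ᵀ) *ᵥ v))) *
        levelTheta d Z (repr d m) ((denom M Z)ᵀ *ᵥ v) =
      ∑ n, C m n * levelTheta d (siegelAct M Z) (repr d n) v := by
  refine forall_congr' fun m => forall_congr' fun v => ?_
  simp only [thetaBasis_zero hZ, thetaBasis_zero (siegelAct_mem hM hZ), formB_denom hM hZ]
  have h : ∑ n, C m n * (cexp (Real.pi / 2 * formB (siegelAct M Z) v v) *
      levelTheta d (siegelAct M Z) (repr d n) v) =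
      cexp (Real.pi / 2 * formB (siegelAct M Z) v v) *
        ∑ n, C m n * levelTheta d (siegelAct M Z) (repr d n) v := by
    rw [Finset.mul_sum]
    exact Finset.sum_congr rfl fun n _ => by ring
  rw [h, mul_add, Complex.exp_add, mul_assoc, mul_right_inj' (Complex.exp_ne_zero _)]
  ring_nf

theorem IsBaseChange.unique (hd : ∀ i, 0 < d i) (hM : M ∈ Matrix.symplecticGroup (Fin g) ℚ)
    (hZ : Z ∈ siegel g) {C C' : Matrix (ZD d) (ZD d) ℂ} (hC : IsBaseChange d M Z 0 0 C)
    (hC' : IsBaseChange d M Z 0 0 C') : C = C' := by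
  rw [isBaseChange_iff hM hZ] at hC hC'
  ext m n
  refine sub_eq_zero.mp (congrFun (levelTheta_linearIndependent hd (siegelAct_mem hM hZ)
    (a := fun n => C m n - C' m n) fun v => ?_) n)
  simp only [sub_mul, Finset.sum_sub_distrib]
  rw [← hC m v, ← hC' m v, sub_self]

/-- The theta functions of characteristic `0` transform under `M` by a matrix
`s(Z)⁻¹ U`, with `s` a branch of the square root of the automorphy factor and `U` a constant
matrix of determinant `x`. -/
def HasTrans (d : Fin g → ℕ) (M : Matrix (Fin g ⊕ Fin g) (Fin g ⊕ Fin g) ℚ) (x : ℂ) : Prop :=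
  ∃ (s : Matrix (Fin g) (Fin g) ℂ → ℂ) (U : Matrix (ZD d) (ZD d) ℂ), IsSqrtDet M s ∧ U.det = x ∧
    ∀ Z ∈ siegel g, IsBaseChange d M Z 0 0 ((s Z)⁻¹ • U)

/-- The base changes compose as `U * U'`, in the order opposite to `M' * M`; the determinant does
not notice. -/
theorem HasTrans.mul {M' : Matrix (Fin g ⊕ Fin g) (Fin g ⊕ Fin g) ℚ} {x x' : ℂ}
    (hM : M ∈ Matrix.symplecticGroup (Fin g) ℚ) (h' : HasTrans d M' x') (h : HasTrans d M x) :
    HasTrans d (M' * M) (x' * x) := by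
  obtain ⟨s, U, hs, rfl, hU⟩ := h
  obtain ⟨s', U', hs', rfl, hU'⟩ := h'
  refine ⟨_, U * U', hs'.mul hM hs, by rw [det_mul, mul_comm], fun Z hZ m v => ?_⟩
  have hZ' := siegelAct_mem hM hZ
  have e1 (w : Fin g → ℂ) : thetaBasis d Z 0 m ((denom M Z)ᵀ *ᵥ w) =
      ∑ k, (s Z)⁻¹ * U m k * thetaBasis d (siegelAct M Z) 0 k w := hU Z hZ m w
  have e2 (k : ZD d) : thetaBasis d (siegelAct M Z) 0 k ((denom M' (siegelAct M Z))ᵀ *ᵥ v) =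
      ∑ n, (s' (siegelAct M Z))⁻¹ * U' k n *
        thetaBasis d (siegelAct M' (siegelAct M Z)) 0 n v := hU' _ hZ' k v
  rw [denom_mul M' hM hZ, siegelAct_mul hM hZ, transpose_mul, ← mulVec_mulVec, e1]
  simp only [e2, Finset.mul_sum]
  rw [Finset.sum_comm]
  refine Finset.sum_congr rfl fun n _ => ?_
  rw [Matrix.smul_apply, Matrix.mul_apply, smul_eq_mul, Finset.mul_sum, Finset.sum_mul]
  refine Finset.sum_congr rfl fun k _ => ?_
  rw [mul_inv]
  ring

theorem card_ZD (d : Fin g → ℕ) : Fintype.card (ZD d) = ∏ i, d i := by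
  simp [ZD, Fintype.card_pi]

/-- By uniqueness at `Z = i`, `U` is the scalar `s(i)`, a square root of `1`; its determinant is an
even power of this scalar. -/
theorem HasTrans.eq_one (hd : ∀ i, 0 < d i) (he : Even (∏ i, d i)) {x : ℂ}
    (h : HasTrans d 1 x) : x = 1 := by
  obtain ⟨s, U, hs, rfl, hU⟩ := h
  have hZ := I_smul_one_mem_siegel g
  have h1 : IsBaseChange d 1 (I • 1 : Matrix (Fin g) (Fin g) ℂ) 0 0 1 := by
    intro m v
    rw [denom_one, siegelAct_one, transpose_one, one_mulVec]
    simp [Matrix.one_apply]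
  have h2 := (hU _ hZ).unique hd (one_mem _) hZ h1
  have hs0 := hs.ne_zero (one_mem _) hZ
  have h3 : U = s (I • 1) • (1 : Matrix (ZD d) (ZD d) ℂ) := by
    rw [← h2, smul_smul, mul_inv_cancel₀ hs0, one_smul]
  obtain ⟨k, hk⟩ := he
  rw [h3, det_smul, card_ZD, hk, ← two_mul, pow_mul, hs.2 _ hZ, denom_one]
  simp

theorem isSqrtDet_one_of_det (h : ∀ Z ∈ siegel g, (denom M Z).det = 1) :
    IsSqrtDet M fun _ => 1 :=
  ⟨continuousOn_const, fun Z hZ => by rw [h Z hZ, one_pow]⟩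

end Trans

/-! ### Translations -/

section Translation

variable {g : ℕ} {d : Fin g → ℕ} {Z : Matrix (Fin g) (Fin g) ℂ}

/-- The translation `Z ↦ Z + r E_{ii}`. -/
def translation (i : Fin g) (r : ℚ) : Matrix (Fin g ⊕ Fin g) (Fin g ⊕ Fin g) ℚ :=
  fromBlocks 1 (Matrix.single i i r) 0 1

theorem denom_translation (i : Fin g) (r : ℚ) (Z : Matrix (Fin g) (Fin g) ℂ) :
    denom (translation i r) Z = 1 := by
  rw [denom, translation, toBlocks_fromBlocks₂₁, toBlocks_fromBlocks₂₂, map_ratCast_one,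
    Matrix.map_zero _ Rat.cast_zero]
  simp

theorem siegelAct_translation (i : Fin g) (r : ℚ) (Z : Matrix (Fin g) (Fin g) ℂ) :
    siegelAct (translation i r) Z = Z + Matrix.single i i (r : ℂ) := by
  rw [siegelAct, denom_translation, translation, toBlocks_fromBlocks₁₁, toBlocks_fromBlocks₁₂,
    map_ratCast_one, inv_one, mul_one, one_mul]
  congr 1
  ext a b
  simp [Matrix.single_apply]
  split_ifs <;> simp

theorem translation_mem (i : Fin g) (r : ℚ) :
    translation i r ∈ Matrix.symplecticGroup (Fin g) ℚ := by
  rw [SymplecticGroup.mem_iff, translation, Matrix.J, fromBlocks_multiply, fromBlocks_transpose,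
    fromBlocks_multiply]
  simp

/-- Expanding `n d_i (k + x/d_i) ^ 2` leaves the constant `n x ^ 2 / d_i` plus `n (d_i k ^ 2 + 2 k
x)`, which is an even integer precisely because `d_i` is even. -/
theorem levelTheta_translation (hd : ∀ i, 0 < d i) {i : Fin g} (hi : 2 ∣ d i) (n : ℤ)
    (x : Fin g → ℤ) (v : Fin g → ℂ) :
    levelTheta d (Z + Matrix.single i i ((n : ℂ) * d i)) x v =
      cexp (Real.pi * I * (n * (x i) ^ 2 / d i)) * levelTheta d Z x v := by
  obtain ⟨e, he⟩ := hi
  have hdi : (d i : ℂ) ≠ 0 := by exact_mod_cast (hd i).ne'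
  rw [levelTheta, levelTheta, thetaSeries, thetaSeries, ← tsum_mul_left]
  refine tsum_congr fun k => ?_
  rw [thetaTerm, thetaTerm, ← Complex.exp_add, Complex.exp_eq_exp_iff_exists_int]
  refine ⟨n * (e * k i ^ 2 + k i * x i), ?_⟩
  have he' : (d i : ℂ) = 2 * e := by rw [he]; push_cast; ring
  rw [add_mulVec, dotProduct_add]
  have : ((fun j => (k j : ℂ) + (x j : ℂ) / d j) ⬝ᵥ (Matrix.single i i ((n : ℂ) * d i) *ᵥ
      fun j => (k j : ℂ) + (x j : ℂ) / d j)) =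
      n * d i * ((k i : ℂ) + (x i : ℂ) / d i) ^ 2 := by
    rw [single_mulVec, ← Pi.single, dotProduct_single]
    ring
  rw [this]
  push_cast
  have h2 : (n : ℂ) * d i * ((k i : ℂ) + (x i : ℂ) / d i) ^ 2 =
      n * (d i * (k i) ^ 2 + 2 * k i * x i) + n * (x i) ^ 2 / d i := by
    field_simp
    ring
  rw [h2, he']
  ring

theorem hasTrans_translation (hd : ∀ i, 0 < d i) {i : Fin g} (hi : 2 ∣ d i) (n : ℤ) :
    HasTrans d (translation i (n * d i))
      (∏ m : ZD d, cexp (-(Real.pi * I * (n * (m i : ℕ) ^ 2 / d i)))) := by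
  refine ⟨fun _ => 1, Matrix.diagonal fun m => cexp (-(Real.pi * I * (n * (m i : ℕ) ^ 2 / d i))),
    isSqrtDet_one_of_det fun Z _ => by rw [denom_translation, det_one], det_diagonal,
    fun Z hZ => ?_⟩
  rw [isBaseChange_iff (translation_mem _ _) hZ]
  intro m v
  have h : (translation i ((n : ℚ) * d i)).toBlocks₂₁.map ((↑) : ℚ → ℂ) = 0 := by
    rw [translation, toBlocks_fromBlocks₂₁, Matrix.map_zero _ Rat.cast_zero]
  rw [h, denom_translation, siegelAct_translation, inv_one, one_smul]
  simp only [transpose_zero, mul_zero, zero_mulVec, dotProduct_zero, Complex.exp_zero, one_mul,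
    transpose_one, one_mulVec, Matrix.diagonal_apply, ite_mul, zero_mul]
  rw [Finset.sum_ite_eq, if_pos (Finset.mem_univ _)]
  have h2 := levelTheta_translation (Z := Z) hd hi n (repr d m) v
  push_cast at h2 ⊢
  rw [h2, ← mul_assoc, ← Complex.exp_add]
  simp [repr]

end Translation

/-! ### Unipotent linear changes of coordinates -/

section Shear

variable {g : ℕ} {d : Fin g → ℕ} {Z : Matrix (Fin g) (Fin g) ℂ}

/-- The element `diag (A, ᵗA⁻¹)` for the elementary matrix `A = 1 + n E_{ij}`. -/
def shear (i j : Fin g) (n : ℤ) : Matrix (Fin g ⊕ Fin g) (Fin g ⊕ Fin g) ℚ :=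
  fromBlocks (transvection i j (n : ℚ)) 0 0 (transvection j i (-n : ℚ))

theorem transpose_transvection {R : Type*} [CommRing R] (i j : Fin g) (c : R) :
    (transvection i j c)ᵀ = transvection j i c := by
  simp [transvection]

theorem shear_mem {i j : Fin g} (hij : i ≠ j) (n : ℤ) :
    shear i j n ∈ Matrix.symplecticGroup (Fin g) ℚ := by
  rw [SymplecticGroup.mem_iff, shear, Matrix.J, fromBlocks_multiply, fromBlocks_transpose,
    fromBlocks_multiply]
  simp [transpose_transvection, transvection_mul_transvection_same, hij, hij.symm]

theorem map_transvection (i j : Fin g) (c : ℚ) :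
    (transvection i j c).map ((↑) : ℚ → ℂ) = transvection i j (c : ℂ) := by
  ext a b
  simp [transvection, Matrix.one_apply, Matrix.single_apply]
  split_ifs <;> simp

theorem denom_shear (i j : Fin g) (n : ℤ) (Z : Matrix (Fin g) (Fin g) ℂ) :
    denom (shear i j n) Z = transvection j i (-n : ℂ) := by
  rw [denom, shear, toBlocks_fromBlocks₂₁, toBlocks_fromBlocks₂₂, map_transvection,
    Matrix.map_zero _ Rat.cast_zero]
  simp

/-- With `Δ = γ Z + δ` constant and unimodular, `Z = ᵗΔ Z' Δ`, and the sum is reindexed by `k ↦ Δ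
k`. -/
theorem thetaSeries_shear {i j : Fin g} (hij : i ≠ j) (n : ℤ) (hZ : Z ∈ siegel g)
    (ν v : Fin g → ℂ) :
    thetaSeries Z ν ((transvection j i (-n : ℂ))ᵀ *ᵥ v) =
      thetaSeries (siegelAct (shear i j n) Z) (transvection j i (-n : ℂ) *ᵥ ν) v := by
  set Δ : Matrix (Fin g) (Fin g) ℂ := transvection j i (-n : ℂ) with hΔ
  set Z' := siegelAct (shear i j n) Z with hZ'
  have hZ2 : Δᵀ * Z' * Δ = Z := by
    have h := siegelAct_mul_denom (shear_mem hij n) hZ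
    rw [denom_shear, ← hΔ, ← hZ'] at h
    rw [Matrix.mul_assoc, h, numer, shear, toBlocks_fromBlocks₁₁, toBlocks_fromBlocks₁₂,
      map_transvection, Matrix.map_zero _ Rat.cast_zero, add_zero, ← Matrix.mul_assoc, hΔ,
      transpose_transvection]
    simp [transvection_mul_transvection_same, hij]
  let e : (Fin g → ℤ) ≃ (Fin g → ℤ) :=
    { toFun := fun k => transvection j i (-n) *ᵥ k
      invFun := fun k => transvection j i n *ᵥ k
      left_inv := fun k => by
        simp [mulVec_mulVec, transvection_mul_transvection_same, hij.symm]
      right_inv := fun k => by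
        simp [mulVec_mulVec, transvection_mul_transvection_same, hij.symm] }
  rw [thetaSeries, thetaSeries, ← e.tsum_eq fun k : Fin g → ℤ => thetaTerm Z' v fun i =>
    (k i : ℂ) + _]
  refine tsum_congr fun k => ?_
  have h1 : (fun a => ((e k a : ℤ) : ℂ) + (Δ *ᵥ ν) a) = Δ *ᵥ fun a => (k a : ℂ) + ν a := by
    have : (fun a => (k a : ℂ) + ν a) = (fun a => (k a : ℂ)) + ν := rfl
    rw [this, mulVec_add]
    ext a
    rw [Pi.add_apply]
    congr 1
    simp only [e, hΔ, transvection, add_mulVec, single_mulVec, Equiv.coe_fn_mk, one_mulVec,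
      Pi.add_apply, Function.update_apply]
    split_ifs <;> simp
  rw [h1, thetaTerm, thetaTerm]
  congr 2
  set l : Fin g → ℂ := fun a => (k a : ℂ) + ν a
  conv_lhs => rw [← hZ2]
  rw [← mulVec_mulVec, ← mulVec_mulVec, dotProduct_mulVec l, vecMul_transpose,
    dotProduct_mulVec l, vecMul_transpose]

/-- Write `d_j = d_i q`. Then `Δ D⁻¹ m = D⁻¹ m'` with `m'_j = m_j - n q m_i`, again integral, so the
matrix permutes the basis. Its determinant is left open, to be recovered from relations. -/
theorem hasTrans_shear (hd : ∀ i, 0 < d i) {i j : Fin g} (hij : i ≠ j) (hdvd : d i ∣ d j)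
    (n : ℤ) : ∃ x, HasTrans d (shear i j n) x := by
  obtain ⟨q, hq⟩ := hdvd
  refine ⟨_, fun _ => 1, Matrix.of fun m m' => if m' = residue d hd
    (transvection j i (-(n * q)) *ᵥ repr d m) then 1 else 0,
    isSqrtDet_one_of_det fun Z _ => by
      rw [denom_shear, det_transvection_of_ne _ _ hij.symm], rfl, fun Z hZ => ?_⟩
  rw [isBaseChange_iff (shear_mem hij n) hZ]
  intro m v
  have h : (shear i j n).toBlocks₂₁.map ((↑) : ℚ → ℂ) = 0 := by
    rw [shear, toBlocks_fromBlocks₂₁, Matrix.map_zero _ Rat.cast_zero]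
  simp only [h, denom_shear, inv_one, one_smul, transpose_zero, mul_zero, zero_mulVec,
    dotProduct_zero, Complex.exp_zero, one_mul, Matrix.of_apply, ite_mul, zero_mul,
    Finset.sum_ite_eq', Finset.mem_univ, if_true]
  rw [levelTheta_repr_residue, levelTheta, levelTheta, thetaSeries_shear hij n hZ]
  congr 1
  ext a
  have hdi : (d i : ℂ) ≠ 0 := by exact_mod_cast (hd i).ne'
  have hdj : (d j : ℂ) ≠ 0 := by exact_mod_cast (hd j).ne'
  have hq' : (d j : ℂ) = d i * q := by rw [hq]; push_cast; ring
  have hq0 : (q : ℂ) ≠ 0 := fun h0 => hdj (by rw [hq', h0, mul_zero])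
  by_cases ha : a = j
  · subst ha
    simp [transvection, add_mulVec, single_mulVec]
    rw [hq']
    field_simp
  · simp [transvection, add_mulVec, single_mulVec, ha]

end Shear

/-! ### Partial inversions -/

section OneVariable

theorem tsum_int_eq_sum_tsum {N : ℕ} [NeZero N] {f : ℤ → ℂ} (hf : Summable f) :
    ∑' n, f n = ∑ r : Fin N, ∑' k : ℤ, f (k * N + (r : ℕ)) := by
  have hf' : Summable fun p : ℤ × Fin N => f (p.1 * N + (p.2 : ℕ)) :=
    ((Int.divModEquiv N).symm.summable_iff (f := f)).mpr hf
  rw [← (Int.divModEquiv N).symm.tsum_eq f, ← (Equiv.prodComm (Fin N) ℤ).tsum_eq]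
  have hf'' := (Equiv.prodComm (Fin N) ℤ).summable_iff.mpr hf'
  rw [Summable.tsum_prod (by exact hf''), tsum_fintype]
  rfl

/-- Poisson summation for a Gaussian with rational characteristic. -/
theorem tsum_gaussian_inversion {N : ℕ} (hN : 0 < N) (m : ℤ) (w : ℂ) {τ : ℂ} (hτ : 0 < τ.im) :
    ∑' k : ℤ, cexp (Real.pi * I * (((k : ℂ) + m / N) ^ 2 * τ + 2 * ((k : ℂ) + m / N) * w)) =
      1 / (-I * τ) ^ (1 / 2 : ℂ) * cexp (-Real.pi * I * w ^ 2 / τ) *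
      ∑ r : Fin N, cexp (-2 * Real.pi * I * ((r : ℕ) * m / N)) *
        ∑' k : ℤ, cexp (Real.pi * I * (-((k : ℂ) + (r : ℕ) / N) ^ 2 * N ^ 2 / τ -
          2 * ((k : ℂ) + (r : ℕ) / N) * N * w / τ)) := by
  have : NeZero N := ⟨hN.ne'⟩
  have hN0 : (N : ℂ) ≠ 0 := by exact_mod_cast hN.ne'
  have hτ0 : τ ≠ 0 := fun h => by simp [h] at hτ
  have h1 : ∑' k : ℤ, cexp (Real.pi * I * (((k : ℂ) + m / N) ^ 2 * τ +
      2 * ((k : ℂ) + m / N) * w)) =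
      cexp (Real.pi * I * ((m / N) ^ 2 * τ + 2 * (m / N) * w)) *
        jacobiTheta₂ (m / N * τ + w) τ := by
    rw [jacobiTheta₂, ← tsum_mul_left]
    refine tsum_congr fun k => ?_
    rw [jacobiTheta₂_term, ← Complex.exp_add]
    congr 1
    ring
  rw [h1, jacobiTheta₂_functional_equation]
  have hτ' : 0 < (-1 / τ).im := by
    rw [neg_div, neg_im, one_div, inv_im, neg_div, neg_neg]
    exact div_pos hτ (normSq_pos.mpr hτ0)
  have hsum := (hasSum_jacobiTheta₂_term ((m / N * τ + w) / τ) hτ').summable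
  -- The sign change of the dual index makes the characters come out as `exp (-2 π i r m / N)`; the
  -- dual sum is then split by residues modulo `N`.
  rw [jacobiTheta₂, ← (Equiv.neg ℤ).tsum_eq, tsum_int_eq_sum_tsum (N := N)
    (f := fun n => jacobiTheta₂_term ((Equiv.neg ℤ) n) ((m / N * τ + w) / τ) (-1 / τ))
    ((Equiv.neg ℤ).summable_iff.mpr hsum)]
  have h2 : cexp (Real.pi * I * ((m / N) ^ 2 * τ + 2 * (m / N) * w)) *
      cexp (-Real.pi * I * (m / N * τ + w) ^ 2 / τ) = cexp (-Real.pi * I * w ^ 2 / τ) := by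
    rw [← Complex.exp_add]
    congr 1
    field_simp
    ring
  rw [← h2]
  have h3 : ∀ r : Fin N, ∑' k : ℤ, jacobiTheta₂_term ((Equiv.neg ℤ) (k * N + (r : ℕ)))
      ((m / N * τ + w) / τ) (-1 / τ) = cexp (-2 * Real.pi * I * ((r : ℕ) * m / N)) *
        ∑' k : ℤ, cexp (Real.pi * I * (-((k : ℂ) + (r : ℕ) / N) ^ 2 * N ^ 2 / τ -
          2 * ((k : ℂ) + (r : ℕ) / N) * N * w / τ)) := by
    intro r
    rw [← tsum_mul_left]
    refine tsum_congr fun k => ?_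
    rw [jacobiTheta₂_term, ← Complex.exp_add, Complex.exp_eq_exp_iff_exists_int]
    -- For the dual index `k N + r` the character is `exp (-2 π i (k m + r m / N))`, and the `k m`
    -- part is trivial.
    refine ⟨-(k * m), ?_⟩
    simp only [Equiv.neg_apply]
    push_cast
    field_simp
    ring
  rw [Finset.sum_congr rfl fun r _ => h3 r]
  ring

end OneVariable

/-! ### Poisson summation in one coordinate of a theta series -/

section Inversion

variable {g : ℕ} {d : Fin g → ℕ} {Z : Matrix (Fin g) (Fin g) ℂ}

/-- The vector `ν + k` with its `i`-th coordinate replaced by `0`. -/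
noncomputable def partialVec (i : Fin g) (ν : Fin g → ℂ) (k : { j // j ≠ i } → ℤ) : Fin g → ℂ :=
  fun j => if h : j = i then 0 else k ⟨j, h⟩ + ν j

theorem partialVec_self (i : Fin g) (ν : Fin g → ℂ) (k : { j // j ≠ i } → ℤ) :
    partialVec i ν k i = 0 := by simp [partialVec]

theorem partialVec_update (i : Fin g) (ν : Fin g → ℂ) (a : ℂ) (k : { j // j ≠ i } → ℤ) :
    partialVec i (Function.update ν i a) k = partialVec i ν k := by
  ext j
  by_cases h : j = i <;> simp [partialVec, h]

theorem funSplitAt_symm_add (i : Fin g) (ν : Fin g → ℂ) (n : ℤ) (k : { j // j ≠ i } → ℤ) :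
    (fun j => (((Equiv.funSplitAt i ℤ).symm (n, k) j : ℤ) : ℂ) + ν j) =
      Pi.single i ((n : ℂ) + ν i) + partialVec i ν k := by
  ext j
  by_cases h : j = i
  · subst h; simp [partialVec]
  · simp [partialVec, h]

theorem summable_thetaTerm_split (i : Fin g) (hZ : Z ∈ siegel g) (ν v : Fin g → ℂ) :
    Summable fun p : ({ j // j ≠ i } → ℤ) × ℤ =>
      thetaTerm Z v (Pi.single i ((p.2 : ℂ) + ν i) + partialVec i ν p.1) := by
  have h := (((Equiv.prodComm _ _).trans (Equiv.funSplitAt i ℤ).symm).summable_iff).mpr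
    (summable_thetaTerm hZ ν v)
  refine h.congr fun p => ?_
  rw [← funSplitAt_symm_add]
  rfl

/-- Isolates the `i`-th summation variable by absolute convergence, so that Poisson summation in one
variable applies with the other coordinates frozen. -/
theorem thetaSeries_split (i : Fin g) (hZ : Z ∈ siegel g) (ν v : Fin g → ℂ) :
    thetaSeries Z ν v = ∑' k : { j // j ≠ i } → ℤ, ∑' n : ℤ,
      thetaTerm Z v (Pi.single i ((n : ℂ) + ν i) + partialVec i ν k) := by
  rw [← (summable_thetaTerm_split i hZ ν v).tsum_prod, thetaSeries,
    ← ((Equiv.prodComm _ _).trans (Equiv.funSplitAt i ℤ).symm).tsum_eq]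
  refine tsum_congr fun p => ?_
  rw [← funSplitAt_symm_add]
  rfl

/-- The partial inversion in the `i`-th coordinate, of level `N`. -/
def inversion (i : Fin g) (N : ℕ) : Matrix (Fin g ⊕ Fin g) (Fin g ⊕ Fin g) ℚ :=
  fromBlocks (1 - Matrix.single i i 1) (Matrix.single i i (N : ℚ))
    (-Matrix.single i i (N : ℚ)⁻¹) (1 - Matrix.single i i 1)

theorem inversion_mem (i : Fin g) {N : ℕ} (hN : 0 < N) :
    inversion i N ∈ Matrix.symplecticGroup (Fin g) ℚ := by
  have hN' : (N : ℚ) ≠ 0 := by exact_mod_cast hN.ne'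
  rw [SymplecticGroup.mem_iff, inversion, Matrix.J, fromBlocks_multiply, fromBlocks_transpose,
    fromBlocks_multiply]
  simp [Matrix.mul_sub, Matrix.sub_mul, hN']
  abel

theorem map_single_ratCast (i : Fin g) (r : ℚ) :
    (Matrix.single i i r).map ((↑) : ℚ → ℂ) = Matrix.single i i (r : ℂ) := by
  ext a b
  simp only [Matrix.single_apply, Matrix.map_apply]
  split_ifs <;> simp

theorem map_toBlocks₂₁_inversion (i : Fin g) (N : ℕ) :
    (inversion i N).toBlocks₂₁.map ((↑) : ℚ → ℂ) = -Matrix.single i i (N : ℂ)⁻¹ := by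
  rw [inversion, toBlocks_fromBlocks₂₁]
  ext a b
  simp only [Matrix.single_apply, Matrix.map_apply, Matrix.neg_apply]
  split_ifs <;> simp

theorem denom_inversion (i : Fin g) (N : ℕ) (Z : Matrix (Fin g) (Fin g) ℂ) :
    denom (inversion i N) Z = 1 - Matrix.single i i 1 - Matrix.single i i (N : ℂ)⁻¹ * Z := by
  rw [denom, map_toBlocks₂₁_inversion, inversion, toBlocks_fromBlocks₂₂, map_ratCast_sub,
    map_ratCast_one, map_single_ratCast]
  simp
  abel

theorem numer_inversion (i : Fin g) (N : ℕ) (Z : Matrix (Fin g) (Fin g) ℂ) :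
    numer (inversion i N) Z = Z - Matrix.single i i 1 * Z + Matrix.single i i (N : ℂ) := by
  rw [numer, inversion, toBlocks_fromBlocks₁₁, toBlocks_fromBlocks₁₂, map_ratCast_sub,
    map_ratCast_one, map_single_ratCast, map_single_ratCast]
  simp [Matrix.sub_mul]

/-- `γ Z + δ` is the identity with its `i`-th row replaced by `-1/N` times that of `Z`, so only the
diagonal entry of that row contributes. -/
theorem det_denom_inversion (i : Fin g) (N : ℕ) (Z : Matrix (Fin g) (Fin g) ℂ) :
    (denom (inversion i N) Z).det = -(Z i i) / N := by
  have h : denom (inversion i N) Z = (1 : Matrix (Fin g) (Fin g) ℂ).updateRow i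
      (-(N : ℂ)⁻¹ • Z i) := by
    rw [denom_inversion]
    ext a b
    by_cases ha : a = i
    · subst ha
      simp [Matrix.one_apply, Matrix.single_apply]
    · simp [Ne.symm ha, Matrix.single_mul_apply_of_ne, ha]
  rw [h]
  have h2 : (-(N : ℂ)⁻¹ • Z i) = ∑ j, (-(N : ℂ)⁻¹ * Z i j) • (1 : Matrix (Fin g) (Fin g) ℂ) j := by
    ext b
    simp [Matrix.one_apply]
  rw [h2, det_updateRow_sum, det_one]
  simp
  ring

theorem denom_inversion_mulVec (i : Fin g) (N : ℕ) (x : ℂ) {p : Fin g → ℂ} (hp : p i = 0) :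
    denom (inversion i N) Z *ᵥ (Pi.single i x + p) =
      Pi.single i (-(x * Z i i + (Z *ᵥ p) i) / N) + p := by
  rw [denom_inversion, sub_mulVec, sub_mulVec, ← mulVec_mulVec, one_mulVec, single_mulVec,
    single_mulVec, mulVec_add, mulVec_single]
  ext j
  by_cases h : j = i
  · subst h; simp [hp]; ring
  · simp [h]

theorem numer_inversion_mulVec (i : Fin g) (N : ℕ) (x : ℂ) {p : Fin g → ℂ} (hp : p i = 0) :
    numer (inversion i N) Z *ᵥ (Pi.single i x + p) =
      Z *ᵥ (Pi.single i x + p) + Pi.single i (N * x - (x * Z i i + (Z *ᵥ p) i)) := by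
  rw [numer_inversion, add_mulVec, sub_mulVec, ← mulVec_mulVec, single_mulVec, single_mulVec,
    mulVec_add, mulVec_single]
  ext j
  by_cases h : j = i
  · subst h; simp [hp]
  · simp [h]

theorem im_diag_pos (hZ : Z ∈ siegel g) (i : Fin g) : 0 < (Z i i).im := hZ.2.diag_pos

theorem dotProduct_add_single_mulVec (hZ : Z.IsSymm) (i : Fin g) (x : ℂ) (p : Fin g → ℂ) :
    (Pi.single i x + p) ⬝ᵥ (Z *ᵥ (Pi.single i x + p)) =
      x ^ 2 * Z i i + 2 * x * (Z *ᵥ p) i + p ⬝ᵥ (Z *ᵥ p) := by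
  rw [mulVec_add, add_dotProduct, dotProduct_add, dotProduct_add,
    dotProduct_mulVec_comm hZ p (Pi.single i x), single_dotProduct, single_dotProduct, mulVec_single]
  simp
  ring

theorem quadForm_inversion (i : Fin g) {N : ℕ} (hN : 0 < N) (hZ : Z ∈ siegel g) (y : ℂ)
    {p : Fin g → ℂ} (hp : p i = 0) :
    (Pi.single i y + p) ⬝ᵥ (siegelAct (inversion i N) Z *ᵥ (Pi.single i y + p)) =
      -y ^ 2 * N ^ 2 / Z i i - 2 * y * N * (Z *ᵥ p) i / Z i i + p ⬝ᵥ (Z *ᵥ p) -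
        (Z *ᵥ p) i ^ 2 / Z i i := by
  have hτ : Z i i ≠ 0 := fun h => by simpa [h] using im_diag_pos hZ i
  have hN' : (N : ℂ) ≠ 0 := by exact_mod_cast hN.ne'
  -- Chosen so that `γ Z + δ` maps `x e_i + p` to `y e_i + p`. Then `M(Z)` is evaluated through `α Z
  -- + β`, with no matrix inverted.
  set x : ℂ := -(N * y + (Z *ᵥ p) i) / Z i i with hx
  have h1 : denom (inversion i N) Z *ᵥ (Pi.single i x + p) = Pi.single i y + p := by
    rw [denom_inversion_mulVec i N x hp]
    congr 2
    rw [hx]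
    field_simp
    ring
  have h2 : siegelAct (inversion i N) Z *ᵥ (Pi.single i y + p) =
      Z *ᵥ (Pi.single i x + p) + Pi.single i (N * x - (x * Z i i + (Z *ᵥ p) i)) := by
    rw [← h1, mulVec_mulVec, siegelAct_mul_denom (inversion_mem i hN) hZ,
      numer_inversion_mulVec i N x hp]
  rw [h2, mulVec_add, add_dotProduct, dotProduct_add, dotProduct_add, dotProduct_add,
    dotProduct_add, dotProduct_mulVec_comm hZ.1 p (Pi.single i x), single_dotProduct,
    single_dotProduct, single_dotProduct, single_dotProduct, mulVec_single, dotProduct_single, hp]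
  simp
  rw [hx]
  field_simp
  ring

theorem thetaTerm_inversion_left (i : Fin g) (N : ℕ) (hZ : Z ∈ siegel g) (x : ℂ)
    {p : Fin g → ℂ} (hp : p i = 0) (v : Fin g → ℂ) :
    thetaTerm Z ((denom (inversion i N) Z)ᵀ *ᵥ v) (Pi.single i x + p) =
      cexp (Real.pi * I * (p ⬝ᵥ (Z *ᵥ p) + 2 * (p ⬝ᵥ v) - 2 * (Z *ᵥ p) i * v i / N)) *
        cexp (Real.pi * I * (x ^ 2 * Z i i + 2 * x * ((Z *ᵥ p) i - Z i i * v i / N))) := by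
  rw [thetaTerm, ← Complex.exp_add, dotProduct_add_single_mulVec hZ.1,
    dotProduct_mulVec _ (denom (inversion i N) Z)ᵀ, vecMul_transpose, denom_inversion_mulVec i N x hp, add_dotProduct, single_dotProduct]
  congr 1
  ring

theorem thetaTerm_inversion_right (i : Fin g) {N : ℕ} (hN : 0 < N) (hZ : Z ∈ siegel g) (y : ℂ)
    {p : Fin g → ℂ} (hp : p i = 0) (v : Fin g → ℂ) :
    thetaTerm (siegelAct (inversion i N) Z) v (Pi.single i y + p) =
      cexp (Real.pi * I * (p ⬝ᵥ (Z *ᵥ p) + 2 * (p ⬝ᵥ v) - (Z *ᵥ p) i ^ 2 / Z i i)) *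
        cexp (Real.pi * I * (-y ^ 2 * N ^ 2 / Z i i -
          2 * y * N * ((Z *ᵥ p) i - Z i i * v i / N) / Z i i)) := by
  have hτ : Z i i ≠ 0 := fun h => by simpa [h] using im_diag_pos hZ i
  have hN' : (N : ℂ) ≠ 0 := by exact_mod_cast hN.ne'
  rw [thetaTerm, ← Complex.exp_add, quadForm_inversion i hN hZ y hp, add_dotProduct,
    single_dotProduct]
  congr 1
  field_simp
  ring

/-- For frozen `p` both sides are one-variable Gaussian sums with parameter `Z_ii` and shift `w = (Z
p)_i - Z_ii v_i / N`. The factor `exp (-π i w ^ 2 / Z_ii)` from Poisson summation reconciles the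
prefactors of the two sides. -/
theorem tsum_thetaTerm_inversion (i : Fin g) {N : ℕ} (hN : 0 < N) (hZ : Z ∈ siegel g) (m : ℤ)
    {p : Fin g → ℂ} (hp : p i = 0) (v : Fin g → ℂ) :
    cexp (Real.pi * I * (Z i i * v i ^ 2 / N ^ 2)) *
      ∑' n : ℤ, thetaTerm Z ((denom (inversion i N) Z)ᵀ *ᵥ v)
        (Pi.single i ((n : ℂ) + m / N) + p) =
      ∑ r : Fin N, 1 / (-I * Z i i) ^ (1 / 2 : ℂ) *
        cexp (-2 * Real.pi * I * ((r : ℕ) * m / N)) *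
        ∑' n : ℤ, thetaTerm (siegelAct (inversion i N) Z) v
          (Pi.single i ((n : ℂ) + (r : ℕ) / N) + p) := by
  have hτ : Z i i ≠ 0 := fun h => by simpa [h] using im_diag_pos hZ i
  have hN' : (N : ℂ) ≠ 0 := by exact_mod_cast hN.ne'
  simp only [thetaTerm_inversion_left i N hZ _ hp, thetaTerm_inversion_right i hN hZ _ hp,
    tsum_mul_left]
  rw [tsum_gaussian_inversion hN m _ (im_diag_pos hZ i), Finset.mul_sum, Finset.mul_sum,
    Finset.mul_sum]
  refine Finset.sum_congr rfl fun r _ => ?_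
  have h : cexp (Real.pi * I * (Z i i * v i ^ 2 / N ^ 2)) *
      cexp (Real.pi * I * (p ⬝ᵥ (Z *ᵥ p) + 2 * (p ⬝ᵥ v) - 2 * (Z *ᵥ p) i * v i / N)) *
      cexp (-Real.pi * I * ((Z *ᵥ p) i - Z i i * v i / N) ^ 2 / Z i i) =
      cexp (Real.pi * I * (p ⬝ᵥ (Z *ᵥ p) + 2 * (p ⬝ᵥ v) - (Z *ᵥ p) i ^ 2 / Z i i)) := by
    rw [← Complex.exp_add, ← Complex.exp_add]
    congr 1
    field_simp
    ring
  rw [← h]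
  ring

theorem levelTheta_inversion (hd : ∀ i, 0 < d i) (i : Fin g) (hZ : Z ∈ siegel g)
    (m : ZD d) (v : Fin g → ℂ) :
    cexp (Real.pi * I * (Z i i * v i ^ 2 / d i ^ 2)) *
      levelTheta d Z (repr d m) ((denom (inversion i (d i)) Z)ᵀ *ᵥ v) =
      ∑ r : Fin (d i), 1 / (-I * Z i i) ^ (1 / 2 : ℂ) *
        cexp (-2 * Real.pi * I * ((r : ℕ) * (m i : ℕ) / d i)) *
        levelTheta d (siegelAct (inversion i (d i)) Z) (repr d (Function.update m i r)) v := by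
  have hZ' := siegelAct_mem (inversion_mem i (hd i)) hZ
  set ν : Fin g → ℂ := fun j => (repr d m j : ℂ) / d j with hν
  have hupd (r : Fin (d i)) : (fun j => (repr d (Function.update m i r) j : ℂ) / d j) =
      Function.update ν i ((r : ℕ) / d i) := by
    ext j
    by_cases h : j = i
    · subst h; simp [repr]
    · simp [repr, h, hν]
  have hs (r : Fin (d i)) := summable_thetaTerm_split i hZ' (Function.update ν i ((r : ℕ) / d i)) v
  simp only [partialVec_update, Function.update_self] at hs
  simp only [levelTheta, hupd, thetaSeries_split i hZ, thetaSeries_split i hZ', partialVec_update,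
    Function.update_self]
  rw [← tsum_mul_left]
  simp only [← tsum_mul_left (ι := { j // j ≠ i } → ℤ)]
  rw [← Summable.tsum_finsetSum fun r _ => (hs r).prod.mul_left _]
  refine tsum_congr fun k => ?_
  have := tsum_thetaTerm_inversion i (hd i) hZ (repr d m i) (partialVec_self i ν k) v
  simpa [hν, repr] using this

/-- `-i Z_ii` has positive real part, so the principal square root is continuous, and `ρ ^ 2 (-i
Z_ii) = -Z_ii / N`. -/
theorem isSqrtDet_inversion (i : Fin g) (N : ℕ) {ρ : ℂ} (hρ : ρ ^ 2 = -I / N) :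
    IsSqrtDet (inversion i N) fun Z => ρ * (-I * Z i i) ^ (1 / 2 : ℂ) := by
  refine ⟨continuousOn_const.mul (ContinuousOn.cpow_const ?_ fun Z hZ => ?_), fun Z hZ => ?_⟩
  · exact (continuous_const.mul (continuous_id.matrix_elem i i)).continuousOn
  · left
    simpa using im_diag_pos hZ i
  · rw [mul_pow, hρ, det_denom_inversion, one_div, ← Nat.cast_ofNat (R := ℂ) (n := 2),
      Complex.cpow_nat_inv_pow _ two_ne_zero]
    linear_combination (Z i i / N) * I_sq

theorem exists_isSqrtDet_inversion (i : Fin g) (N : ℕ) : ∃ s, IsSqrtDet (inversion i N) s := by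
  obtain ⟨ρ, hρ⟩ := IsAlgClosed.exists_pow_nat_eq (-I / N : ℂ) two_pos
  exact ⟨_, isSqrtDet_inversion i N hρ⟩

/-- `U` is `ρ` times a finite Fourier transform in the `i`-th coordinate, `ρ` being the constant
that is then cancelled by `(s Z)⁻¹`. Its determinant is never evaluated. -/
theorem hasTrans_inversion (hd : ∀ i, 0 < d i) (i : Fin g) :
    ∃ x, HasTrans d (inversion i (d i)) x := by
  obtain ⟨ρ, hρ⟩ := IsAlgClosed.exists_pow_nat_eq (-I / d i : ℂ) two_pos
  have hdi : (d i : ℂ) ≠ 0 := by exact_mod_cast (hd i).ne'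
  have hρ0 : ρ ≠ 0 := by
    rintro rfl
    have : (-I / d i : ℂ) ≠ 0 := div_ne_zero (by simp) hdi
    exact this (by rw [← hρ]; simp)
  refine ⟨_, _, ρ • Matrix.of fun m n => ∑ r : Fin (d i), if n = Function.update m i r then
    cexp (-2 * Real.pi * I * ((r : ℕ) * (m i : ℕ) / d i)) else 0,
    isSqrtDet_inversion i (d i) hρ, rfl, fun Z hZ => ?_⟩
  rw [isBaseChange_iff (inversion_mem i (hd i)) hZ]
  intro m v
  have h : v ⬝ᵥ ((denom (inversion i (d i)) Z *
      ((inversion i (d i)).toBlocks₂₁.map ((↑) : ℚ → ℂ))ᵀ) *ᵥ v) =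
      Z i i * v i ^ 2 / d i ^ 2 := by
    have h1 : (((inversion i (d i)).toBlocks₂₁.map ((↑) : ℚ → ℂ))ᵀ *ᵥ v) =
        Pi.single i (-(v i) / d i) + 0 := by
      rw [map_toBlocks₂₁_inversion, transpose_neg, transpose_single, neg_mulVec, single_mulVec,
        ← Pi.single, add_zero, ← Pi.single_neg]
      congr 1
      ring
    rw [← mulVec_mulVec, h1, denom_inversion_mulVec i _ _ rfl, add_zero, dotProduct_single]
    simp
    field_simp
  rw [h, levelTheta_inversion hd i hZ m v]
  simp only [Matrix.smul_apply, Matrix.of_apply, smul_eq_mul, Finset.mul_sum, Finset.sum_mul]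
  rw [Finset.sum_comm]
  refine Finset.sum_congr rfl fun r _ => ?_
  simp only [mul_ite, mul_zero, ite_mul, zero_mul, Finset.sum_ite_eq', Finset.mem_univ, if_true]
  rw [mul_inv]
  field_simp

end Inversion

/-! ### Generators of `Γ_D` -/

section Generators

variable {g : ℕ}

/-- The elementary matrix sending the row vector `(a, b)` to `(a, b + n a_i e_i)`. -/
def tMat (i : Fin g) (n : ℤ) : Matrix (Fin g ⊕ Fin g) (Fin g ⊕ Fin g) ℤ :=
  fromBlocks 1 (Matrix.single i i n) 0 1

/-- The matrix rotating the `i`-th hyperbolic plane. -/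
def jMat (i : Fin g) : Matrix (Fin g ⊕ Fin g) (Fin g ⊕ Fin g) ℤ :=
  fromBlocks (1 - Matrix.single i i 1) (Matrix.single i i 1) (-Matrix.single i i 1)
    (1 - Matrix.single i i 1)

/-- The matrix adding `n a_i` to `a_j`, for `d_j = d_i q`. -/
def pMat (i j : Fin g) (n q : ℤ) : Matrix (Fin g ⊕ Fin g) (Fin g ⊕ Fin g) ℤ :=
  fromBlocks (transvection i j n) 0 0 (transvection j i (-(n * q)))

/-- The matrix adding `n a_i` to `b_j`, for `d_j = d_i q`. -/
def sMat (i j : Fin g) (n q : ℤ) : Matrix (Fin g ⊕ Fin g) (Fin g ⊕ Fin g) ℤ :=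
  fromBlocks 1 (Matrix.single i j n + Matrix.single j i (n * q)) 0 1

/-- The inverse of `jMat i`. -/
def jInv (i : Fin g) : Matrix (Fin g ⊕ Fin g) (Fin g ⊕ Fin g) ℤ :=
  fromBlocks (1 - Matrix.single i i 1) (-Matrix.single i i 1) (Matrix.single i i 1)
    (1 - Matrix.single i i 1)

theorem vecMul_single_apply (x : Fin g → ℤ) (i j : Fin g) (c : ℤ) (a : Fin g) :
    (x ᵥ* Matrix.single i j c) a = if a = j then x i * c else 0 := by
  simp only [vecMul, dotProduct, Matrix.single_apply]
  by_cases h : a = j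
  · subst h; simp
  · simp [h, Ne.symm h]

variable (x : Fin g ⊕ Fin g → ℤ) (i j a : Fin g) (n q : ℤ)

theorem vecMul_tMat_inl : (x ᵥ* tMat i n) (Sum.inl a) = x (Sum.inl a) := by
  simp [tMat, vecMul_fromBlocks]

theorem vecMul_tMat_inr : (x ᵥ* tMat i n) (Sum.inr a) =
    x (Sum.inr a) + if a = i then x (Sum.inl i) * n else 0 := by
  simp [tMat, vecMul_fromBlocks, vecMul_single_apply, add_comm]

theorem vecMul_jMat_inl : (x ᵥ* jMat i) (Sum.inl a) =
    if a = i then -x (Sum.inr i) else x (Sum.inl a) := by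
  by_cases h : a = i
  · subst h; simp [jMat, vecMul_fromBlocks, vecMul_sub, vecMul_neg, vecMul_single_apply]
  · simp [jMat, vecMul_fromBlocks, vecMul_sub, vecMul_neg, vecMul_single_apply, h]

theorem vecMul_jMat_inr : (x ᵥ* jMat i) (Sum.inr a) =
    if a = i then x (Sum.inl i) else x (Sum.inr a) := by
  by_cases h : a = i
  · subst h; simp [jMat, vecMul_fromBlocks, vecMul_sub, vecMul_single_apply]
  · simp [jMat, vecMul_fromBlocks, vecMul_sub, vecMul_single_apply, h]

theorem vecMul_jInv_inl : (x ᵥ* jInv i) (Sum.inl a) =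
    if a = i then x (Sum.inr i) else x (Sum.inl a) := by
  by_cases h : a = i
  · subst h; simp [jInv, vecMul_fromBlocks, vecMul_sub, vecMul_single_apply]
  · simp [jInv, vecMul_fromBlocks, vecMul_sub, vecMul_single_apply, h]

theorem vecMul_jInv_inr : (x ᵥ* jInv i) (Sum.inr a) =
    if a = i then -x (Sum.inl i) else x (Sum.inr a) := by
  by_cases h : a = i
  · subst h; simp [jInv, vecMul_fromBlocks, vecMul_sub, vecMul_neg, vecMul_single_apply]
  · simp [jInv, vecMul_fromBlocks, vecMul_sub, vecMul_neg, vecMul_single_apply, h]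

theorem vecMul_pMat_inl : (x ᵥ* pMat i j n q) (Sum.inl a) =
    x (Sum.inl a) + if a = j then x (Sum.inl i) * n else 0 := by
  simp [pMat, vecMul_fromBlocks, transvection, vecMul_add, vecMul_single_apply]

theorem vecMul_pMat_inr : (x ᵥ* pMat i j n q) (Sum.inr a) =
    x (Sum.inr a) - if a = i then x (Sum.inr j) * (n * q) else 0 := by
  simp only [pMat, vecMul_fromBlocks, transvection, vecMul_add, Sum.elim_inr]
  by_cases h : a = i <;> simp [h, sub_eq_add_neg, vecMul_single_apply]

theorem vecMul_sMat_inl : (x ᵥ* sMat i j n q) (Sum.inl a) = x (Sum.inl a) := by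
  simp [sMat, vecMul_fromBlocks]

theorem vecMul_sMat_inr : (x ᵥ* sMat i j n q) (Sum.inr a) = x (Sum.inr a) +
    ((if a = j then x (Sum.inl i) * n else 0) + if a = i then x (Sum.inl j) * (n * q) else 0) := by
  simp [sMat, vecMul_fromBlocks, vecMul_add, vecMul_single_apply, add_comm]

/-- Reduces matrix identities to coordinates of a row vector, where products of elementary matrices
are successive operations read from left to right. -/
theorem eq_of_vecMul {A B : Matrix (Fin g ⊕ Fin g) (Fin g ⊕ Fin g) ℤ}
    (h1 : ∀ x a, (x ᵥ* A) (Sum.inl a) = (x ᵥ* B) (Sum.inl a))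
    (h2 : ∀ x a, (x ᵥ* A) (Sum.inr a) = (x ᵥ* B) (Sum.inr a)) : A = B := by
  ext r c
  have hA : (Pi.single r 1 ᵥ* A) c = A r c := by simp
  have hB : (Pi.single r 1 ᵥ* B) c = B r c := by simp
  rw [← hA, ← hB]
  cases c
  · exact h1 _ _
  · exact h2 _ _

theorem jInv_mul_jMat : jInv i * jMat i = 1 := by
  apply eq_of_vecMul <;> intro x a <;>
    simp only [← vecMul_vecMul, vecMul_jMat_inl, vecMul_jMat_inr, vecMul_jInv_inl,
      vecMul_jInv_inr, vecMul_one] <;> split_ifs <;> simp_all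

theorem jMat_mul_jInv : jMat i * jInv i = 1 := by
  apply eq_of_vecMul <;> intro x a <;>
    simp only [← vecMul_vecMul, vecMul_jMat_inl, vecMul_jMat_inr, vecMul_jInv_inl,
      vecMul_jInv_inr, vecMul_one] <;> split_ifs <;> simp_all

theorem jInv_eq : jInv i = jMat i * jMat i * jMat i := by
  apply eq_of_vecMul <;> intro x a <;>
    simp only [← vecMul_vecMul, vecMul_jMat_inl, vecMul_jMat_inr, vecMul_jInv_inl,
      vecMul_jInv_inr] <;> split_ifs <;> simp_all

theorem tMat_mul_tMat_neg : tMat i n * tMat i (-n) = 1 := by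
  apply eq_of_vecMul <;> intro x a <;>
    simp only [← vecMul_vecMul, vecMul_tMat_inl, vecMul_tMat_inr, vecMul_one] <;>
    split_ifs <;> simp_all

theorem pMat_mul_pMat_neg {i j : Fin g} (hij : i ≠ j) (n q : ℤ) :
    pMat i j n q * pMat i j (-n) q = 1 := by
  apply eq_of_vecMul <;> intro x a <;>
    simp only [← vecMul_vecMul, vecMul_pMat_inl, vecMul_pMat_inr, vecMul_one] <;>
    split_ifs <;> simp_all

/-- The factorization of the Weyl element of `SL₂` into three unipotents, the middle one being the
opposite unipotent `J⁻¹ T J`. -/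
theorem jMat_eq : jMat i = tMat i 1 * jInv i * tMat i 1 * jMat i * tMat i 1 := by
  apply eq_of_vecMul <;> intro x a <;>
    simp only [← vecMul_vecMul, vecMul_tMat_inl, vecMul_tMat_inr, vecMul_jMat_inl,
      vecMul_jMat_inr, vecMul_jInv_inl, vecMul_jInv_inr] <;> split_ifs <;> simp_all

theorem sMat_eq {i j : Fin g} (hij : i ≠ j) (n q : ℤ) :
    sMat i j n q = jMat j * pMat i j (-n) q * jInv j := by
  apply eq_of_vecMul <;> intro x a <;>
    simp only [← vecMul_vecMul, vecMul_sMat_inl, vecMul_sMat_inr, vecMul_jMat_inl,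
      vecMul_jMat_inr, vecMul_jInv_inl, vecMul_jInv_inr, vecMul_pMat_inl, vecMul_pMat_inr] <;>
    split_ifs <;> simp_all <;> ring

/-- The commutator of the inverse of `pMat` with `tMat j 1` is a mixed translation `sMat`, up to a
translation in plane `i`, which `-(n ^ 2 * q)` removes; conjugation by the rotation of plane `j`
turns it into `pMat`. Any homomorphism to an abelian group is thus determined on `pMat` by its
values on translations. -/
theorem pMat_eq {i j : Fin g} (hij : i ≠ j) (n q : ℤ) :
    pMat i j n q = jInv j * (pMat i j (-n) q * tMat j 1 * pMat i j n q * tMat j (-1) *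
      tMat i (-(n ^ 2 * q))) * jMat j := by
  apply eq_of_vecMul <;> intro x a <;>
    simp only [← vecMul_vecMul, vecMul_tMat_inl, vecMul_tMat_inr, vecMul_jMat_inl,
      vecMul_jMat_inr, vecMul_jInv_inl, vecMul_jInv_inr, vecMul_pMat_inl, vecMul_pMat_inr] <;>
    split_ifs <;> simp_all <;> ring

/-- The alternating form of type `d` on row vectors. -/
def altForm (d : Fin g → ℕ) (x y : Fin g ⊕ Fin g → ℤ) : ℤ :=
  ∑ i, (d i : ℤ) * (x (Sum.inl i) * y (Sum.inr i) - x (Sum.inr i) * y (Sum.inl i))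

theorem altForm_eq (d : Fin g → ℕ) (x y : Fin g ⊕ Fin g → ℤ) :
    altForm d x y =
      x ⬝ᵥ (fromBlocks 0 (typeMatrix ℤ d) (-typeMatrix ℤ d) 0 *ᵥ y) := by
  simp only [altForm, dotProduct, fromBlocks_mulVec, Fintype.sum_sum_type, Sum.elim_inl,
    Sum.elim_inr, zero_mulVec, zero_add, add_zero, neg_mulVec, typeMatrix, mulVec_diagonal,
    Pi.neg_apply, Function.comp_apply, ← Finset.sum_add_distrib]
  exact Finset.sum_congr rfl fun i _ => by ring

theorem mem_GammaD_iff {d : Fin g → ℕ} {R : Matrix (Fin g ⊕ Fin g) (Fin g ⊕ Fin g) ℤ} :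
    R ∈ GammaD d ↔ ∀ x y, altForm d (x ᵥ* R) (y ᵥ* R) = altForm d x y := by
  simp only [altForm_eq]
  set Ω : Matrix (Fin g ⊕ Fin g) (Fin g ⊕ Fin g) ℤ :=
    fromBlocks 0 (typeMatrix ℤ d) (-typeMatrix ℤ d) 0 with hΩ
  have h1 (x y : Fin g ⊕ Fin g → ℤ) :
      (x ᵥ* R) ⬝ᵥ (Ω *ᵥ (y ᵥ* R)) = x ⬝ᵥ ((R * Ω * Rᵀ) *ᵥ y) := by
    rw [← mulVec_transpose R y, ← dotProduct_mulVec, mulVec_mulVec, mulVec_mulVec,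
      Matrix.mul_assoc]
  simp only [h1]
  refine ⟨fun h x y => ?_, fun h => ?_⟩
  · have h' : R * Ω * Rᵀ = Ω := h
    rw [h']
  · change R * Ω * Rᵀ = Ω
    ext a b
    have := h (Pi.single a 1) (Pi.single b 1)
    simpa using this

theorem mul_mem_GammaD {d : Fin g → ℕ} {A B : Matrix (Fin g ⊕ Fin g) (Fin g ⊕ Fin g) ℤ}
    (hA : A ∈ GammaD d) (hB : B ∈ GammaD d) : A * B ∈ GammaD d := by
  rw [mem_GammaD_iff] at *
  intro x y
  rw [← vecMul_vecMul, ← vecMul_vecMul, hB, hA]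

theorem one_mem_GammaD {d : Fin g → ℕ} :
    (1 : Matrix (Fin g ⊕ Fin g) (Fin g ⊕ Fin g) ℤ) ∈ GammaD d := by
  simp [mem_GammaD_iff]

theorem tMat_mem (d : Fin g → ℕ) : tMat i n ∈ GammaD d := by
  refine mem_GammaD_iff.mpr fun x y => Finset.sum_congr rfl fun a _ => ?_
  simp only [vecMul_tMat_inl, vecMul_tMat_inr]
  split_ifs with h
  · subst h; ring
  · ring

theorem jMat_mem (d : Fin g → ℕ) : jMat i ∈ GammaD d := by
  refine mem_GammaD_iff.mpr fun x y => Finset.sum_congr rfl fun a _ => ?_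
  simp only [vecMul_jMat_inl, vecMul_jMat_inr]
  split_ifs with h
  · subst h; ring
  · ring

theorem pMat_mem {d : Fin g → ℕ} (i j : Fin g) (n : ℤ) {q : ℤ}
    (hq : (d j : ℤ) = d i * q) (hij : i ≠ j) : pMat i j n q ∈ GammaD d := by
  refine mem_GammaD_iff.mpr fun x y => ?_
  rw [← sub_eq_zero, altForm, altForm, ← Finset.sum_sub_distrib]
  simp only [vecMul_pMat_inl, vecMul_pMat_inr]
  have h (a : Fin g) : (d a : ℤ) * ((x (Sum.inl a) + if a = j then x (Sum.inl i) * n else 0) *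
      (y (Sum.inr a) - if a = i then y (Sum.inr j) * (n * q) else 0) -
      (x (Sum.inr a) - if a = i then x (Sum.inr j) * (n * q) else 0) *
      (y (Sum.inl a) + if a = j then y (Sum.inl i) * n else 0)) -
      (d a : ℤ) * (x (Sum.inl a) * y (Sum.inr a) - x (Sum.inr a) * y (Sum.inl a)) =
      (if a = j then (d j : ℤ) * (x (Sum.inl i) * n * y (Sum.inr j) -
        y (Sum.inl i) * n * x (Sum.inr j)) else 0) -
      (if a = i then (d i : ℤ) * (n * q) * (x (Sum.inl i) * y (Sum.inr j) -
        y (Sum.inl i) * x (Sum.inr j)) else 0) := by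
    by_cases h1 : a = j
    · have h2 : a ≠ i := fun h => hij (h.symm.trans h1)
      simp only [h1, if_true, hij.symm, if_false]
      ring
    · by_cases h2 : a = i
      · simp only [h2, if_true, hij, if_false]
        ring
      · simp only [h1, h2, if_false]
        ring
  simp only [h, Finset.sum_sub_distrib, Finset.sum_ite_eq', Finset.mem_univ, if_true, hq]
  ring

end Generators

/-! ### Generation of `Γ_D` by elementary matrices -/

section Generation

variable {g : ℕ} {d : Fin g → ℕ}

/-- The elementary matrices in the hyperbolic planes of index at least `k`. -/
inductive IsElementary (d : Fin g → ℕ) (k : ℕ) :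
    Matrix (Fin g ⊕ Fin g) (Fin g ⊕ Fin g) ℤ → Prop
  | translation (i : Fin g) (n : ℤ) (hi : k ≤ i) : IsElementary d k (tMat i n)
  | rotation (i : Fin g) (hi : k ≤ i) : IsElementary d k (jMat i)
  | mixed (i j : Fin g) (n q : ℤ) (hi : k ≤ i) (hij : i < j) (hq : (d j : ℤ) = d i * q) :
    IsElementary d k (pMat i j n q)

/-- The monoid generated by the elementary matrices in the planes of index at least `k`. -/
def elementaryMonoid (d : Fin g → ℕ) (k : ℕ) :
    Submonoid (Matrix (Fin g ⊕ Fin g) (Fin g ⊕ Fin g) ℤ) :=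
  Submonoid.closure {R | IsElementary d k R}

variable {k : ℕ} {h : Matrix (Fin g ⊕ Fin g) (Fin g ⊕ Fin g) ℤ}

theorem tMat_mem_elementary {i : Fin g} (n : ℤ) (hi : k ≤ i) : tMat i n ∈ elementaryMonoid d k :=
  Submonoid.subset_closure (.translation i n hi)

theorem jMat_mem_elementary {i : Fin g} (hi : k ≤ i) : jMat i ∈ elementaryMonoid d k :=
  Submonoid.subset_closure (.rotation i hi)

theorem jInv_mem_elementary {i : Fin g} (hi : k ≤ i) : jInv i ∈ elementaryMonoid d k := by
  have := jMat_mem_elementary (d := d) hi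
  rw [jInv_eq]
  exact mul_mem (mul_mem this this) this

theorem pMat_mem_elementary {i j : Fin g} (n : ℤ) {q : ℤ} (hi : k ≤ i) (hij : i < j)
    (hq : (d j : ℤ) = d i * q) : pMat i j n q ∈ elementaryMonoid d k :=
  Submonoid.subset_closure (.mixed i j n q hi hij hq)

theorem sMat_mem_elementary {i j : Fin g} (n : ℤ) {q : ℤ} (hi : k ≤ i) (hij : i < j)
    (hq : (d j : ℤ) = d i * q) : sMat i j n q ∈ elementaryMonoid d k := by
  have hj : k ≤ j := hi.trans hij.le
  rw [sMat_eq hij.ne]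
  exact mul_mem (mul_mem (jMat_mem_elementary hj) (pMat_mem_elementary _ hi hij hq))
    (jInv_mem_elementary hj)

theorem elementaryMonoid_anti {k k' : ℕ} (hk : k ≤ k') :
    elementaryMonoid d k' ≤ elementaryMonoid d k := by
  refine Submonoid.closure_mono fun R hR => ?_
  induction hR with
  | translation i n hi => exact .translation i n (hk.trans hi)
  | rotation i hi => exact .rotation i (hk.trans hi)
  | mixed i j n q hi hij hq => exact .mixed i j n q (hk.trans hi) hij hq

theorem mem_GammaD_of_elementary (hh : h ∈ elementaryMonoid d k) : h ∈ GammaD d := by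
  induction hh using Submonoid.closure_induction with
  | mem R hR =>
    induction hR with
    | translation i n hi => exact tMat_mem i n d
    | rotation i hi => exact jMat_mem i d
    | mixed i j n q hi hij hq => exact pMat_mem i j n hq hij.ne
  | one => exact one_mem_GammaD
  | mul A B _ _ hA hB => exact mul_mem_GammaD hA hB

theorem exists_right_inverse_elementary (hh : h ∈ elementaryMonoid d k) :
    ∃ h' ∈ elementaryMonoid d k, h * h' = 1 := by
  induction hh using Submonoid.closure_induction with
  | mem R hR =>
    induction hR with
    | translation i n hi => exact ⟨_, tMat_mem_elementary (-n) hi, tMat_mul_tMat_neg i n⟩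
    | rotation i hi => exact ⟨_, jInv_mem_elementary hi, jMat_mul_jInv i⟩
    | mixed i j n q hi hij hq =>
      exact ⟨_, pMat_mem_elementary (-n) hi hij hq, pMat_mul_pMat_neg hij.ne n q⟩
  | one => exact ⟨1, one_mem _, one_mul 1⟩
  | mul A B _ _ hA hB =>
    obtain ⟨A', hA', hAA⟩ := hA
    obtain ⟨B', hB', hBB⟩ := hB
    refine ⟨B' * A', mul_mem hB' hA', ?_⟩
    rw [Matrix.mul_assoc, ← Matrix.mul_assoc B, hBB, Matrix.one_mul, hAA]

theorem vecMul_elementary_apply (hh : h ∈ elementaryMonoid d k) (x : Fin g ⊕ Fin g → ℤ)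
    {a : Fin g} (ha : (a : ℕ) < k) :
    (x ᵥ* h) (Sum.inl a) = x (Sum.inl a) ∧ (x ᵥ* h) (Sum.inr a) = x (Sum.inr a) := by
  have hne {i : Fin g} (hi : k ≤ i) : a ≠ i := fun h => by subst h; omega
  induction hh using Submonoid.closure_induction generalizing x with
  | mem R hR =>
    induction hR with
    | translation i n hi => simp [vecMul_tMat_inl, vecMul_tMat_inr, hne hi]
    | rotation i hi => simp [vecMul_jMat_inl, vecMul_jMat_inr, hne hi]
    | mixed i j n q hi hij hq =>
      simp [vecMul_pMat_inl, vecMul_pMat_inr, hne hi, hne (hi.trans hij.le)]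
  | one => simp
  | mul A B _ _ hA hB =>
    rw [← vecMul_vecMul, (hB _).1, (hB _).2, (hA _).1, (hA _).2]
    exact ⟨rfl, rfl⟩

theorem vecMul_elementary_eq_self (hh : h ∈ elementaryMonoid d k) {x : Fin g ⊕ Fin g → ℤ}
    (hx : ∀ a : Fin g, k ≤ a → x (Sum.inl a) = 0 ∧ x (Sum.inr a) = 0) : x ᵥ* h = x := by
  induction hh using Submonoid.closure_induction with
  | mem R hR =>
    induction hR with
    | translation i n hi =>
      ext (a | a)
      · simp [vecMul_tMat_inl]
      · simp [vecMul_tMat_inr, hx i hi]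
    | rotation i hi =>
      ext (a | a)
      · by_cases h : a = i
        · subst h; simp [vecMul_jMat_inl, hx a hi]
        · simp [vecMul_jMat_inl, h]
      · by_cases h : a = i
        · subst h; simp [vecMul_jMat_inr, hx a hi]
        · simp [vecMul_jMat_inr, h]
    | mixed i j n q hi hij hq =>
      ext (a | a)
      · simp [vecMul_pMat_inl, hx i hi]
      · simp [vecMul_pMat_inr, hx j (hi.trans hij.le)]
  | one => simp
  | mul A B _ _ hA hB => rw [← vecMul_vecMul, hA, hB]

/-- Row vectors supported in the hyperbolic planes of index at least `k`. -/
def SupportedFrom (k : ℕ) (x : Fin g ⊕ Fin g → ℤ) : Prop :=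
  ∀ a : Fin g, (a : ℕ) < k → x (Sum.inl a) = 0 ∧ x (Sum.inr a) = 0

theorem SupportedFrom.vecMul {x : Fin g ⊕ Fin g → ℤ} (hx : SupportedFrom k x)
    (hh : h ∈ elementaryMonoid d k) : SupportedFrom k (x ᵥ* h) := fun a ha => by
  rw [(vecMul_elementary_apply hh x ha).1, (vecMul_elementary_apply hh x ha).2]
  exact hx a ha

/-- A coordinate `ε = ±1` is a pivot: multiples of it clear every plane beyond `k`, and then the
second coordinate of plane `k`. Each operation used fixes the second basis vector of plane `k`;
`exists_vecMul_eq_pair` depends on this. -/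
theorem exists_clear (hdvd : ∀ i j, i ≤ j → d i ∣ d j) (k : Fin g) {x : Fin g ⊕ Fin g → ℤ}
    (hx : SupportedFrom k x) {ε : ℤ} (hε : ε * ε = 1) (hxk : x (Sum.inl k) = ε) :
    ∃ h ∈ elementaryMonoid d k, x ᵥ* h = Pi.single (Sum.inl k) ε ∧
      (Pi.single (Sum.inr k) 1 : Fin g ⊕ Fin g → ℤ) ᵥ* h = Pi.single (Sum.inr k) 1 := by
  have key : ∀ T : Finset (Fin g), (∀ j ∈ T, k < j) → ∃ h ∈ elementaryMonoid d k,
      (x ᵥ* h) (Sum.inl k) = ε ∧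
      (Pi.single (Sum.inr k) 1 : Fin g ⊕ Fin g → ℤ) ᵥ* h = Pi.single (Sum.inr k) 1 ∧
      ∀ j ∈ T, (x ᵥ* h) (Sum.inl j) = 0 ∧ (x ᵥ* h) (Sum.inr j) = 0 := by
    intro T
    induction T using Finset.induction_on with
    | empty => exact fun _ => ⟨1, one_mem _, by simpa using hxk, by simp, by simp⟩
    | insert j T hj ih =>
      intro hT
      obtain ⟨h, hh, h1, h2, h3⟩ := ih fun i hi => hT i (Finset.mem_insert_of_mem hi)
      have hkj : k < j := hT j (Finset.mem_insert_self _ _)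
      obtain ⟨q, hq⟩ := hdvd k j hkj.le
      have hq' : (d j : ℤ) = d k * (q : ℤ) := by exact_mod_cast hq
      set y := x ᵥ* h with hy
      -- As `ε` is its own inverse, the multipliers `-ε y` cancel the two coordinates of plane `j`.
      -- Neither matrix touches the pivot or the planes already cleared.
      refine ⟨h * (pMat k j (-(ε * y (Sum.inl j))) q * sMat k j (-(ε * y (Sum.inr j))) q),
        mul_mem hh (mul_mem (pMat_mem_elementary _ le_rfl hkj hq')
          (sMat_mem_elementary _ le_rfl hkj hq')), ?_, ?_, fun i hi => ?_⟩
      · rw [← vecMul_vecMul, ← vecMul_vecMul, ← hy, vecMul_sMat_inl, vecMul_pMat_inl,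
          if_neg hkj.ne, add_zero, h1]
      · rw [← vecMul_vecMul, h2, ← vecMul_vecMul]
        ext (a | a)
        · simp [vecMul_sMat_inl, vecMul_pMat_inl, -single_vecMul]
        · simp [vecMul_sMat_inr, vecMul_pMat_inr, vecMul_pMat_inl, Pi.single_apply, hkj.ne',
            -single_vecMul]
      · have hik : i ≠ k := (hT i hi).ne'
        rw [← vecMul_vecMul, ← vecMul_vecMul, ← hy, vecMul_sMat_inl, vecMul_sMat_inr,
          vecMul_pMat_inl, vecMul_pMat_inl, vecMul_pMat_inl, vecMul_pMat_inr, h1, if_neg hik,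
          if_neg hik, if_neg hkj.ne]
        rcases Finset.mem_insert.mp hi with rfl | hi
        · simp only [if_true]
          constructor
          · linear_combination -(y (Sum.inl i)) * hε
          · linear_combination -(y (Sum.inr i)) * hε
        · have : i ≠ j := fun h => hj (h ▸ hi)
          simp [this, h3 i hi]
  obtain ⟨h, hh, h1, h2, h3⟩ := key (Finset.univ.filter fun j => k < j) (by simp)
  set y := x ᵥ* h with hy
  refine ⟨h * tMat k (-(ε * y (Sum.inr k))),
    mul_mem hh (tMat_mem_elementary _ le_rfl), ?_, ?_⟩
  · have hys : SupportedFrom k y := hx.vecMul hh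
    rw [← vecMul_vecMul, ← hy]
    ext (a | a)
    · rw [vecMul_tMat_inl]
      rcases lt_trichotomy a k with hak | rfl | hak
      · rw [(hys a hak).1, Pi.single_eq_of_ne (by simpa using hak.ne)]
      · rw [h1, Pi.single_eq_same]
      · rw [(h3 a (by simpa using hak)).1, Pi.single_eq_of_ne (by simpa using hak.ne')]
    · rw [vecMul_tMat_inr, Pi.single_eq_of_ne (by simp), h1]
      rcases lt_trichotomy a k with hak | rfl | hak
      · rw [(hys a hak).2, if_neg hak.ne, zero_add]
      · rw [if_pos rfl]
        linear_combination -(y (Sum.inr a)) * hε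
      · rw [(h3 a (by simpa using hak)).2, if_neg hak.ne', zero_add]
  · rw [← vecMul_vecMul, h2]
    ext (a | a)
    · simp [vecMul_tMat_inl]
    · simp [vecMul_tMat_inr]

/-- Suitable words move a nonzero multiple of any coordinate of `x` into the first slot of plane
`k`. If all results vanished, so would `x`, contradicting `altForm d x y = d k ≠ 0`. -/
theorem exists_vecMul_inl_ne_zero (hpos : ∀ i, 0 < d i) (hdvd : ∀ i j, i ≤ j → d i ∣ d j)
    (k : Fin g) {x y : Fin g ⊕ Fin g → ℤ} (hx : SupportedFrom k x)
    (hxy : altForm d x y = d k) : ∃ h ∈ elementaryMonoid d k, (x ᵥ* h) (Sum.inl k) ≠ 0 := by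
  by_contra! hz
  have h1 : x (Sum.inl k) = 0 := by simpa using hz 1 (one_mem _)
  have h2 : x (Sum.inr k) = 0 := by
    simpa [vecMul_jMat_inl] using hz _ (jMat_mem_elementary le_rfl)
  have h3 (j : Fin g) (hkj : k < j) : x (Sum.inl j) = 0 ∧ x (Sum.inr j) = 0 := by
    obtain ⟨q, hq⟩ := hdvd k j hkj.le
    have hq' : (d j : ℤ) = d k * (q : ℤ) := by exact_mod_cast hq
    have hq0 : q ≠ 0 := by
      rintro rfl
      exact (hpos j).ne' (by simpa using hq)
    constructor
    · have := hz _ (mul_mem (jMat_mem_elementary (i := j) hkj.le)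
        (mul_mem (pMat_mem_elementary 1 le_rfl hkj hq') (jMat_mem_elementary le_rfl)))
      rw [← vecMul_vecMul, ← vecMul_vecMul, vecMul_jMat_inl, if_pos rfl, vecMul_pMat_inr,
        if_pos rfl, vecMul_jMat_inr, vecMul_jMat_inr, if_pos rfl, if_neg hkj.ne, h2] at this
      simpa [hq0] using this
    · have := hz _ (mul_mem (pMat_mem_elementary 1 le_rfl hkj hq') (jMat_mem_elementary le_rfl))
      rw [← vecMul_vecMul, vecMul_jMat_inl, if_pos rfl, vecMul_pMat_inr,
        if_pos rfl, h2] at this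
      simpa [hq0] using this
  have h0 : altForm d x y = 0 := by
    refine Finset.sum_eq_zero fun a _ => ?_
    have : x (Sum.inl a) = 0 ∧ x (Sum.inr a) = 0 := by
      rcases lt_trichotomy a k with h | rfl | h
      exacts [hx a h, ⟨h1, h2⟩, h3 a h]
    rw [this.1, this.2]
    ring
  rw [h0] at hxy
  exact (hpos k).ne' (by exact_mod_cast hxy.symm)

/-- Euclidean algorithm: the smallest nonzero value `a` reached in the pivot slot divides enough of
the vector that `d k * a` divides the pairing `d k`, so `a` is a unit. -/
theorem exists_vecMul_eq_single (hpos : ∀ i, 0 < d i) (hdvd : ∀ i j, i ≤ j → d i ∣ d j)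
    (k : Fin g) {x y : Fin g ⊕ Fin g → ℤ} (hx : SupportedFrom k x)
    (hxy : altForm d x y = d k) :
    ∃ h ∈ elementaryMonoid d k, x ᵥ* h = Pi.single (Sum.inl k) 1 := by
  classical
  have hex : ∃ N : ℕ, N ≠ 0 ∧ ∃ h ∈ elementaryMonoid d k,
      ((x ᵥ* h) (Sum.inl k)).natAbs = N := by
    obtain ⟨h, hh, h0⟩ := exists_vecMul_inl_ne_zero hpos hdvd k hx hxy
    exact ⟨_, by simpa using h0, h, hh, rfl⟩
  obtain ⟨hN0, h, hh, hN⟩ := Nat.find_spec hex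
  have hmin := fun N hN => Nat.find_min hex (m := N) hN
  set N := Nat.find hex
  set z := x ᵥ* h with hz
  set a := z (Sum.inl k) with ha
  have ha0 : a ≠ 0 := by
    intro h0
    rw [h0] at hN
    exact hN0 hN.symm
  -- Otherwise a translation replaces the second coordinate by its remainder modulo `a`, and a
  -- rotation moves that smaller nonzero value into the pivot slot.
  have hdiv (h' : Matrix (Fin g ⊕ Fin g) (Fin g ⊕ Fin g) ℤ) (hh' : h' ∈ elementaryMonoid d k)
      (hl : (z ᵥ* h') (Sum.inl k) = a) : a ∣ (z ᵥ* h') (Sum.inr k) := by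
    by_contra hnd
    set b := (z ᵥ* h') (Sum.inr k) with hb
    refine hmin (b % a).natAbs ?_ ⟨?_, h * (h' * (tMat k (-(b / a)) * jMat k)), ?_, ?_⟩
    · rw [← hN]
      have h1 := Int.emod_lt_abs b ha0
      have h2 := Int.emod_nonneg b ha0
      rw [Int.abs_eq_natAbs] at h1
      omega
    · rw [Int.natAbs_ne_zero]
      exact fun h0 => hnd (Int.dvd_of_emod_eq_zero h0)
    · exact mul_mem hh (mul_mem hh' (mul_mem (tMat_mem_elementary _ le_rfl)
        (jMat_mem_elementary le_rfl)))
    · rw [← vecMul_vecMul, ← hz, ← vecMul_vecMul, ← vecMul_vecMul, vecMul_jMat_inl, if_pos rfl,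
        vecMul_tMat_inr, if_pos rfl, hl, ← hb, Int.natAbs_neg, Int.emod_def]
      congr 1
      ring
  have hk1 : a ∣ z (Sum.inr k) := by simpa using hdiv 1 (one_mem _) (by simp [ha])
  -- `pMat k i 1 q` subtracts `q` times the second coordinate of plane `i` from that of plane `k`,
  -- so `a` divides `q` times each coordinate after a rotation if needed. The factor `d i = d k * q`
  -- of the form compensates exactly for `q`.
  have hcoord (i : Fin g) : (d k : ℤ) * a ∣ d i * z (Sum.inl i) ∧
      (d k : ℤ) * a ∣ d i * z (Sum.inr i) := by
    rcases lt_trichotomy i k with hik | rfl | hik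
    · have := hx.vecMul hh i hik
      rw [hz, this.1, this.2]
      simp
    · exact ⟨mul_dvd_mul_left _ dvd_rfl, mul_dvd_mul_left _ hk1⟩
    · obtain ⟨q, hq⟩ := hdvd k i hik.le
      have hq' : (d i : ℤ) = d k * (q : ℤ) := by exact_mod_cast hq
      rw [hq', mul_assoc, mul_assoc]
      constructor
      · refine mul_dvd_mul_left _ ?_
        have := hdiv (jMat i * pMat k i 1 q) (mul_mem (jMat_mem_elementary hik.le)
          (pMat_mem_elementary 1 le_rfl hik hq')) (by
            rw [← vecMul_vecMul, vecMul_pMat_inl, if_neg hik.ne, vecMul_jMat_inl, if_neg hik.ne,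
              add_zero])
        rw [← vecMul_vecMul, vecMul_pMat_inr, if_pos rfl, vecMul_jMat_inr, vecMul_jMat_inr,
          if_pos rfl, if_neg hik.ne] at this
        simpa [mul_comm] using (dvd_sub_right hk1).mp this
      · refine mul_dvd_mul_left _ ?_
        have := hdiv (pMat k i 1 q) (pMat_mem_elementary 1 le_rfl hik hq') (by
            rw [vecMul_pMat_inl, if_neg hik.ne, add_zero])
        rw [vecMul_pMat_inr, if_pos rfl] at this
        simpa [mul_comm] using (dvd_sub_right hk1).mp this
  have hform : altForm d z (y ᵥ* h) = d k := by
    rw [hz, mem_GammaD_iff.mp (mem_GammaD_of_elementary hh), hxy]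
  have hd : (d k : ℤ) * a ∣ d k * 1 := by
    have h0 : (d k : ℤ) * a ∣ altForm d z (y ᵥ* h) := Finset.dvd_sum fun i _ => by
      rw [mul_sub, ← mul_assoc, ← mul_assoc]
      exact dvd_sub ((hcoord i).1.mul_right _) ((hcoord i).2.mul_right _)
    rw [mul_one]
    exact h0.trans (dvd_of_eq hform)
  have hdk : (d k : ℤ) ≠ 0 := by exact_mod_cast (hpos k).ne'
  have hunit : IsUnit a := isUnit_of_dvd_one ((mul_dvd_mul_iff_left hdk).mp hd)
  have hsq : a * a = 1 := Int.isUnit_mul_self hunit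
  obtain ⟨h', hh', h1, -⟩ := exists_clear hdvd k (hx.vecMul hh) hsq rfl
  rcases Int.isUnit_iff.mp hunit with h2 | h2
  · exact ⟨h * h', mul_mem hh hh', by rw [← vecMul_vecMul, ← hz, h1, h2]⟩
  -- The square of the rotation is `-1` on plane `k`, which repairs the sign of the pivot.
  · refine ⟨h * (h' * (jMat k * jMat k)), mul_mem hh (mul_mem hh' (mul_mem
      (jMat_mem_elementary le_rfl) (jMat_mem_elementary le_rfl))), ?_⟩
    rw [← vecMul_vecMul, ← hz, ← vecMul_vecMul, h1, h2, ← vecMul_vecMul]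
    ext (b | b)
    · by_cases hb : b = k <;>
        simp [vecMul_jMat_inl, vecMul_jMat_inr, hb, -single_vecMul]
    · by_cases hb : b = k <;>
        simp [vecMul_jMat_inl, vecMul_jMat_inr, hb, -single_vecMul]

theorem altForm_single_left (x : Fin g ⊕ Fin g → ℤ) (k : Fin g) :
    altForm d (Pi.single (Sum.inl k) 1) x = d k * x (Sum.inr k) := by
  rw [altForm, Finset.sum_eq_single k]
  · simp
  · intro b _ hb; simp [hb]
  · simp

theorem altForm_single_inr_left (x : Fin g ⊕ Fin g → ℤ) (k : Fin g) :
    altForm d (Pi.single (Sum.inr k) 1) x = -(d k * x (Sum.inl k)) := by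
  rw [altForm, Finset.sum_eq_single k]
  · simp
  · intro b _ hb; simp [hb]
  · simp

theorem exists_vecMul_eq_pair (hpos : ∀ i, 0 < d i) (hdvd : ∀ i j, i ≤ j → d i ∣ d j)
    (k : Fin g) {x y : Fin g ⊕ Fin g → ℤ} (hx : SupportedFrom k x) (hy : SupportedFrom k y)
    (hxy : altForm d x y = d k) :
    ∃ h ∈ elementaryMonoid d k, x ᵥ* h = Pi.single (Sum.inl k) 1 ∧
      y ᵥ* h = Pi.single (Sum.inr k) 1 := by
  obtain ⟨h, hh, h1⟩ := exists_vecMul_eq_single hpos hdvd k hx hxy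
  have h2 : (y ᵥ* h) (Sum.inr k) = 1 := by
    have hdk : (d k : ℤ) ≠ 0 := by exact_mod_cast (hpos k).ne'
    have h3 := mem_GammaD_iff.mp (mem_GammaD_of_elementary hh) x y
    rw [h1, altForm_single_left, hxy] at h3
    exact mul_left_cancel₀ hdk (by rw [h3, mul_one])
  -- After the rotation, the image of `y` has pivot `-1` and the image of `x` is the second basis
  -- vector of plane `k`, which clearing fixes. Rotating back restores both.
  have hj := jMat_mem_elementary (d := d) (i := k) le_rfl
  obtain ⟨h', hh', h4, h5⟩ := exists_clear (ε := -1) hdvd k ((hy.vecMul hh).vecMul hj) (by norm_num)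
    (by rw [vecMul_jMat_inl, if_pos rfl, h2])
  refine ⟨h * (jMat k * (h' * jInv k)), mul_mem hh (mul_mem hj (mul_mem hh'
    (jInv_mem_elementary le_rfl))), ?_, ?_⟩
  · have h6 : (Pi.single (Sum.inl k) 1 : Fin g ⊕ Fin g → ℤ) ᵥ* jMat k =
        Pi.single (Sum.inr k) 1 := by
      ext (b | b)
      · by_cases hb : b = k <;> simp [vecMul_jMat_inl, hb]
      · by_cases hb : b = k <;> simp [vecMul_jMat_inr, hb]
    rw [← vecMul_vecMul, h1, ← vecMul_vecMul, h6, ← vecMul_vecMul, h5]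
    ext (b | b)
    · by_cases hb : b = k <;> simp [vecMul_jInv_inl, hb]
    · by_cases hb : b = k <;> simp [vecMul_jInv_inr, hb]
  · rw [← vecMul_vecMul, ← vecMul_vecMul, ← vecMul_vecMul, h4]
    ext (b | b)
    · by_cases hb : b = k <;> simp [vecMul_jInv_inl, hb]
    · by_cases hb : b = k <;> simp [vecMul_jInv_inr, hb]

/-- `Γ_D` is generated by elementary matrices. -/
theorem GammaD_subset_elementaryMonoid (hpos : ∀ i, 0 < d i) (hdvd : ∀ i j, i ≤ j → d i ∣ d j)
    {R : Matrix (Fin g ⊕ Fin g) (Fin g ⊕ Fin g) ℤ} (hR : R ∈ GammaD d) :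
    R ∈ elementaryMonoid d 0 := by
  have key : ∀ m k : ℕ, m + k = g → ∀ R ∈ GammaD d,
      (∀ a : Fin g, (a : ℕ) < k →
        (Pi.single (Sum.inl a) 1 : Fin g ⊕ Fin g → ℤ) ᵥ* R = Pi.single (Sum.inl a) 1 ∧
        (Pi.single (Sum.inr a) 1 : Fin g ⊕ Fin g → ℤ) ᵥ* R = Pi.single (Sum.inr a) 1) →
      R ∈ elementaryMonoid d 0 := by
    intro m
    induction m with
    | zero =>
      intro k hk R _ hfix
      have : R = 1 := by
        ext r c
        have h1 : (Pi.single r 1 : Fin g ⊕ Fin g → ℤ) ᵥ* R = Pi.single r 1 := by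
          cases r with
          | inl a => exact (hfix a (by omega)).1
          | inr a => exact (hfix a (by omega)).2
        have h2 := congrFun h1 c
        rw [single_one_vecMul] at h2
        rw [show R r c = R.row r c from rfl, h2, Matrix.one_apply, Pi.single_apply]
        simp only [eq_comm]
      rw [this]
      exact one_mem _
    | succ m ih =>
      intro k hk R hR hfix
      set κ : Fin g := ⟨k, by omega⟩ with hκ
      have hform := mem_GammaD_iff.mp hR
      -- Since `R` preserves the form and fixes the first `k` planes, it preserves their orthogonal
      -- complement.
      have hsupp (z : Fin g ⊕ Fin g → ℤ)
          (hz : ∀ a : Fin g, (a : ℕ) < k → z (Sum.inl a) = 0 ∧ z (Sum.inr a) = 0) :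
          SupportedFrom (κ : ℕ) (z ᵥ* R) := by
        intro a ha
        have hda : (d a : ℤ) ≠ 0 := by exact_mod_cast (hpos a).ne'
        have h1 := hform (Pi.single (Sum.inl a) 1) z
        have h2 := hform (Pi.single (Sum.inr a) 1) z
        rw [(hfix a ha).1, altForm_single_left, altForm_single_left, (hz a ha).2] at h1
        rw [(hfix a ha).2, altForm_single_inr_left, altForm_single_inr_left, (hz a ha).1] at h2
        simp only [mul_zero, neg_zero, neg_eq_zero, mul_eq_zero, hda, false_or] at h1 h2
        exact ⟨h2, h1⟩
      have hne (a : Fin g) (ha : (a : ℕ) < k) : a ≠ κ := fun h => by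
        rw [h] at ha; exact lt_irrefl _ ha
      obtain ⟨h, hh, h1, h2⟩ := exists_vecMul_eq_pair hpos hdvd κ
        (hsupp (Pi.single (Sum.inl κ) 1) fun a ha => by simp [hne a ha])
        (hsupp (Pi.single (Sum.inr κ) 1) fun a ha => by simp [hne a ha])
        (by rw [hform, altForm_single_left]; simp)
      have hRh : R * h ∈ elementaryMonoid d 0 := by
        refine ih (k + 1) (by omega) _ (mul_mem_GammaD hR (mem_GammaD_of_elementary hh))
          fun a ha => ?_
        rcases Nat.lt_succ_iff_lt_or_eq.mp ha with ha | ha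
        · have hfa := vecMul_elementary_eq_self hh
            (x := (Pi.single (Sum.inl a) 1 : Fin g ⊕ Fin g → ℤ)) fun b hb => by
              have : b ≠ a := fun h => by subst h; exact absurd ha (not_lt.mpr hb)
              simp [this]
          have hfb := vecMul_elementary_eq_self hh
            (x := (Pi.single (Sum.inr a) 1 : Fin g ⊕ Fin g → ℤ)) fun b hb => by
              have : b ≠ a := fun h => by subst h; exact absurd ha (not_lt.mpr hb)
              simp [this]
          rw [← vecMul_vecMul, ← vecMul_vecMul, (hfix a ha).1, (hfix a ha).2]
          exact ⟨hfa, hfb⟩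
        · have : a = κ := Fin.ext ha
          subst this
          rw [← vecMul_vecMul, ← vecMul_vecMul]
          exact ⟨h1, h2⟩
      obtain ⟨h', hh', h3⟩ := exists_right_inverse_elementary hh
      have : R = R * h * h' := by rw [Matrix.mul_assoc, h3, Matrix.mul_one]
      rw [this]
      exact mul_mem hRh (elementaryMonoid_anti (Nat.zero_le _) hh')
  exact key g 0 (by omega) R hR fun a ha => absurd ha (Nat.not_lt_zero _)

end Generation

/-! ### The groups `Γ_D` and `G_D` -/

section Lift

variable {g : ℕ} {d : Fin g → ℕ}

/-- The element of `G_D` attached to an element of `Γ_D`. -/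
noncomputable def ratLift (d : Fin g → ℕ) (R : Matrix (Fin g ⊕ Fin g) (Fin g ⊕ Fin g) ℤ) :
    Matrix (Fin g ⊕ Fin g) (Fin g ⊕ Fin g) ℚ :=
  (fromBlocks 1 0 0 (typeMatrix ℚ d))⁻¹ * R.map ((↑) : ℤ → ℚ) * fromBlocks 1 0 0 (typeMatrix ℚ d)

theorem isUnit_det_levelBlock (hd : ∀ i, 0 < d i) :
    IsUnit (fromBlocks (1 : Matrix (Fin g) (Fin g) ℚ) 0 0 (typeMatrix ℚ d)).det := by
  rw [det_fromBlocks_zero₂₁, det_one, one_mul, typeMatrix, det_diagonal, isUnit_iff_ne_zero]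
  exact Finset.prod_ne_zero_iff.mpr fun i _ => by exact_mod_cast (hd i).ne'

theorem ratLift_eq (hd : ∀ i, 0 < d i) {R : Matrix (Fin g ⊕ Fin g) (Fin g ⊕ Fin g) ℤ}
    {M : Matrix (Fin g ⊕ Fin g) (Fin g ⊕ Fin g) ℚ}
    (h : R.map ((↑) : ℤ → ℚ) * fromBlocks 1 0 0 (typeMatrix ℚ d) =
      fromBlocks 1 0 0 (typeMatrix ℚ d) * M) : ratLift d R = M := by
  rw [ratLift, Matrix.mul_assoc, h, ← Matrix.mul_assoc,
    Matrix.nonsing_inv_mul _ (isUnit_det_levelBlock hd), Matrix.one_mul]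

theorem ratLift_apply (hd : ∀ i, 0 < d i) (R : Matrix (Fin g ⊕ Fin g) (Fin g ⊕ Fin g) ℤ)
    (r c : Fin g ⊕ Fin g) : ratLift d R r c =
      (Sum.elim (fun _ => (1 : ℚ)) (fun i => (d i : ℚ)) r)⁻¹ * R r c *
        Sum.elim (fun _ => (1 : ℚ)) (fun i => (d i : ℚ)) c := by
  have h : ratLift d R = Matrix.of fun r c =>
      (Sum.elim (fun _ => (1 : ℚ)) (fun i => (d i : ℚ)) r)⁻¹ * R r c *
        Sum.elim (fun _ => (1 : ℚ)) (fun i => (d i : ℚ)) c := by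
    apply ratLift_eq hd
    rw [← diagonal_one, typeMatrix, fromBlocks_diagonal]
    ext r c
    have hr : Sum.elim (fun _ => (1 : ℚ)) (fun i => (d i : ℚ)) r ≠ 0 := by
      cases r
      · simp
      · simpa using (hd _).ne'
    rw [mul_diagonal, diagonal_mul, Matrix.of_apply, Matrix.map_apply, ← mul_assoc, ← mul_assoc,
      mul_inv_cancel₀ hr, one_mul]
  rw [h, Matrix.of_apply]

theorem ratLift_mul (hd : ∀ i, 0 < d i) (R S : Matrix (Fin g ⊕ Fin g) (Fin g ⊕ Fin g) ℤ) :
    ratLift d (R * S) = ratLift d R * ratLift d S := by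
  apply ratLift_eq hd
  have : (R * S).map ((↑) : ℤ → ℚ) = R.map ((↑) : ℤ → ℚ) * S.map ((↑) : ℤ → ℚ) :=
    Matrix.map_mul (f := Int.castRingHom ℚ)
  simp only [this, ratLift, ← Matrix.mul_assoc]
  rw [Matrix.mul_nonsing_inv _ (isUnit_det_levelBlock hd), Matrix.one_mul,
    Matrix.mul_nonsing_inv_cancel_right _ _ (isUnit_det_levelBlock hd)]

theorem ratLift_one (hd : ∀ i, 0 < d i) : ratLift d 1 = 1 := by
  apply ratLift_eq hd
  rw [Matrix.map_one _ Int.cast_zero Int.cast_one, Matrix.one_mul, Matrix.mul_one]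

theorem ratLift_tMat (hd : ∀ i, 0 < d i) (i : Fin g) (n : ℤ) :
    ratLift d (tMat i n) = translation i (n * d i) := by
  ext r c
  rw [ratLift_apply hd]
  have hne := fun i => (by exact_mod_cast (hd i).ne' : (d i : ℚ) ≠ 0)
  rcases r with r | r <;> rcases c with c | c <;>
    simp [tMat, translation, Matrix.one_apply, Matrix.single_apply]
  · split_ifs with h
    · rw [h.2]
    · rfl
  · split_ifs with h
    · subst h; simp [hne]
    · simp

theorem ratLift_jMat (hd : ∀ i, 0 < d i) (i : Fin g) :
    ratLift d (jMat i) = inversion i (d i) := by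
  ext r c
  rw [ratLift_apply hd]
  have hne := fun i => (by exact_mod_cast (hd i).ne' : (d i : ℚ) ≠ 0)
  rcases r with r | r <;> rcases c with c | c <;>
    simp [jMat, inversion, Matrix.one_apply, Matrix.single_apply]
  · split_ifs with h
    · rw [← h.2]
    · rfl
  · split_ifs with h
    · rw [h.1]
    · rfl
  · by_cases h1 : r = c
    · subst h1
      by_cases h2 : i = r <;> simp [h2, hne]
    · have h2 : ¬ (i = r ∧ i = c) := fun h => h1 (h.1.symm.trans h.2)
      simp [h1, h2]

theorem ratLift_pMat (hd : ∀ i, 0 < d i) {i j : Fin g} (n : ℤ) {q : ℤ}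
    (hq : (d j : ℤ) = d i * q) : ratLift d (pMat i j n q) = shear i j n := by
  ext r c
  rw [ratLift_apply hd]
  have hne := fun i => (by exact_mod_cast (hd i).ne' : (d i : ℚ) ≠ 0)
  have hq' : (d j : ℚ) = d i * q := by exact_mod_cast hq
  rcases r with r | r <;> rcases c with c | c <;>
    simp [pMat, shear, transvection, Matrix.one_apply, Matrix.single_apply]
  have h2 : (d j : ℚ)⁻¹ * (n * q) * d i = n := by
    have := hne j
    have := hne i
    field_simp
    rw [hq']; ring
  by_cases h1 : r = c
  · subst h1
    by_cases h3 : j = r ∧ i = r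
    · obtain ⟨rfl, rfl⟩ := h3
      simp [mul_add, add_mul, hne, h2]
    · simp [h3, hne]
  · by_cases h3 : j = r ∧ i = c
    · obtain ⟨rfl, rfl⟩ := h3
      simp [h1, h2]
    · simp [h1, h3]

theorem ratLift_mem (hd : ∀ i, 0 < d i) {R : Matrix (Fin g ⊕ Fin g) (Fin g ⊕ Fin g) ℤ}
    (hR : R ∈ elementaryMonoid d 0) : ratLift d R ∈ Matrix.symplecticGroup (Fin g) ℚ := by
  induction hR using Submonoid.closure_induction with
  | mem R hR =>
    rcases hR with ⟨i, n, -⟩ | ⟨i, -⟩ | ⟨i, j, n, q, -, hij, hq⟩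
    · rw [ratLift_tMat hd]; exact translation_mem _ _
    · rw [ratLift_jMat hd]; exact inversion_mem _ (hd i)
    · rw [ratLift_pMat hd n hq]; exact shear_mem hij.ne _
  | one => rw [ratLift_one hd]; exact one_mem _
  | mul R S _ _ hR hS => rw [ratLift_mul hd]; exact mul_mem hR hS

/-- Branches are explicit on generators and multiply by the cocycle rule. No parity of `d` is
needed, so this covers the types for which the rest is vacuous. -/
theorem exists_isSqrtDet_ratLift (hd : ∀ i, 0 < d i)
    {R : Matrix (Fin g ⊕ Fin g) (Fin g ⊕ Fin g) ℤ} (hR : R ∈ elementaryMonoid d 0) :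
    ∃ s, IsSqrtDet (ratLift d R) s := by
  induction hR using Submonoid.closure_induction with
  | mem R hR =>
    rcases hR with ⟨i, n, -⟩ | ⟨i, -⟩ | ⟨i, j, n, q, -, hij, hq⟩
    · rw [ratLift_tMat hd]
      exact ⟨_, isSqrtDet_one_of_det fun Z _ => by rw [denom_translation, det_one]⟩
    · rw [ratLift_jMat hd]
      exact exists_isSqrtDet_inversion _ _
    · rw [ratLift_pMat hd n hq]
      exact ⟨_, isSqrtDet_one_of_det fun Z _ => by
        rw [denom_shear, det_transvection_of_ne _ _ hij.ne']⟩
  | one =>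
    rw [ratLift_one hd]
    exact ⟨_, isSqrtDet_one_of_det fun Z _ => by rw [denom_one, det_one]⟩
  | mul R S _ hS' hR hS =>
    obtain ⟨s, hs⟩ := hR
    obtain ⟨t, ht⟩ := hS
    rw [ratLift_mul hd]
    exact ⟨_, hs.mul (ratLift_mem hd hS') ht⟩

end Lift

/-! ### Determinants of the transformation matrices -/

section Det

variable {g : ℕ} {d : Fin g → ℕ}

theorem sum_ZD (i : Fin g) (f : Fin (d i) → ℂ) :
    ∑ m : ZD d, f (m i) = (∏ j : {j // j ≠ i}, d j : ℕ) * ∑ a, f a := by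
  rw [← (Equiv.piSplitAt i fun j => Fin (d j)).symm.sum_comp, Fintype.sum_prod_type,
    Finset.mul_sum]
  refine Finset.sum_congr rfl fun a _ => ?_
  simp [Equiv.piSplitAt, Fintype.card_pi]

theorem sum_fin_sq (N : ℕ) :
    ∑ a : Fin N, ((a : ℕ) : ℂ) ^ 2 = (N : ℂ) * (N - 1) * (2 * N - 1) / 6 := by
  rw [Fin.sum_univ_eq_sum_range fun a => (a : ℂ) ^ 2]
  induction N with
  | zero => simp
  | succ N ih => rw [Finset.sum_range_succ, ih]; push_cast; ring

theorem sum_fin_id (N : ℕ) : ∑ a : Fin N, ((a : ℕ) : ℂ) = (N : ℂ) * (N - 1) / 2 := by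
  rw [Fin.sum_univ_eq_sum_range fun a => (a : ℂ)]
  induction N with
  | zero => simp
  | succ N ih => rw [Finset.sum_range_succ, ih]; push_cast; ring

theorem four_dvd_prod_ne (hg : 3 ≤ g) (he : ∀ i, 2 ∣ d i) (i : Fin g) :
    4 ∣ ∏ j : {j // j ≠ i}, d j := by
  have h1 : 1 < Fintype.card {j // j ≠ i} := by
    simp
    omega
  obtain ⟨a, b, hab⟩ := Fintype.one_lt_card_iff.mp h1
  calc 4 = 2 * 2 := rfl
    _ ∣ d a * d b := mul_dvd_mul (he a) (he b)
    _ = ∏ j ∈ {a, b}, d (j : {j // j ≠ i}) := (Finset.prod_pair (f := fun j : {j // j ≠ i} => d j) hab).symm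
    _ ∣ _ := Finset.prod_dvd_prod_of_subset _ _ _ (Finset.subset_univ _)

/-- Each value of `m i` occurs `4 k` times and the squares below `d i` sum to `d_i (d_i - 1)(2 d_i -
1) / 6`. The factor `4` cancels all of the denominator but `3`. -/
theorem prod_exp_translation (hg : 3 ≤ g) (hd : ∀ i, 0 < d i) (he : ∀ i, 2 ∣ d i) (i : Fin g)
    (n : ℤ) : ∃ k : ℕ, ∏ j : {j // j ≠ i}, d j = 4 * k ∧
      ∏ m : ZD d, cexp (-(Real.pi * I * (n * (m i : ℕ) ^ 2 / d i))) =
        cexp (2 * Real.pi * I * ((-(n * k * (d i - 1) * (2 * d i - 1)) : ℤ) / 3)) := by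
  obtain ⟨k, hk⟩ := four_dvd_prod_ne hg he i
  refine ⟨k, hk, ?_⟩
  have hdi : (d i : ℂ) ≠ 0 := by exact_mod_cast (hd i).ne'
  rw [← Complex.exp_sum]
  congr 1
  have h1 (m : ZD d) : -(Real.pi * I * (n * ((m i : ℕ) : ℂ) ^ 2 / d i)) =
      -(Real.pi * I * n / d i) * ((m i : ℕ) : ℂ) ^ 2 := by ring
  simp only [h1]
  rw [← Finset.mul_sum, sum_ZD i fun a => ((a : ℕ) : ℂ) ^ 2, hk, sum_fin_sq]
  push_cast
  field_simp
  ring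

theorem prod_exp_translation_pow_three (hg : 3 ≤ g) (hd : ∀ i, 0 < d i) (he : ∀ i, 2 ∣ d i)
    (i : Fin g) (n : ℤ) :
    (∏ m : ZD d, cexp (-(Real.pi * I * (n * (m i : ℕ) ^ 2 / d i)))) ^ 3 = 1 := by
  obtain ⟨k, -, h⟩ := prod_exp_translation hg hd he i n
  rw [h, ← Complex.exp_nat_mul, Complex.exp_eq_one_iff]
  refine ⟨-(n * k * (d i - 1) * (2 * d i - 1)), ?_⟩
  push_cast
  ring

/-- If `3 ∤ d i`, then `3` divides `(d_i - 1)(2 d_i - 1)`. If `3 ∣ d i`, some other `d j` is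
divisible by `3`: the last one when `i` is not last, and `d b` by hypothesis when it is. -/
theorem prod_exp_translation_eq_one (hg : 3 ≤ g) (hd : ∀ i, 0 < d i) (he : ∀ i, 2 ∣ d i)
    (hdvd : ∀ i j, i ≤ j → d i ∣ d j) {a b : Fin g} (ha : (a : ℕ) = g - 1) (hba : b ≠ a)
    (h3 : ¬ (3 ∣ d a ∧ Nat.gcd 3 (d b) = 1)) (i : Fin g) (n : ℤ) :
    ∏ m : ZD d, cexp (-(Real.pi * I * (n * (m i : ℕ) ^ 2 / d i))) = 1 := by
  obtain ⟨k, hk, h⟩ := prod_exp_translation hg hd he i n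
  have key : (3 : ℤ) ∣ k * (d i - 1) * (2 * d i - 1) := by
    by_cases h3i : 3 ∣ d i
    · have h1 : 3 ∣ ∏ j : {j // j ≠ i}, d j := by
        by_cases hi : i = a
        · subst hi
          have h4 : 3 ∣ d b := by
            by_contra h5
            exact h3 ⟨h3i, (Nat.Prime.coprime_iff_not_dvd Nat.prime_three).mpr h5⟩
          exact h4.trans (Finset.dvd_prod_of_mem (fun j : {j // j ≠ i} => d j)
            (Finset.mem_univ ⟨b, hba⟩))
        · have hia : i ≤ a := by
            have := i.2
            rw [Fin.le_def]
            omega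
          exact (h3i.trans (hdvd i a hia)).trans
            (Finset.dvd_prod_of_mem (fun j : {j // j ≠ i} => d j)
              (Finset.mem_univ ⟨a, fun h => hi h.symm⟩))
      rw [hk] at h1
      have h2 : (3 : ℤ) ∣ k := by omega
      exact (h2.mul_right _).mul_right _
    · have h1 : (3 : ℤ) ∣ d i - 1 ∨ (3 : ℤ) ∣ 2 * d i - 1 := by
        have h2 : d i % 3 = 1 ∨ d i % 3 = 2 := by omega
        omega
      rcases h1 with h1 | h1
      · exact (h1.mul_left _).mul_right _
      · exact h1.mul_left _
  obtain ⟨l, hl⟩ := key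
  rw [h, Complex.exp_eq_one_iff]
  refine ⟨-(n * l), ?_⟩
  have : -(n * k * (d i - 1) * (2 * d i - 1) : ℤ) = -(n * (3 * l)) := by rw [← hl]; ring
  rw [this]
  push_cast
  ring

/-- `HasTrans` for the element of `G_D` attached to an element of `Γ_D`. -/
def LiftTrans (d : Fin g → ℕ) (R : Matrix (Fin g ⊕ Fin g) (Fin g ⊕ Fin g) ℤ) (x : ℂ) : Prop :=
  ratLift d R ∈ Matrix.symplecticGroup (Fin g) ℚ ∧ HasTrans d (ratLift d R) x

theorem LiftTrans.mul (hd : ∀ i, 0 < d i) {R S : Matrix (Fin g ⊕ Fin g) (Fin g ⊕ Fin g) ℤ}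
    {x y : ℂ} (hR : LiftTrans d R x) (hS : LiftTrans d S y) : LiftTrans d (R * S) (x * y) := by
  rw [LiftTrans, ratLift_mul hd]
  exact ⟨mul_mem hR.1 hS.1, hR.2.mul hS.1 hS.2⟩

theorem LiftTrans.eq_one (hd : ∀ i, 0 < d i) (he : Even (∏ i, d i))
    {R : Matrix (Fin g ⊕ Fin g) (Fin g ⊕ Fin g) ℤ} {x : ℂ} (hR : LiftTrans d R x)
    (h : R = 1) : x = 1 := by
  subst h
  rw [LiftTrans, ratLift_one hd] at hR
  exact hR.2.eq_one hd he

theorem liftTrans_one (hd : ∀ i, 0 < d i) : LiftTrans d 1 1 := by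
  rw [LiftTrans, ratLift_one hd]
  refine ⟨one_mem _, fun _ => 1, 1, isSqrtDet_one_of_det fun Z _ => by rw [denom_one, det_one],
    det_one, fun Z hZ m v => ?_⟩
  rw [denom_one, siegelAct_one, transpose_one, one_mulVec]
  simp [Matrix.one_apply]

theorem liftTrans_tMat (hd : ∀ i, 0 < d i) {e : ℕ} (he : ∀ i, 2 ∣ d i)
    (ht : ∀ (i : Fin g) (n : ℤ),
      (∏ m : ZD d, cexp (-(Real.pi * I * (n * (m i : ℕ) ^ 2 / d i)))) ^ e = 1)
    (i : Fin g) (n : ℤ) : ∃ x, x ^ e = 1 ∧ LiftTrans d (tMat i n) x := by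
  refine ⟨_, ht i n, ?_⟩
  rw [LiftTrans, ratLift_tMat hd]
  exact ⟨translation_mem _ _, hasTrans_translation hd (he i) n⟩

/-- The relations `J ^ 4 = 1` and `jMat_eq` give `y ^ 4 = 1` and `y = t ^ 3`. They are used as words
equal to the identity, where `LiftTrans.eq_one` pins down the determinant. -/
theorem liftTrans_jMat (hd : ∀ i, 0 < d i) {e : ℕ} (hev : Even (∏ i, d i))
    (ht : ∀ (i : Fin g) (n : ℤ), ∃ x, x ^ e = 1 ∧ LiftTrans d (tMat i n) x)
    (i : Fin g) : ∃ x, x ^ 4 = 1 ∧ x ^ e = 1 ∧ LiftTrans d (jMat i) x := by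
  obtain ⟨y, hy⟩ : ∃ y, LiftTrans d (jMat i) y := by
    obtain ⟨y, hy⟩ := hasTrans_inversion hd i
    refine ⟨y, ?_⟩
    rw [LiftTrans, ratLift_jMat hd]
    exact ⟨inversion_mem _ (hd i), hy⟩
  obtain ⟨t, hte, htt⟩ := ht i 1
  have hinv : LiftTrans d (jInv i) (y * y * y) := by
    rw [jInv_eq]
    exact (hy.mul hd hy).mul hd hy
  have h4 : y * y * y * y = 1 := (hinv.mul hd hy).eq_one hd hev (jInv_mul_jMat i)
  have h7 := (hinv.mul hd ((((htt.mul hd hinv).mul hd htt).mul hd hy).mul hd htt)).eq_one hd hev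
    (by rw [← jMat_eq, jInv_mul_jMat])
  have hyt : y = t ^ 3 := by
    linear_combination -y * h7 + t ^ 3 * (y ^ 4 + 1) * h4
  refine ⟨y, by linear_combination h4, ?_, hy⟩
  rw [hyt, ← pow_mul, mul_comm, pow_mul, hte, one_pow]

/-- By `pMat_eq`, conjugation and the factors `pMat` and its inverse drop out of the determinant,
leaving the product of three translation determinants. -/
theorem liftTrans_pMat (hd : ∀ i, 0 < d i) {e : ℕ} (hev : Even (∏ i, d i))
    (ht : ∀ (i : Fin g) (n : ℤ), ∃ x, x ^ e = 1 ∧ LiftTrans d (tMat i n) x)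
    {i j : Fin g} (hij : i ≠ j) (n : ℤ) {q : ℤ} (hq : (d j : ℤ) = d i * q) :
    ∃ x, x ^ e = 1 ∧ LiftTrans d (pMat i j n q) x := by
  have hp (n : ℤ) : ∃ y, LiftTrans d (pMat i j n q) y := by
    obtain ⟨y, hy⟩ := hasTrans_shear hd hij
      (by exact_mod_cast Dvd.intro q hq.symm : d i ∣ d j) n
    refine ⟨y, ?_⟩
    rw [LiftTrans, ratLift_pMat hd n hq]
    exact ⟨shear_mem hij n, hy⟩
  obtain ⟨a, ha⟩ := hp n
  obtain ⟨b, hb⟩ := hp (-n)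
  obtain ⟨y, hy4, -, hy⟩ := liftTrans_jMat hd hev ht j
  obtain ⟨t₁, h1, ht1⟩ := ht j 1
  obtain ⟨t₂, h2, ht2⟩ := ht j (-1)
  obtain ⟨t₃, h3, ht3⟩ := ht i (-(n ^ 2 * q))
  have hinv : LiftTrans d (jInv j) (y * y * y) := by
    rw [jInv_eq]
    exact (hy.mul hd hy).mul hd hy
  have hab : a * b = 1 := (ha.mul hd hb).eq_one hd hev (pMat_mul_pMat_neg hij n q)
  have hneg : pMat i j (-n) q * pMat i j n q = 1 := by
    simpa using pMat_mul_pMat_neg hij (-n) q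
  have hrel := (hb.mul hd ((hinv.mul hd ((((hb.mul hd ht1).mul hd ha).mul hd ht2).mul hd
    ht3)).mul hd hy)).eq_one hd hev (by rw [← pMat_eq hij, hneg])
  have hat : a = t₁ * t₂ * t₃ := by
    linear_combination -a * hrel + t₁ * t₂ * t₃ * (a * b * y ^ 4 + y ^ 4) * hab +
      t₁ * t₂ * t₃ * hy4
  refine ⟨a, ?_, ha⟩
  rw [hat, mul_pow, mul_pow, h1, h2, h3, one_mul, one_mul]

theorem exists_liftTrans (hd : ∀ i, 0 < d i) {e : ℕ} (hev : Even (∏ i, d i))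
    (ht : ∀ (i : Fin g) (n : ℤ), ∃ x, x ^ e = 1 ∧ LiftTrans d (tMat i n) x)
    {R : Matrix (Fin g ⊕ Fin g) (Fin g ⊕ Fin g) ℤ} (hR : R ∈ elementaryMonoid d 0) :
    ∃ x, x ^ e = 1 ∧ LiftTrans d R x := by
  induction hR using Submonoid.closure_induction with
  | mem R hR =>
    rcases hR with ⟨i, n, -⟩ | ⟨i, -⟩ | ⟨i, j, n, q, -, hij, hq⟩
    · exact ht i n
    · obtain ⟨x, -, hx⟩ := liftTrans_jMat hd hev ht i
      exact ⟨x, hx⟩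
    · exact liftTrans_pMat hd hev ht hij.ne n hq
  | one => exact ⟨1, one_pow _, liftTrans_one hd⟩
  | mul R S _ _ hR hS =>
    obtain ⟨x, hx, hR⟩ := hR
    obtain ⟨y, hy, hS⟩ := hS
    exact ⟨x * y, by rw [mul_pow, hx, hy, one_mul], hR.mul hd hS⟩

end Det

/-! ### Change of characteristic -/

section Characteristic

variable {g : ℕ} {d : Fin g → ℕ}

/-- A permutation of a single coordinate acts on `ℤ_D` as `∏_{j ≠ i} d j` disjoint copies of itself,
an even number; a general one is a product of these. -/
theorem sign_piCongrRight (hK : ∀ i, Even (∏ j : {j // j ≠ i}, d j.1))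
    (τ : ∀ i, Equiv.Perm (Fin (d i))) :
    Equiv.Perm.sign (Equiv.piCongrRight τ : Equiv.Perm (ZD d)) = 1 := by
  have hsingle (i : Fin g) (σ : ∀ i, Equiv.Perm (Fin (d i))) (hσ : ∀ j, j ≠ i → σ j = 1) :
      Equiv.Perm.sign (Equiv.piCongrRight σ : Equiv.Perm (ZD d)) = 1 := by
    have h1 := Equiv.Perm.sign_symm_trans_trans (Equiv.piCongrRight σ : Equiv.Perm (ZD d))
      (Equiv.piSplitAt i fun j => Fin (d j))
    have h2 : ((Equiv.piSplitAt i fun j => Fin (d j)).symm.trans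
        (Equiv.piCongrRight σ : Equiv.Perm (ZD d))).trans (Equiv.piSplitAt i fun j => Fin (d j)) =
        Equiv.prodCongrLeft fun _ : (∀ j : {j // j ≠ i}, Fin (d j)) => σ i := by
      ext p
      · simp [Equiv.piSplitAt, Equiv.prodCongrLeft]
      · rename_i j
        simp [Equiv.piSplitAt, Equiv.prodCongrLeft, hσ j j.2, j.2]
    rw [← h1, h2, Equiv.Perm.sign_prodCongrLeft, Finset.prod_const, Finset.card_univ,
      Fintype.card_pi]
    obtain ⟨k, hk⟩ := hK i
    simp only [Fintype.card_fin]
    rw [hk, ← two_mul, pow_mul, Int.units_sq, one_pow]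
  have key (T : Finset (Fin g)) : Equiv.Perm.sign
      (Equiv.piCongrRight (fun i => if i ∈ T then τ i else 1) : Equiv.Perm (ZD d)) = 1 := by
    induction T using Finset.induction_on with
    | empty =>
      have : (Equiv.piCongrRight (fun i => if i ∈ (∅ : Finset (Fin g)) then τ i else 1) :
          Equiv.Perm (ZD d)) = 1 := by
        ext m i
        simp
      rw [this, map_one]
    | insert j T hj ih =>
      have : (Equiv.piCongrRight (fun i => if i ∈ insert j T then τ i else 1) :
          Equiv.Perm (ZD d)) = (Equiv.piCongrRight fun i => if i ∈ T then τ i else 1) *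
            (Equiv.piCongrRight fun i => if i = j then τ i else 1) := by
        ext m i
        by_cases h : i = j
        · subst h; simp [hj]
        · simp [h]
      rw [this, map_mul, ih, hsingle j _ fun i hi => if_neg hi, one_mul]
  simpa using key Finset.univ

/-- The translation by `a` on `ℤ/N`. -/
noncomputable def shiftFin {N : ℕ} (hN : 0 < N) (a : ℤ) : Equiv.Perm (Fin N) :=
  Equiv.ofBijective (fun x => ⟨((((x : ℕ) : ℤ) + a) % N).toNat, by
    have h := Int.emod_lt_of_pos (((x : ℕ) : ℤ) + a) (by exact_mod_cast hN : (0 : ℤ) < N)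
    have h' := Int.emod_nonneg (((x : ℕ) : ℤ) + a) (by exact_mod_cast hN.ne' : (N : ℤ) ≠ 0)
    omega⟩) <| Finite.injective_iff_bijective.mp fun x y h => by
    rw [Fin.mk.injEq] at h
    have hx := Int.emod_nonneg (((x : ℕ) : ℤ) + a) (by exact_mod_cast hN.ne' : (N : ℤ) ≠ 0)
    have hy := Int.emod_nonneg (((y : ℕ) : ℤ) + a) (by exact_mod_cast hN.ne' : (N : ℤ) ≠ 0)
    have h1 : (((x : ℕ) : ℤ) + a) % N = (((y : ℕ) : ℤ) + a) % N := by omega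
    have h2 : ((x : ℕ) : ℤ) % N = ((y : ℕ) : ℤ) % N := Int.ModEq.add_right_cancel' a h1
    apply Fin.ext
    have := x.2
    have := y.2
    rw [Int.emod_eq_of_lt, Int.emod_eq_of_lt] at h2 <;> omega

/-- The translation by `a` on `ℤ_D`. -/
noncomputable def shiftZD (hd : ∀ i, 0 < d i) (a : Fin g → ℤ) : Equiv.Perm (ZD d) :=
  Equiv.piCongrRight fun i => shiftFin (hd i) (a i)

theorem shiftZD_apply (hd : ∀ i, 0 < d i) (a : Fin g → ℤ) (m : ZD d) :
    shiftZD hd a m = residue d hd fun i => repr d m i + a i := rfl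

/-- The matrix expressing the theta functions of characteristic `(D⁻¹ a, n)` through those of
characteristic `0`. -/
noncomputable def charMatrix (hd : ∀ i, 0 < d i) (a n : Fin g → ℤ) : Matrix (ZD d) (ZD d) ℂ :=
  Matrix.diagonal (fun m => cexp (Real.pi * I * ∑ i, (n i : ℂ) * (2 * (m i : ℕ) + a i) / d i)) *
    (1 : Matrix (ZD d) (ZD d) ℂ).submatrix (shiftZD hd a) id

theorem charMatrix_apply (hd : ∀ i, 0 < d i) (a n : Fin g → ℤ) (m k : ZD d) :
    charMatrix hd a n m k =
      cexp (Real.pi * I * ∑ i, (n i : ℂ) * (2 * (m i : ℕ) + a i) / d i) *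
        if shiftZD hd a m = k then 1 else 0 := by
  rw [charMatrix, diagonal_mul, submatrix_apply, Matrix.one_apply, id]

theorem prod_ne_mul (i : Fin g) : d i * ∏ j : {j // j ≠ i}, d j = ∏ j, d j := by
  rw [← Finset.mul_prod_erase _ _ (Finset.mem_univ i)]
  congr 1
  exact (Finset.prod_subtype _ (by simp) d).symm

/-- The permutation is even by `sign_piCongrRight`. With `∏_{j ≠ i} d j = 2 k_i`, the diagonal
exponents sum to `2 π i ∑ n_i k_i (d_i - 1 + a_i)`. -/
theorem det_charMatrix (hd : ∀ i, 0 < d i) (hK : ∀ i, Even (∏ j : {j // j ≠ i}, d j.1))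
    (a n : Fin g → ℤ) : (charMatrix hd a n).det = 1 := by
  rw [charMatrix, det_mul, det_diagonal, det_permute, shiftZD, sign_piCongrRight hK, det_one,
    Units.val_one, Int.cast_one, mul_one, mul_one, ← Complex.exp_sum, ← Finset.mul_sum,
    Finset.sum_comm, Complex.exp_eq_one_iff]
  choose k hk using hK
  refine ⟨∑ i, n i * k i * (d i - 1 + a i), ?_⟩
  push_cast
  rw [Finset.mul_sum, Finset.sum_mul]
  refine Finset.sum_congr rfl fun i _ => ?_
  have hdi : (d i : ℂ) ≠ 0 := by exact_mod_cast (hd i).ne'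
  rw [sum_ZD i fun x => (n i : ℂ) * (2 * ((x : ℕ) : ℂ) + a i) / d i, ← Finset.sum_div,
    ← Finset.mul_sum, Finset.sum_add_distrib, ← Finset.mul_sum, sum_fin_id, hk]
  simp
  field_simp
  ring

theorem thetaBasis_eq_charMatrix (hd : ∀ i, 0 < d i) {Z : Matrix (Fin g) (Fin g) ℂ}
    (hZ : Z ∈ siegel g) {c : (Fin g → ℝ) × (Fin g → ℝ)} {a n : Fin g → ℤ}
    (ha : ∀ i, c.1 i = a i / d i) (hn : ∀ i, c.2 i = n i) (m : ZD d) (v : Fin g → ℂ) :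
    thetaBasis d Z c m v = ∑ k, charMatrix hd a n m k * thetaBasis d Z 0 k v := by
  simp only [charMatrix_apply, mul_ite, mul_one, mul_zero, ite_mul, zero_mul]
  rw [Finset.sum_ite_eq, if_pos (Finset.mem_univ _), thetaBasis_zero hZ, shiftZD_apply,
    levelTheta_repr_residue, thetaBasis_eq hZ fun i => ⟨n i, hn i⟩, levelTheta]
  have h1 : (2 * ∑ i, (c.2 i : ℂ) * ((repr d m i : ℂ) / d i) + ∑ i, (c.1 i : ℂ) * c.2 i) =
      ∑ i, (n i : ℂ) * (2 * (m i : ℕ) + a i) / d i := by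
    rw [Finset.mul_sum, ← Finset.sum_add_distrib]
    refine Finset.sum_congr rfl fun i _ => ?_
    rw [ha, hn]
    simp [repr]
    ring
  have h2 : (fun i => (repr d m i : ℂ) / d i + c.1 i) =
      fun i => ((repr d m i + a i : ℤ) : ℂ) / d i := by
    ext i
    rw [ha]
    push_cast
    ring
  rw [h1, h2]

theorem isBaseChange_char_iff (hd : ∀ i, 0 < d i)
    {M : Matrix (Fin g ⊕ Fin g) (Fin g ⊕ Fin g) ℚ} (hM : M ∈ Matrix.symplecticGroup (Fin g) ℚ)
    {Z : Matrix (Fin g) (Fin g) ℂ} (hZ : Z ∈ siegel g) {c : (Fin g → ℝ) × (Fin g → ℝ)}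
    {a n : Fin g → ℤ} (ha : ∀ i, c.1 i = a i / d i) (hn : ∀ i, c.2 i = n i)
    (C : Matrix (ZD d) (ZD d) ℂ) :
    IsBaseChange d M Z 0 c C ↔ IsBaseChange d M Z 0 0 (C * charMatrix hd a n) := by
  refine forall_congr' fun m => forall_congr' fun v => ?_
  simp only [thetaBasis_eq_charMatrix hd (siegelAct_mem hM hZ) ha hn, Finset.mul_sum,
    Matrix.mul_apply, Finset.sum_mul]
  rw [Finset.sum_comm]
  simp only [mul_assoc]

/-- The factor `1/2` in `M[0]` is absorbed by the even `d j` coming from conjugation by `D`, so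
`M[0]` lies in `D⁻¹ ℤ^g × ℤ^g`, where `charMatrix` applies. -/
theorem exists_charAct_ratLift (hd : ∀ i, 0 < d i) (he : ∀ i, 2 ∣ d i)
    (R : Matrix (Fin g ⊕ Fin g) (Fin g ⊕ Fin g) ℤ) : ∃ a n : Fin g → ℤ,
      (∀ i, (charAct d (ratLift d R) 0).1 i = a i / d i) ∧
      ∀ i, (charAct d (ratLift d R) 0).2 i = n i := by
  choose e he using he
  have hdi (i) : (d i : ℝ) ≠ 0 := by exact_mod_cast (hd i).ne'
  refine ⟨fun i => ∑ j, R (Sum.inr i) (Sum.inl j) * e j * R (Sum.inr i) (Sum.inr j),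
    fun i => ∑ j, R (Sum.inl i) (Sum.inl j) * e j * R (Sum.inl i) (Sum.inr j),
    fun i => ?_, fun i => ?_⟩
  · simp only [charAct, Prod.fst_zero, Prod.snd_zero, mulVec_zero, sub_zero, zero_add,
      Pi.smul_apply, smul_eq_mul, diag_apply, Matrix.mul_apply, typeMatrix, transpose_apply,
      map_apply, toBlocks₂₁, toBlocks₂₂, Matrix.of_apply, ratLift_apply hd]
    simp only [Matrix.diagonal_apply, ite_mul, zero_mul, Finset.sum_ite_eq,
      Finset.mem_univ, if_true, Sum.elim_inl, Sum.elim_inr]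
    push_cast
    rw [Finset.mul_sum, Finset.sum_div]
    refine Finset.sum_congr rfl fun j _ => ?_
    have h2 : (d j : ℝ) = 2 * e j := by exact_mod_cast he j
    have := hdi i
    rw [h2]
    field_simp
  · simp only [charAct, Prod.fst_zero, Prod.snd_zero, mulVec_zero, neg_zero, zero_add,
      Pi.smul_apply, smul_eq_mul, diag_apply, Matrix.mul_apply, transpose_apply,
      map_apply, toBlocks₁₁, toBlocks₁₂, Matrix.of_apply, ratLift_apply hd]
    simp only [Sum.elim_inl, Sum.elim_inr]
    push_cast
    rw [Finset.mul_sum]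
    refine Finset.sum_congr rfl fun j _ => ?_
    have h2 : (d j : ℝ) = 2 * e j := by exact_mod_cast he j
    rw [h2]
    field_simp

/-- Passes from the branch furnished by the generators to an arbitrary one: the other branch
replaces `U` by `-U`, which has the same determinant in even size. -/
theorem exists_baseChange_iff (hd : ∀ i, 0 < d i) (hev : Even (∏ i, d i))
    {M : Matrix (Fin g ⊕ Fin g) (Fin g ⊕ Fin g) ℚ} (hM : M ∈ Matrix.symplecticGroup (Fin g) ℚ)
    {x : ℂ} (h : HasTrans d M x) {s : Matrix (Fin g) (Fin g) ℂ → ℂ} (hs : IsSqrtDet M s) :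
    ∃ U : Matrix (ZD d) (ZD d) ℂ, U.det = x ∧ ∀ Z ∈ siegel g, ∀ C : Matrix (ZD d) (ZD d) ℂ,
      IsBaseChange d M Z 0 0 C ↔ C = (s Z)⁻¹ • U := by
  obtain ⟨t, U, ht, hx, hU⟩ := h
  obtain ⟨V, hV, hVU⟩ : ∃ V : Matrix (ZD d) (ZD d) ℂ, V.det = x ∧
      ∀ Z ∈ siegel g, (s Z)⁻¹ • V = (t Z)⁻¹ • U := by
    rcases hs.eq_or_eq_neg hM ht with h | h
    · exact ⟨U, hx, fun Z hZ => by rw [h Z hZ]⟩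
    · refine ⟨-U, ?_, fun Z hZ => ?_⟩
      · rw [det_neg, card_ZD, hev.neg_one_pow, one_mul, hx]
      · rw [h Z hZ, inv_neg, smul_neg, neg_smul, neg_neg]
  refine ⟨V, hV, fun Z hZ C => ?_⟩
  rw [hVU Z hZ]
  refine ⟨fun hC => hC.unique hd hM hZ (hU Z hZ), ?_⟩
  rintro rfl
  exact hU Z hZ

end Characteristic

end ThetaTransformation

/-! ### Assembly of the proposition -/

open ThetaTransformation

theorem proposition1p2 (g : ℕ) (hg : 3 ≤ g) (d : Fin g → ℕ) (hpos : ∀ i, 0 < d i)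
    (hdvd : ∀ i j, i ≤ j → d i ∣ d j)
    (M : Matrix (Fin g ⊕ Fin g) (Fin g ⊕ Fin g) ℚ) (hM : M ∈ ThetaTransformation.GD d) :
    (∃ s, ThetaTransformation.IsSqrtDet M s) ∧
    ∀ s, ThetaTransformation.IsSqrtDet M s →
    ∀ c' : (Fin g → ℝ) × (Fin g → ℝ), c' = ThetaTransformation.charAct d M 0 ∨ c' = 0 →
    ∃ CM : Matrix (ThetaTransformation.ZD d) (ThetaTransformation.ZD d) ℂ,
      (¬ (3 ∣ d ⟨g - 1, by omega⟩ ∧ Nat.gcd 3 (d ⟨g - 2, by omega⟩) = 1) → CM.det = 1) ∧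
      (3 ∣ d ⟨g - 1, by omega⟩ ∧ Nat.gcd 3 (d ⟨g - 2, by omega⟩) = 1 → CM.det ^ 3 = 1) ∧
      ∀ Z ∈ ThetaTransformation.siegel g,
        ThetaTransformation.IsTotallySymmetric (ThetaTransformation.lattice d Z)
          (ThetaTransformation.formH Z) (ThetaTransformation.chi Z 0) →
        ∀ C : Matrix (ThetaTransformation.ZD d) (ThetaTransformation.ZD d) ℂ,
          ThetaTransformation.IsBaseChange d M Z 0 c' C ↔ C = (s Z)⁻¹ • CM := by
  obtain ⟨hM, R, hR, hMR⟩ := hM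
  obtain rfl : M = ratLift d R := hMR
  have hRe := GammaD_subset_elementaryMonoid hpos hdvd hR
  refine ⟨exists_isSqrtDet_ratLift hpos hRe, fun s hs c' hc' => ?_⟩
  by_cases he : ∀ i, 2 ∣ d i
  swap
  -- Some `d i` is odd, so no `Z` satisfies the symmetry hypothesis and any matrix of determinant
  -- `1` serves.
  · refine ⟨1, fun _ => det_one, fun _ => by rw [det_one, one_pow], fun Z hZ hT => ?_⟩
    exact absurd (even_of_isTotallySymmetric hZ hT) he
  have hK (i : Fin g) : Even (∏ j : {j // j ≠ i}, d j.1) :=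
    even_iff_two_dvd.mpr (Dvd.dvd.trans (by norm_num) (four_dvd_prod_ne hg he i))
  have hev : Even (∏ i, d i) := by
    rw [← prod_ne_mul ⟨0, by omega⟩]
    exact (hK _).mul_left _
  obtain ⟨x, hx1, hx3, hx⟩ : ∃ x : ℂ,
      (¬ (3 ∣ d ⟨g - 1, by omega⟩ ∧ Nat.gcd 3 (d ⟨g - 2, by omega⟩) = 1) → x = 1) ∧
      (3 ∣ d ⟨g - 1, by omega⟩ ∧ Nat.gcd 3 (d ⟨g - 2, by omega⟩) = 1 → x ^ 3 = 1) ∧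
      LiftTrans d R x := by
    by_cases hb : 3 ∣ d ⟨g - 1, by omega⟩ ∧ Nat.gcd 3 (d ⟨g - 2, by omega⟩) = 1
    · obtain ⟨x, hxe, hx⟩ := exists_liftTrans hpos hev
        (liftTrans_tMat hpos he (prod_exp_translation_pow_three hg hpos he)) hRe
      exact ⟨x, fun h => absurd hb h, fun _ => hxe, hx⟩
    -- Outside the exceptional case the translation determinants are `1`, so the same argument runs
    -- with exponent `1` in place of `3`.
    · obtain ⟨x, hxe, hx⟩ := exists_liftTrans (e := 1) hpos hev
        (liftTrans_tMat hpos he fun i n => by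
          rw [prod_exp_translation_eq_one hg hpos he hdvd rfl
            (by rw [Ne, Fin.mk.injEq]; omega) hb, one_pow]) hRe
      exact ⟨x, fun _ => by rwa [pow_one] at hxe, fun h => absurd h hb, hx⟩
  obtain ⟨U, rfl, hU⟩ := exists_baseChange_iff hpos hev hM hx.2 hs
  rcases hc' with rfl | rfl
  · obtain ⟨a, n, ha, hn⟩ := exists_charAct_ratLift hpos he R
    have hP := det_charMatrix hpos hK a n
    have hPu : IsUnit (charMatrix hpos a n).det := by rw [hP]; exact isUnit_one
    have hdet : (U * (charMatrix hpos a n)⁻¹).det = U.det := by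
      rw [det_mul, det_nonsing_inv, hP, Ring.inverse_one, mul_one]
    -- The basis of characteristic `M[0]` at `Z'` is `charMatrix` times that of characteristic `0`,
    -- so the matrix for `0` is multiplied by its inverse on the right.
    refine ⟨U * (charMatrix hpos a n)⁻¹, hdet ▸ hx1, hdet ▸ hx3, fun Z hZ _ C => ?_⟩
    rw [isBaseChange_char_iff hpos hM hZ ha hn]
    refine (hU Z hZ _).trans ⟨fun h => ?_, fun h => ?_⟩
    · rw [← Matrix.smul_mul, ← h, Matrix.mul_nonsing_inv_cancel_right _ _ hPu]
    · rw [h, ← Matrix.smul_mul, Matrix.nonsing_inv_mul_cancel_right _ _ hPu]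
  · exact ⟨U, hx1, hx3, fun Z hZ _ C => hU Z hZ C⟩
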